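/- Let $0<\lambda\le\Lambda$, $0<\delta_1\le\delta_0$ and $0<\beta_i\le\alpha_i<2$ for $i=1,2$. Let $J_1,J_2:\mathbb R^2\to[0,\infty)$ be measurable and even, and suppose that for $i=1,2$ and all $z\ne0$ $$\frac{\lambda}{|z|^{2+\beta_i}}\mathbf 1_{\{|z|\le\delta_1\}}\le J_i(z)\le\frac{\Lambda}{|z|^{2+\alpha_i}}\mathbf 1_{\{|z|\le\delta_0\}} .$$ Put $J=J_1+J_2$ and let $f\in C^1(\mathbb R)$. Let $u:\mathbb R^2\to\mathbb R$ be a bounded continuous function which solves $$\lim_{\epsilon\to0^+}\int_{\{|x-y|>\epsilon\}}[u(y)-u(x)]\,J(x-y)\,dy+f(u(x))=0\qquad\text{for every }x\in\mathbb R^2$$ (the limit is assumed to exist at every $x$), and which is stable, that is, for every $\zeta\in C_c^1(\mathbb R^2)$, $$\int_{\mathbb R^2}f'(u(x))\,\zeta(x)^2\,dx\le\frac12\int_{\mathbb R^2}\int_{\mathbb R^2}[\zeta(x)-\zeta(y)]^2J(x-y)\,dy\,dx .$$ Then $u$ is one-dimensional: there are a unit vector $e\in\mathbb R^2$ and a function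 $g:\mathbb R\to\mathbb R$ such that $u(x)=g(e\cdot x)$ for all $x\in\mathbb R^2$. -/

import Mathlib

open Filter Topology MeasureTheory

noncomputable section

/-- A jump kernel of convolution type on `ℝⁿ`: the function `z ↦ J z` standing for the symmetric
kernel `(x, y) ↦ J (x - y)`; it is measurable, nonnegative and even. -/
structure IsJumpKernel {n : ℕ} (J : EuclideanSpace ℝ (Fin n) → ℝ) : Prop where
  measurable : Measurable J
  nonneg : ∀ z, 0 ≤ J z
  even : ∀ z, J (-z) = J z

/-- The two-sided bound
`lam |z|^(-n-β) 1_{|z| ≤ δ₁} ≤ J z ≤ Lam |z|^(-n-α) 1_{|z| ≤ δ₀}` for all `z ≠ 0`. -/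
def TruncatedBounds {n : ℕ} (lam Lam δ₁ δ₀ β α : ℝ)
    (J : EuclideanSpace ℝ (Fin n) → ℝ) : Prop :=
  ∀ z : EuclideanSpace ℝ (Fin n), z ≠ 0 →
    (Metric.closedBall (0 : EuclideanSpace ℝ (Fin n)) δ₁).indicator
        (fun w => lam / ‖w‖ ^ ((n : ℝ) + β)) z ≤ J z ∧
    J z ≤ (Metric.closedBall (0 : EuclideanSpace ℝ (Fin n)) δ₀).indicator
        (fun w => Lam / ‖w‖ ^ ((n : ℝ) + α)) z

/-- The integral `∫_{|x - y| > ε} (u y - u x) K (x - y) dy`. -/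
def cutoffOperator {n : ℕ} (K : EuclideanSpace ℝ (Fin n) → ℝ) (ε : ℝ)
    (u : EuclideanSpace ℝ (Fin n) → ℝ) (x : EuclideanSpace ℝ (Fin n)) : ℝ :=
  ∫ y in {y | ε < ‖x - y‖}, (u y - u x) * K (x - y)

/-- `u` is a (continuous, pointwise) solution of
`lim_{ε → 0+} ∫_{|x - y| > ε} (u y - u x) K (x - y) dy + f (u x) = 0` in the whole space:
the principal value exists at every point and satisfies the equation there. -/
def IsNonlocalSolution {n : ℕ} (K : EuclideanSpace ℝ (Fin n) → ℝ) (f : ℝ → ℝ)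
    (u : EuclideanSpace ℝ (Fin n) → ℝ) : Prop :=
  Continuous u ∧
    ∀ x, Tendsto (fun ε : ℝ => cutoffOperator K ε u x + f (u x)) (𝓝[>] 0) (𝓝 0)

/-- Stability (nonnegative second variation of the energy): for every `ζ ∈ C_c^1`,
`∫ f'(u) ζ² ≤ ½ ∬ (ζ x - ζ y)² K (x - y) dy dx`. -/
def IsNonlocalStable {n : ℕ} (K : EuclideanSpace ℝ (Fin n) → ℝ) (f : ℝ → ℝ)
    (u : EuclideanSpace ℝ (Fin n) → ℝ) : Prop :=
  ∀ ζ : EuclideanSpace ℝ (Fin n) → ℝ, ContDiff ℝ 1 ζ → HasCompactSupport ζ →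
    ∫ x, deriv f (u x) * ζ x ^ 2 ≤
      (1 / 2) * ∫ x, ∫ y, (ζ x - ζ y) ^ 2 * K (x - y)

/-- `u` is one-dimensional: it depends on `x` only through `e · x` for a fixed unit vector `e`. -/
def IsOneDimensional {n : ℕ} (u : EuclideanSpace ℝ (Fin n) → ℝ) : Prop :=
  ∃ (e : EuclideanSpace ℝ (Fin n)) (g : ℝ → ℝ), ‖e‖ = 1 ∧ ∀ x, u x = g (inner ℝ e x)

end

/-! The heart of the proof is that every short increment `u (x + e) - u x` keeps one sign on the
whole plane. Granted this, the directions along which `u` increases form a closed set which together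
with its opposite covers the unit circle. The circle is connected, so some direction lies in both
sets, and `u` is constant along it; in the plane this is one-dimensionality
(`isOneDimensional_of_le_shift_or`).

For the sign, let `v` be the derivative of `u` along `e`, formally a solution of the linearised
equation, and let Q be the second variation, which is nonnegative by stability. Testing the equation
of `v` with a cutoff η gives Q(ηv) ≤ ½ ∬ v(x)² (η(x+z) - η(x))². For logarithmic cutoffs at scale
exp T this is O(1/T), because `v` has uniformly bounded local mean squares and the dimension is two
(`FiniteRange.exists_logCutoff_le`). On the other hand, Q is submodular with a quantitative gain:
Q(max(a,b)) + Q(min(a,b)) ≤ Q(a) + Q(b) - ∬ (b-a)₊(x) (a-b)₊(x+z). With a = ηv and T → ∞ this bounds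
the interaction of `v` with any competitor ψ by Q(ψ) (`PVSolution.interaction_limit_le`). Replacing
ψ by sψ with ψ ≥ 0, the part of the left side over {v ≤ 0} is of first order in s and the right side
is of second order, so no jump leads from {v ≤ 0} to {v > 0} (`interaction_nonpos_eq_zero`). The
kernel is bounded below near the origin and the plane is connected, so {v ≤ 0} is null or of full
measure.

Two regularity questions remain, since `u` is merely continuous. The pointwise principal value
equation is turned into a weak one by sup-convolution (`PVSolution.weak_eq`); as the kernel is
translation invariant, mollification then yields smooth solutions of equations with mollified right
sides, and every identity is proved for these and passed to the limit. The derivative `v` exists as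
a limit of dyadic difference quotients: a Caccioppoli inequality with exponential weight and the
lower bound on the kernel control second increments by |h|^β times first increments in weighted mean
square, so consecutive quotients differ by a geometrically small amount
(`PVSolution.exists_dyadicQuotient_le`). -/

/-! ### Jump measures, regular solutions and the weighted energy identity. -/

/-- The Euclidean plane. -/
abbrev Plane := EuclideanSpace ℝ (Fin 2)

/-- An even measure of jumps of length at most `δ₀`, with finite second moment. -/
structure FiniteRange (ν : Measure Plane) (δ₀ : ℝ) : Prop where
  neg : MeasurePreserving (fun z : Plane => -z) ν ν
  range : ∀ᵐ z ∂ν, ‖z‖ ≤ δ₀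
  sq : Integrable (fun z : Plane => ‖z‖ ^ 2) ν

/-- `v` is bounded and regular, and `½ ∫ (v (x + z) + v (x - z) - 2 v x) dν z = - g x`. -/
structure RegularSolution (ν : Measure Plane) (v g : Plane → ℝ) : Prop where
  cont : Continuous v
  bdd : ∃ C, ∀ x, |v x| ≤ C
  lip : ∃ C, ∀ x z, |v (x + z) - v x| ≤ C * ‖z‖
  sec : ∃ C, ∀ x z, |v (x + z) + v (x - z) - 2 * v x| ≤ C * ‖z‖ ^ 2
  contg : Continuous g
  bddg : ∃ C, ∀ x, |g x| ≤ C
  eq : ∀ x, (1 / 2) * ∫ z, (v (x + z) + v (x - z) - 2 * v x) ∂ν = - g x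

/-- A continuous weight `η` dominated, together with its increments, by the square integrable
function `m`. -/
structure IsWeight (δ₀ : ℝ) (η m : Plane → ℝ) : Prop where
  cont : Continuous η
  int : Integrable (fun x => m x ^ 2)
  le : ∀ x, |η x| ≤ m x
  diff : ∀ x z, ‖z‖ ≤ δ₀ → |η (x + z) - η x| ≤ ‖z‖ * m x


namespace FiniteRange

variable {ν : Measure Plane} {δ₀ : ℝ}

theorem ae_prod [SFinite ν] (hν : FiniteRange ν δ₀) :
    ∀ᵐ p : Plane × Plane ∂(ν.prod volume), ‖p.1‖ ≤ δ₀ :=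
  Measure.quasiMeasurePreserving_fst.ae hν.range

/-- In the coordinates (z, x) for a jump from x to x + z, this map exchanges the two endpoints;
invariance is the symmetry of the kernel. -/
theorem measurePreserving_flip [SFinite ν] (hν : FiniteRange ν δ₀) :
    MeasurePreserving (fun p : Plane × Plane => (-p.1, p.2 + p.1)) (ν.prod volume)
      (ν.prod volume) := by
  refine hν.neg.skew_product (g := fun z x => x + z) (by fun_prop) ?_
  exact Filter.Eventually.of_forall fun z => (measurePreserving_add_right volume z).map_eq

theorem integral_flip [SFinite ν] (hν : FiniteRange ν δ₀) {F : Plane × Plane → ℝ}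
    (hF : AEStronglyMeasurable F (ν.prod volume)) :
    ∫ p, F (-p.1, p.2 + p.1) ∂(ν.prod volume) = ∫ p, F p ∂(ν.prod volume) := by
  conv_rhs => rw [← hν.measurePreserving_flip.map_eq]
  rw [integral_map hν.measurePreserving_flip.measurable.aemeasurable]
  rwa [hν.measurePreserving_flip.map_eq]

theorem integrable_prod [SFinite ν] (hν : FiniteRange ν δ₀) {F : Plane × Plane → ℝ}
    (hF : AEStronglyMeasurable F (ν.prod volume)) {M : Plane → ℝ} (hM : Integrable M) {C : ℝ}
    (h : ∀ z x, ‖z‖ ≤ δ₀ → |F (z, x)| ≤ C * ‖z‖ ^ 2 * M x) : Integrable F (ν.prod volume) := by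
  have := (hν.sq.mul_prod hM).const_mul C
  refine this.mono' hF ?_
  filter_upwards [hν.ae_prod] with p hp
  have := h p.1 p.2 hp
  rw [Real.norm_eq_abs]
  simpa [mul_assoc] using this

theorem nonneg_sq (_hν : FiniteRange ν δ₀) : 0 ≤ ∫ z, ‖z‖ ^ 2 ∂ν :=
  integral_nonneg fun z => by positivity

end FiniteRange

theorem IsWeight.nonneg {δ₀ : ℝ} {η m : Plane → ℝ} (h : IsWeight δ₀ η m) (x : Plane) : 0 ≤ m x :=
  (abs_nonneg _).trans (h.le x)

theorem IsWeight.le_shift {δ₀ : ℝ} {η m : Plane → ℝ} (h : IsWeight δ₀ η m) {x z : Plane}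
    (hz : ‖z‖ ≤ δ₀) : |η (x + z)| ≤ (1 + δ₀) * m x := by
  have h1 := h.diff x z hz
  have h2 := h.le x
  have h3 : |η (x + z)| ≤ |η (x + z) - η x| + |η x| := by
    simpa using abs_add_le (η (x + z) - η x) (η x)
  nlinarith [h.nonneg x]

namespace RegularSolution

variable {ν : Measure Plane} {δ₀ : ℝ} {v g η m : Plane → ℝ}

theorem integrable_sq_diff [SFinite ν] (hν : FiniteRange ν δ₀) (hv : RegularSolution ν v g)
    (hη : IsWeight δ₀ η m) :
    Integrable (fun p : Plane × Plane => (η (p.2 + p.1) * v (p.2 + p.1) - η p.2 * v p.2) ^ 2)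
      (ν.prod volume) := by
  obtain ⟨C, hC⟩ := hv.bdd
  obtain ⟨L, hL⟩ := hv.lip
  have hc := hv.cont
  have hc' := hη.cont
  refine hν.integrable_prod (M := fun x => m x ^ 2) (C := ((1 + δ₀) * L + C) ^ 2)
    (by fun_prop) hη.int fun z x hz => ?_
  have h0 := hη.nonneg x
  have hL0 : 0 ≤ L * ‖z‖ := (abs_nonneg _).trans (hL x z)
  have e : η (x + z) * v (x + z) - η x * v x
      = η (x + z) * (v (x + z) - v x) + (η (x + z) - η x) * v x := by ring
  have : |η (x + z) * v (x + z) - η x * v x| ≤ ((1 + δ₀) * L + C) * ‖z‖ * m x := by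
    rw [e]
    calc _ ≤ |η (x + z)| * |v (x + z) - v x| + |η (x + z) - η x| * |v x| := by
          rw [← abs_mul, ← abs_mul]; exact abs_add_le _ _
      _ ≤ ((1 + δ₀) * m x) * (L * ‖z‖) + (‖z‖ * m x) * C := by
          have hA := hη.le_shift (x := x) hz
          gcongr
          · exact (abs_nonneg _).trans hA
          · exact hL x z
          · exact hη.diff x z hz
          · exact hC x
      _ = _ := by ring
  rw [abs_pow]
  calc _ ≤ (((1 + δ₀) * L + C) * ‖z‖ * m x) ^ 2 := by gcongr
    _ = _ := by ring

end RegularSolution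

theorem FiniteRange.integrable_weight {ν : Measure Plane} {δ₀ : ℝ} [SFinite ν]
    (hν : FiniteRange ν δ₀)
    {v η m : Plane → ℝ} (hv : Measurable v) {C : ℝ} (hC : ∀ x, |v x| ≤ C)
    (hη : IsWeight δ₀ η m) :
    Integrable (fun p : Plane × Plane => v p.2 * v (p.2 + p.1) * (η (p.2 + p.1) - η p.2) ^ 2)
      (ν.prod volume) := by
  have hc' := hη.cont
  refine hν.integrable_prod (M := fun x => m x ^ 2) (C := C ^ 2)
    (Measurable.aestronglyMeasurable (by fun_prop)) hη.int fun z x hz => ?_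
  have hC0 : 0 ≤ C := (abs_nonneg _).trans (hC x)
  rw [abs_mul, abs_mul, abs_pow]
  calc _ ≤ C * C * (‖z‖ * m x) ^ 2 := by
        gcongr
        · exact hC x
        · exact hC _
        · exact hη.diff x z hz
    _ = _ := by ring

namespace RegularSolution

variable {ν : Measure Plane} {δ₀ : ℝ} {v g η m : Plane → ℝ}

/-- Summation by parts: translating the `x - z` term by `z` makes the integrand symmetric in the two
endpoints, after which the identity is pointwise algebra. -/
theorem integral_second_diff (hv : RegularSolution ν v g)
    (hη : IsWeight δ₀ η m) (z : Plane) :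
    ∫ x, η x ^ 2 * v x * (v (x + z) + v (x - z) - 2 * v x) =
      ∫ x, (v x * v (x + z) * (η (x + z) - η x) ^ 2 -
        (η (x + z) * v (x + z) - η x * v x) ^ 2) := by
  obtain ⟨C, hC⟩ := hv.bdd
  have hc := hv.cont
  have hc' := hη.cont
  have hζ : Integrable (fun x => η x ^ 2 * v x) := by
    refine (hη.int.mul_const C).mono' (by fun_prop) (Eventually.of_forall fun x => ?_)
    rw [Real.norm_eq_abs, abs_mul, abs_pow]
    have := hη.le x
    gcongr
    exact hC x
  have hb : ∀ y x, ‖v y - v x‖ ≤ 2 * C := fun y x => by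
    rw [Real.norm_eq_abs, abs_le]
    have h1 := abs_le.1 (hC x); have h2 := abs_le.1 (hC y)
    constructor <;> linarith
  have i1 : Integrable (fun x => η x ^ 2 * v x * (v (x + z) - v x)) :=
    hζ.mul_bdd (c := 2 * C) (by fun_prop) (Eventually.of_forall fun x => hb _ _)
  have i2 : Integrable (fun x => η x ^ 2 * v x * (v (x - z) - v x)) :=
    hζ.mul_bdd (c := 2 * C) (by fun_prop) (Eventually.of_forall fun x => hb _ _)
  have i3 : Integrable (fun x => η (x + z) ^ 2 * v (x + z) * (v x - v (x + z))) := by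
    simpa using i2.comp_add_right z
  calc _ = ∫ x, (η x ^ 2 * v x * (v (x + z) - v x) + η x ^ 2 * v x * (v (x - z) - v x)) := by
        congr 1; ext x; ring
    _ = (∫ x, η x ^ 2 * v x * (v (x + z) - v x)) + ∫ x, η x ^ 2 * v x * (v (x - z) - v x) :=
        integral_add i1 i2
    _ = (∫ x, η x ^ 2 * v x * (v (x + z) - v x)) +
          ∫ x, η (x + z) ^ 2 * v (x + z) * (v x - v (x + z)) := by
        rw [← integral_add_right_eq_self (fun x => η x ^ 2 * v x * (v (x - z) - v x)) z]
        simp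
    _ = _ := by
        rw [← integral_add i1 i3]
        congr 1; ext x; ring

/-- The energy of `η v` for a regular solution `v`. -/
theorem energy_identity [SFinite ν] (hν : FiniteRange ν δ₀) (hv : RegularSolution ν v g)
    (hη : IsWeight δ₀ η m) :
    (1 / 2) * ∫ p : Plane × Plane, (η (p.2 + p.1) * v (p.2 + p.1) - η p.2 * v p.2) ^ 2
        ∂(ν.prod volume) =
      (∫ x, g x * v x * η x ^ 2) + (1 / 2) * ∫ p : Plane × Plane,
        v p.2 * v (p.2 + p.1) * (η (p.2 + p.1) - η p.2) ^ 2 ∂(ν.prod volume) := by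
  obtain ⟨C, hC⟩ := hv.bdd
  obtain ⟨D, hD⟩ := hv.sec
  have hc := hv.cont
  have hc' := hη.cont
  have j1 := hv.integrable_sq_diff hν hη
  have j2 := hν.integrable_weight hv.cont.measurable hC hη
  have j3 : Integrable (fun p : Plane × Plane =>
      η p.2 ^ 2 * v p.2 * (v (p.2 + p.1) + v (p.2 - p.1) - 2 * v p.2)) (ν.prod volume) := by
    refine hν.integrable_prod (M := fun x => m x ^ 2) (C := C * D) (by fun_prop) hη.int
      fun z x hz => ?_
    have hC0 : 0 ≤ C := (abs_nonneg _).trans (hC x)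
    rw [abs_mul, abs_mul, abs_pow]
    calc _ ≤ m x ^ 2 * C * (D * ‖z‖ ^ 2) := by
          have := hη.le x
          gcongr
          · exact hC x
          · exact hD x z
      _ = _ := by ring
  -- The equation multiplied by `v η²` and integrated in `x`.
  have e1 : ∫ x, g x * v x * η x ^ 2 = -(1 / 2) * ∫ p : Plane × Plane,
      η p.2 ^ 2 * v p.2 * (v (p.2 + p.1) + v (p.2 - p.1) - 2 * v p.2) ∂(ν.prod volume) := by
    rw [integral_prod_symm _ j3, ← integral_const_mul]
    congr 1; ext x
    dsimp only
    rw [integral_const_mul]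
    have := hv.eq x
    linear_combination (v x * η x ^ 2) * this
  have e2 : ∫ p : Plane × Plane,
      η p.2 ^ 2 * v p.2 * (v (p.2 + p.1) + v (p.2 - p.1) - 2 * v p.2) ∂(ν.prod volume) =
      (∫ p : Plane × Plane,
        v p.2 * v (p.2 + p.1) * (η (p.2 + p.1) - η p.2) ^ 2 ∂(ν.prod volume)) -
      ∫ p : Plane × Plane, (η (p.2 + p.1) * v (p.2 + p.1) - η p.2 * v p.2) ^ 2
        ∂(ν.prod volume) := by
    have j4 : Integrable (fun p : Plane × Plane =>
        v p.2 * v (p.2 + p.1) * (η (p.2 + p.1) - η p.2) ^ 2 -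
          (η (p.2 + p.1) * v (p.2 + p.1) - η p.2 * v p.2) ^ 2) (ν.prod volume) := j2.sub j1
    rw [← integral_sub j2 j1, integral_prod _ j3, integral_prod _ j4]
    refine integral_congr_ae ?_
    exact Eventually.of_forall fun z => hv.integral_second_diff hη z
  rw [e1, e2]; ring

end RegularSolution

/-! ### Exponential weights and the Caccioppoli inequality. -/

/-- The exponential weight centred at `x₀`. -/
noncomputable def expWeight (x₀ x : Plane) : ℝ := Real.exp (-‖x - x₀‖)

namespace expWeight

theorem pos (x₀ x : Plane) : 0 < expWeight x₀ x := Real.exp_pos _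

theorem continuous (x₀ : Plane) : Continuous (expWeight x₀) := by
  unfold expWeight; fun_prop

theorem eq_translate (x₀ x : Plane) : expWeight x₀ x = expWeight 0 (x - x₀) := by
  simp [expWeight]

theorem integrable_zero : Integrable (fun x => expWeight 0 x ^ 2) := by
  have h3 : ((Module.finrank ℝ Plane : ℕ) : ℝ) < 3 := by simp; norm_num
  -- The constant is (3/2)³: exp(2t/3) ≥ (2/3)(1 + t), cubed and inverted.
  have h := (integrable_one_add_norm (E := Plane) (μ := volume) h3).const_mul (27 / 8)
  refine h.mono' ((continuous 0).pow 2).aestronglyMeasurable (Eventually.of_forall fun x => ?_)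
  have hx := norm_nonneg x
  rw [Real.norm_eq_abs, abs_of_nonneg (by positivity), Real.rpow_neg (by positivity)]
  have e1 : (1 + ‖x‖) ^ (3 : ℝ) = (1 + ‖x‖) ^ 3 := by norm_cast
  rw [e1]
  have e2 : expWeight 0 x ^ 2 = (Real.exp (2 * ‖x‖ / 3) ^ 3)⁻¹ := by
    rw [expWeight, ← Real.exp_nat_mul, ← Real.exp_nat_mul, ← Real.exp_neg]
    congr 1; push_cast; simp; ring
  rw [e2]
  have h1 : 2 / 3 * (1 + ‖x‖) ≤ Real.exp (2 * ‖x‖ / 3) := by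
    have := Real.add_one_le_exp (2 * ‖x‖ / 3)
    linarith
  calc _ ≤ ((2 / 3 * (1 + ‖x‖)) ^ 3)⁻¹ := by gcongr
    _ = _ := by rw [mul_pow, mul_inv]; norm_num

theorem integrable (x₀ : Plane) : Integrable (fun x => expWeight x₀ x ^ 2) := by
  have := integrable_zero.comp_sub_right x₀
  simpa only [← eq_translate] using this

theorem integral_eq (x₀ : Plane) :
    ∫ x, expWeight x₀ x ^ 2 = ∫ x, expWeight 0 x ^ 2 := by
  simp only [eq_translate x₀]
  exact integral_sub_right_eq_self (fun x => expWeight 0 x ^ 2) x₀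

theorem abs_exp_sub_one_le (t : ℝ) : |Real.exp t - 1| ≤ |t| * Real.exp |t| := by
  rcases le_total 0 t with ht | ht
  · rw [abs_of_nonneg ht, abs_of_nonneg (by linarith [Real.add_one_le_exp t])]
    have h1 := Real.add_one_le_exp (-t)
    have h2 : Real.exp (-t) * Real.exp t = 1 := by rw [← Real.exp_add]; simp
    nlinarith [Real.exp_pos t]
  · rw [abs_of_nonpos ht, abs_of_nonpos (by linarith [Real.exp_le_one_iff.2 ht])]
    have h1 := Real.add_one_le_exp t
    have h2 : 1 ≤ Real.exp (-t) := Real.one_le_exp (by linarith)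
    nlinarith

theorem abs_sub_le (x₀ x z : Plane) :
    |expWeight x₀ (x + z) - expWeight x₀ x| ≤ ‖z‖ * (Real.exp ‖z‖ * expWeight x₀ x) := by
  set t := ‖x - x₀‖ - ‖x + z - x₀‖ with ht
  have e : expWeight x₀ (x + z) - expWeight x₀ x = (Real.exp t - 1) * expWeight x₀ x := by
    rw [expWeight, expWeight, sub_mul, ← Real.exp_add, ht]; ring_nf
  have h1 : |t| ≤ ‖z‖ := by
    have := abs_norm_sub_norm_le (x - x₀) (x + z - x₀)
    simpa [ht] using this
  rw [e, abs_mul, abs_of_pos (pos x₀ x), ← mul_assoc]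
  have := abs_exp_sub_one_le t
  have h2 := pos x₀ x
  gcongr
  exact this.trans (by gcongr)

theorem isWeight {δ₀ : ℝ} (hδ : 0 ≤ δ₀) (x₀ : Plane) :
    IsWeight δ₀ (expWeight x₀) (fun x => Real.exp δ₀ * expWeight x₀ x) where
  cont := continuous x₀
  int := by simpa only [mul_pow] using (integrable x₀).const_mul _
  le x := by
    rw [abs_of_pos (pos x₀ x)]
    have := pos x₀ x
    have := Real.one_le_exp hδ
    nlinarith
  diff x z hz := by
    have := pos x₀ x
    exact (abs_sub_le x₀ x z).trans (by gcongr)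

theorem integrable_mul (x₀ : Plane) {w : Plane → ℝ} (hw : Measurable w) {C : ℝ}
    (hC : ∀ x, |w x| ≤ C) : Integrable (fun x => expWeight x₀ x ^ 2 * w x ^ 2) := by
  refine (integrable x₀).mul_bdd (c := C ^ 2) (by fun_prop) (Eventually.of_forall fun x => ?_)
  rw [Real.norm_eq_abs, abs_pow]
  have := hC x
  gcongr

end expWeight

theorem FiniteRange.integrable_weight_sq {ν : Measure Plane} {δ₀ : ℝ} [SFinite ν]
    (hν : FiniteRange ν δ₀)
    {v η m : Plane → ℝ} (hv : Measurable v) {C : ℝ} (hC : ∀ x, |v x| ≤ C)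
    (hη : IsWeight δ₀ η m) :
    Integrable (fun p : Plane × Plane => v p.2 ^ 2 * (η (p.2 + p.1) - η p.2) ^ 2)
      (ν.prod volume) := by
  have hc' := hη.cont
  refine hν.integrable_prod (M := fun x => m x ^ 2) (C := C ^ 2)
    (Measurable.aestronglyMeasurable (by fun_prop)) hη.int fun z x hz => ?_
  have hC0 : 0 ≤ C := (abs_nonneg _).trans (hC x)
  rw [abs_mul, abs_pow, abs_pow]
  calc _ ≤ C ^ 2 * (‖z‖ * m x) ^ 2 := by
        gcongr
        · exact hC x
        · exact hη.diff x z hz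
    _ = _ := by ring

/-- Young's inequality on `v x * v (x + z)`; exchanging endpoints shows that the two resulting
squares contribute equally. -/
theorem FiniteRange.integral_weight_le {ν : Measure Plane} {δ₀ : ℝ} [SFinite ν]
    (hν : FiniteRange ν δ₀)
    {v η m : Plane → ℝ} (hv : Measurable v) {C : ℝ} (hC : ∀ x, |v x| ≤ C)
    (hη : IsWeight δ₀ η m) :
    ∫ p : Plane × Plane, v p.2 * v (p.2 + p.1) * (η (p.2 + p.1) - η p.2) ^ 2
        ∂(ν.prod volume) ≤
      ∫ p : Plane × Plane, v p.2 ^ 2 * (η (p.2 + p.1) - η p.2) ^ 2 ∂(ν.prod volume) := by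
  have hc' := hη.cont
  have j1 := hν.integrable_weight hv hC hη
  have j2 := hν.integrable_weight_sq hv hC hη
  have e := hν.integral_flip j2.aestronglyMeasurable
  have j3 := hν.measurePreserving_flip.integrable_comp_of_integrable j2
  simp only [Function.comp_def, add_neg_cancel_right] at e j3
  have : ∫ p : Plane × Plane, v p.2 * v (p.2 + p.1) * (η (p.2 + p.1) - η p.2) ^ 2
        ∂(ν.prod volume) ≤ ∫ p : Plane × Plane, (1 / 2 * (v p.2 ^ 2 * (η (p.2 + p.1) - η p.2) ^ 2)
          + 1 / 2 * (v (p.2 + p.1) ^ 2 * (η p.2 - η (p.2 + p.1)) ^ 2)) ∂(ν.prod volume) := by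
    refine integral_mono j1 ((j2.const_mul _).add (j3.const_mul _)) fun p => ?_
    dsimp only [Pi.add_apply]
    nlinarith [sq_nonneg ((v p.2 - v (p.2 + p.1)) * (η (p.2 + p.1) - η p.2))]
  rw [integral_add (j2.const_mul _) (j3.const_mul _), integral_const_mul, integral_const_mul, e]
    at this
  linarith

/-- Caccioppoli inequality with an exponential weight. -/
theorem RegularSolution.energy_le {ν : Measure Plane} {δ₀ : ℝ} [SFinite ν]
    (hν : FiniteRange ν δ₀) (hδ : 0 ≤ δ₀) {v g : Plane → ℝ} (hv : RegularSolution ν v g)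
    (x₀ : Plane) :
    ∫ p : Plane × Plane, (expWeight x₀ (p.2 + p.1) * v (p.2 + p.1) - expWeight x₀ p.2 * v p.2) ^ 2
        ∂(ν.prod volume) ≤
      (1 + Real.exp δ₀ ^ 2 * ∫ z, ‖z‖ ^ 2 ∂ν) *
        ((∫ x, expWeight x₀ x ^ 2 * v x ^ 2) + ∫ x, expWeight x₀ x ^ 2 * g x ^ 2) := by
  obtain ⟨C, hC⟩ := hv.bdd
  obtain ⟨D, hD⟩ := hv.bddg
  have hη := expWeight.isWeight hδ x₀
  have hc := hv.cont
  have hcg := hv.contg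
  have hc' := hη.cont
  have key := hv.energy_identity hν hη
  have i1 := expWeight.integrable_mul x₀ hc.measurable hC
  have i2 := expWeight.integrable_mul x₀ hcg.measurable hD
  have h1 : ∫ x, g x * v x * expWeight x₀ x ^ 2 ≤
      1 / 2 * (∫ x, expWeight x₀ x ^ 2 * v x ^ 2) + 1 / 2 * ∫ x, expWeight x₀ x ^ 2 * g x ^ 2 := by
    rw [← integral_const_mul, ← integral_const_mul,
      ← integral_add (i1.const_mul _) (i2.const_mul _)]
    have i3 : Integrable (fun x => g x * v x * expWeight x₀ x ^ 2) := by
      refine (i1.add i2).mono' (by fun_prop) (Eventually.of_forall fun x => ?_)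
      rw [Real.norm_eq_abs, abs_le]
      constructor <;> simp only [Pi.add_apply] <;>
        nlinarith [mul_nonneg (sq_nonneg (expWeight x₀ x)) (sq_nonneg (g x - v x)),
          mul_nonneg (sq_nonneg (expWeight x₀ x)) (sq_nonneg (g x + v x)),
          mul_nonneg (sq_nonneg (expWeight x₀ x)) (sq_nonneg (g x)),
          mul_nonneg (sq_nonneg (expWeight x₀ x)) (sq_nonneg (v x))]
    refine integral_mono i3 ((i1.const_mul _).add (i2.const_mul _)) fun x => ?_
    dsimp only [Pi.add_apply]
    nlinarith [mul_nonneg (sq_nonneg (expWeight x₀ x)) (sq_nonneg (g x - v x))]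
  have h2 := hν.integral_weight_le hc.measurable hC hη
  have h3 : ∫ p : Plane × Plane, v p.2 ^ 2 * (expWeight x₀ (p.2 + p.1) - expWeight x₀ p.2) ^ 2
        ∂(ν.prod volume) ≤
      Real.exp δ₀ ^ 2 * (∫ z, ‖z‖ ^ 2 ∂ν) * ∫ x, expWeight x₀ x ^ 2 * v x ^ 2 := by
    rw [mul_assoc, ← integral_prod_mul, ← integral_const_mul]
    refine integral_mono_ae (hν.integrable_weight_sq hc.measurable hC hη)
      ((hν.sq.mul_prod i1).const_mul _) ?_
    filter_upwards [hν.ae_prod] with p hp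
    have := hη.diff p.2 p.1 hp
    have h4 : (expWeight x₀ (p.2 + p.1) - expWeight x₀ p.2) ^ 2 ≤
        (‖p.1‖ * (Real.exp δ₀ * expWeight x₀ p.2)) ^ 2 := by
      rw [← sq_abs]; gcongr
    calc _ ≤ v p.2 ^ 2 * (‖p.1‖ * (Real.exp δ₀ * expWeight x₀ p.2)) ^ 2 := by gcongr
      _ = _ := by ring
  have h5 : 0 ≤ (Real.exp δ₀ ^ 2 * ∫ z, ‖z‖ ^ 2 ∂ν) * ∫ x, expWeight x₀ x ^ 2 * g x ^ 2 :=
    mul_nonneg (mul_nonneg (by positivity) hν.nonneg_sq) (integral_nonneg fun x => by positivity)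
  nlinarith

/-! ### Fractional regularity from the lower bound on the kernel. -/

/-- The measure `ν` dominates `c r ^ (-2 - β)` times the Lebesgue measure on small balls of
radius `r`. -/
def DominatesBalls (ν : Measure Plane) (c β δ₁ : ℝ) : Prop :=
  ∀ r, 0 < r → r ≤ δ₁ →
    ENNReal.ofReal (c * r ^ (-(2 + β))) • volume.restrict (Metric.ball (0 : Plane) r) ≤ ν

namespace DominatesBalls

variable {ν : Measure Plane} {c β δ₁ : ℝ}

theorem integrableOn (hν : DominatesBalls ν c β δ₁) (hc : 0 < c) {G : Plane → ℝ}
    (hG : Integrable G ν) {r : ℝ} (hr : 0 < r) (hr' : r ≤ δ₁) :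
    IntegrableOn G (Metric.ball 0 r) := by
  have h := hG.mono_measure (hν r hr hr')
  rwa [integrable_smul_measure (by simp; positivity) (by simp)] at h

theorem setIntegral_le (hν : DominatesBalls ν c β δ₁) (hc : 0 < c) {G : Plane → ℝ}
    (hG : Integrable G ν) (hG0 : ∀ z, 0 ≤ G z) {r : ℝ} (hr : 0 < r) (hr' : r ≤ δ₁) :
    ∫ z in Metric.ball 0 r, G z ≤ r ^ (2 + β) / c * ∫ z, G z ∂ν := by
  have h := integral_mono_measure (hν r hr hr') (Eventually.of_forall hG0) hG
  rw [integral_smul_measure, ENNReal.toReal_ofReal (by positivity), smul_eq_mul,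
    Real.rpow_neg hr.le] at h
  have h2 : 0 < r ^ (2 + β) := by positivity
  rw [div_mul_eq_mul_div, le_div_iff₀ hc]
  have h3 := mul_le_mul_of_nonneg_left h h2.le
  have e : r ^ (2 + β) * (c * (r ^ (2 + β))⁻¹ * ∫ z in Metric.ball 0 r, G z) =
    (∫ z in Metric.ball 0 r, G z) * c := by field_simp
  rwa [e] at h3

end DominatesBalls

/-- For z in the ball of radius r, the complementary displacement h - z stays in the ball of radius
2r. -/
theorem setIntegral_ball_comp_sub_le {G : Plane → ℝ} (hG0 : ∀ z, 0 ≤ G z) {r : ℝ}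
    (hG : IntegrableOn G (Metric.ball 0 (2 * r))) {h : Plane} (hh : ‖h‖ ≤ r) :
    IntegrableOn (fun z => G (h - z)) (Metric.ball 0 r) ∧
    ∫ z in Metric.ball 0 r, G (h - z) ≤ ∫ z in Metric.ball 0 (2 * r), G z := by
  have hI : Integrable ((Metric.ball (0 : Plane) (2 * r)).indicator G) :=
    (integrable_indicator_iff measurableSet_ball).2 hG
  have hI' := hI.comp_sub_left h
  have e : ∀ z ∈ Metric.ball (0 : Plane) r,
      (Metric.ball (0 : Plane) (2 * r)).indicator G (h - z) = G (h - z) := fun z hz => by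
    rw [Set.indicator_of_mem]
    rw [mem_ball_zero_iff] at hz ⊢
    have := norm_sub_le h z
    linarith
  constructor
  · exact (hI'.integrableOn (s := Metric.ball (0 : Plane) r)).congr_fun e measurableSet_ball
  · rw [← setIntegral_congr_fun measurableSet_ball e]
    calc _ ≤ ∫ z, (Metric.ball (0 : Plane) (2 * r)).indicator G (h - z) := by
          refine setIntegral_le_integral hI' (Eventually.of_forall fun z => ?_)
          exact Set.indicator_nonneg (fun z _ => hG0 z) _
      _ = ∫ z, (Metric.ball (0 : Plane) (2 * r)).indicator G z :=
          integral_sub_left_eq_self _ volume h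
      _ = _ := integral_indicator measurableSet_ball

/-- The displacement h is split through the intermediate point x + z; z is averaged later. -/
theorem integral_sq_diff_le {w : Plane → ℝ} (hw : Continuous w)
    (hw2 : Integrable (fun x => w x ^ 2)) (h z : Plane) :
    ∫ x, (w (x + h) - w x) ^ 2 ≤
      2 * (∫ x, (w (x + z) - w x) ^ 2) + 2 * ∫ x, (w (x + (h - z)) - w x) ^ 2 := by
  have hd : ∀ z, Integrable (fun x => (w (x + z) - w x) ^ 2) := fun z => by
    refine ((hw2.comp_add_right z).const_mul 2 |>.add (hw2.const_mul 2)).mono' (by fun_prop)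
      (Eventually.of_forall fun x => ?_)
    rw [Real.norm_eq_abs, abs_of_nonneg (by positivity)]
    simp only [Pi.add_apply]
    nlinarith [sq_nonneg (w (x + z) + w x)]
  have e : ∫ x, (w (x + (h - z)) - w x) ^ 2 = ∫ x, (w (x + h) - w (x + z)) ^ 2 := by
    rw [← integral_add_right_eq_self (fun x => (w (x + (h - z)) - w x) ^ 2) z]
    congr 1; ext x; rw [show x + z + (h - z) = x + h by abel]
  have i : Integrable (fun x => (w (x + h) - w (x + z)) ^ 2) := by
    refine ((hd (h - z)).comp_add_right z).congr (Eventually.of_forall fun x => ?_)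
    dsimp only
    rw [show x + z + (h - z) = x + h by abel]
  rw [e, ← integral_const_mul, ← integral_const_mul,
    ← integral_add ((hd z).const_mul 2) (i.const_mul 2)]
  refine integral_mono (hd h) (((hd z).const_mul 2).add (i.const_mul 2)) fun x => ?_
  dsimp only
  nlinarith [sq_nonneg ((w (x + z) - w x) - (w (x + h) - w (x + z)))]

/-- Fractional regularity of square integrable functions with finite energy. -/
theorem DominatesBalls.integral_sq_diff_le {ν : Measure Plane} [SFinite ν] {c β δ₁ : ℝ}
    (hν : DominatesBalls ν c β δ₁) (hc : 0 < c) {w : Plane → ℝ} (hw : Continuous w)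
    (hw2 : Integrable (fun x => w x ^ 2))
    (hE : Integrable (fun p : Plane × Plane => (w (p.2 + p.1) - w p.2) ^ 2) (ν.prod volume))
    {h : Plane} (h0 : h ≠ 0) (hh : 2 * ‖h‖ ≤ δ₁) :
    ∫ x, (w (x + h) - w x) ^ 2 ≤ 4 * 2 ^ (2 + β) / (Real.pi * c) * ‖h‖ ^ β *
      ∫ p : Plane × Plane, (w (p.2 + p.1) - w p.2) ^ 2 ∂(ν.prod volume) := by
  set G : Plane → ℝ := fun z => ∫ x, (w (x + z) - w x) ^ 2 with hG
  have hr : 0 < ‖h‖ := norm_pos_iff.2 h0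
  have hG0 : ∀ z, 0 ≤ G z := fun z => integral_nonneg fun x => by positivity
  have hGi : Integrable G ν := hE.integral_prod_left
  rw [integral_prod _ hE]
  change G h ≤ _ * ∫ z, G z ∂ν
  have h2 := hν.integrableOn hc hGi (r := 2 * ‖h‖) (by positivity) hh
  have h1 : IntegrableOn G (Metric.ball 0 ‖h‖) :=
    h2.mono_set (Metric.ball_subset_ball (by linarith))
  obtain ⟨h3, h4⟩ := setIntegral_ball_comp_sub_le hG0 h2 le_rfl
  have h5 : ∫ z in Metric.ball 0 ‖h‖, G z ≤ ∫ z in Metric.ball 0 (2 * ‖h‖), G z :=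
    setIntegral_mono_set h2 (Eventually.of_forall hG0)
      (Metric.ball_subset_ball (by linarith)).eventuallyLE
  have h6 := hν.setIntegral_le hc hGi hG0 (r := 2 * ‖h‖) (by positivity) hh
  -- Averaging over z in the ball of radius |h|: both halves of the path are integrals over the ball
  -- of radius 2|h|, which the energy controls with the factor (2|h|)^(2+β)/c. Dividing by the area
  -- π|h|² leaves |h|^β.
  have h7 : ∫ z in Metric.ball (0 : Plane) ‖h‖, G h ≤
      ∫ z in Metric.ball (0 : Plane) ‖h‖, (2 * G z + 2 * G (h - z)) := by
    refine integral_mono (integrableOn_const measure_ball_lt_top.ne) ((h1.const_mul 2).add (h3.const_mul 2)) fun z => ?_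
    exact _root_.integral_sq_diff_le hw hw2 h z
  rw [integral_add (h1.const_mul 2) (h3.const_mul 2), integral_const_mul, integral_const_mul,
    setIntegral_const, measureReal_def, EuclideanSpace.volume_ball_fin_two] at h7
  simp only [smul_eq_mul, ENNReal.toReal_mul, ENNReal.toReal_pow,
    ENNReal.toReal_ofReal hr.le, ENNReal.toReal_ofReal Real.pi_pos.le] at h7
  have h8 : (2 * ‖h‖) ^ (2 + β) = 2 ^ (2 + β) * (‖h‖ ^ 2 * ‖h‖ ^ β) := by
    rw [Real.mul_rpow (by norm_num) hr.le, Real.rpow_add hr]; norm_cast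
  rw [h8] at h6
  have h9 : ‖h‖ ^ 2 * Real.pi * G h ≤
      4 * (2 ^ (2 + β) * (‖h‖ ^ 2 * ‖h‖ ^ β) / c * ∫ z, G z ∂ν) := by linarith
  have hpi := Real.pi_pos
  have : 0 < ‖h‖ ^ 2 * Real.pi := by positivity
  refine le_of_mul_le_mul_left (h9.trans (le_of_eq ?_)) this
  field_simp

/-- Increments of a regular solution are small in a weighted mean square sense. -/
theorem RegularSolution.exists_increment_le {ν : Measure Plane} [SFinite ν] {δ₀ c β δ₁ : ℝ}
    (hν : FiniteRange ν δ₀) (hδ : 0 ≤ δ₀) (hd : DominatesBalls ν c β δ₁) (hc : 0 < c)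
    (hβ : β ≤ 2) :
    ∃ A, 0 ≤ A ∧ ∀ v g, RegularSolution ν v g → ∀ x₀ h : Plane, h ≠ 0 → ‖h‖ ≤ 1 →
      2 * ‖h‖ ≤ δ₁ →
      ∫ x, expWeight x₀ x ^ 2 * (v (x + h) - v x) ^ 2 ≤ A * ‖h‖ ^ β *
        ((∫ x, expWeight x₀ x ^ 2 * v x ^ 2) + ∫ x, expWeight x₀ x ^ 2 * g x ^ 2) := by
  set A₁ := 4 * 2 ^ (2 + β) / (Real.pi * c) with hA₁
  set A₂ := 1 + Real.exp δ₀ ^ 2 * ∫ z, ‖z‖ ^ 2 ∂ν with hA₂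
  have hA₁0 : 0 ≤ A₁ := by have := Real.pi_pos; positivity
  have hA₂0 : 0 ≤ A₂ := by have := hν.nonneg_sq; positivity
  refine ⟨2 * (A₁ * A₂) + 2 * Real.exp 1 ^ 2, by positivity, fun v g hv x₀ h h0 h1 hδ₁ => ?_⟩
  obtain ⟨C, hC⟩ := hv.bdd
  have hcv := hv.cont
  have hce := expWeight.continuous x₀
  have i0 := expWeight.integrable_mul x₀ hcv.measurable hC
  have i0h := expWeight.integrable_mul x₀ (w := fun x => v (x + h)) (by fun_prop)
    (fun x => hC (x + h))
  set V := ∫ x, expWeight x₀ x ^ 2 * v x ^ 2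
  set W := ∫ x, expWeight x₀ x ^ 2 * g x ^ 2
  have hV : 0 ≤ V := integral_nonneg fun x => by positivity
  have hW : 0 ≤ W := integral_nonneg fun x => by positivity
  have hw2 : Integrable (fun x => (expWeight x₀ x * v x) ^ 2) := by simpa only [mul_pow] using i0
  have hE := hv.integrable_sq_diff hν (expWeight.isWeight hδ x₀)
  have k1 := hd.integral_sq_diff_le hc (w := fun x => expWeight x₀ x * v x) (by fun_prop) hw2 hE h0
    hδ₁
  have k2 := hv.energy_le hν hδ x₀
  have hr : 0 < ‖h‖ := norm_pos_iff.2 h0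
  have hrβ : ‖h‖ ^ 2 ≤ ‖h‖ ^ β := by
    have := Real.rpow_le_rpow_of_exponent_ge hr h1 hβ
    simpa using this
  have hrβ0 : 0 ≤ ‖h‖ ^ β := by positivity
  -- The weight is moved inside the increment: η(x)(v(x+h) - v(x)) is the increment of ηv minus
  -- (η(x+h) - η(x)) v(x+h), and the last factor costs |h|², at most |h|^β.
  have k3 : ∫ x, expWeight x₀ x ^ 2 * (v (x + h) - v x) ^ 2 ≤
      2 * (∫ x, (expWeight x₀ (x + h) * v (x + h) - expWeight x₀ x * v x) ^ 2) +
        2 * Real.exp 1 ^ 2 * ‖h‖ ^ 2 * V := by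
    have i1 : Integrable (fun x => expWeight x₀ (x + h) ^ 2 * v (x + h) ^ 2) :=
      i0.comp_add_right h
    have i2 : Integrable
        (fun x => (expWeight x₀ (x + h) * v (x + h) - expWeight x₀ x * v x) ^ 2) := by
      refine ((i1.const_mul 2).add (i0.const_mul 2)).mono' (by fun_prop)
        (Eventually.of_forall fun x => ?_)
      rw [Real.norm_eq_abs, abs_of_nonneg (by positivity)]
      simp only [Pi.add_apply]
      nlinarith [sq_nonneg (expWeight x₀ (x + h) * v (x + h) + expWeight x₀ x * v x)]
    have e : V = ∫ x, expWeight x₀ (x + h) ^ 2 * v (x + h) ^ 2 :=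
      (integral_add_right_eq_self (fun x => expWeight x₀ x ^ 2 * v x ^ 2) h).symm
    rw [e, ← integral_const_mul, ← integral_const_mul, ← integral_add (i2.const_mul _)
      (i1.const_mul _)]
    refine integral_mono ?_ ((i2.const_mul _).add (i1.const_mul _)) fun x => ?_
    · exact expWeight.integrable_mul x₀ (w := fun x => v (x + h) - v x) (C := C + C) (by fun_prop)
        fun x => (abs_sub _ _).trans (add_le_add (hC _) (hC _))
    · dsimp only
      have hp : (expWeight x₀ (x + h) - expWeight x₀ x) ^ 2 ≤
          Real.exp 1 ^ 2 * ‖h‖ ^ 2 * expWeight x₀ (x + h) ^ 2 := by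
        have := expWeight.abs_sub_le x₀ (x + h) (-h)
        simp only [add_neg_cancel_right, norm_neg] at this
        have h5 : |expWeight x₀ x - expWeight x₀ (x + h)| ≤
            Real.exp 1 * ‖h‖ * expWeight x₀ (x + h) := by
          refine this.trans ?_
          have := (expWeight.pos x₀ (x + h)).le
          have : Real.exp ‖h‖ ≤ Real.exp 1 := by gcongr
          calc _ ≤ ‖h‖ * (Real.exp 1 * expWeight x₀ (x + h)) := by gcongr
            _ = _ := by ring
        rw [abs_sub_comm] at h5
        calc _ ≤ (Real.exp 1 * ‖h‖ * expWeight x₀ (x + h)) ^ 2 := by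
              rw [← sq_abs]; gcongr
          _ = _ := by ring
      have hq := mul_le_mul_of_nonneg_right hp (sq_nonneg (v (x + h)))
      nlinarith [sq_nonneg ((expWeight x₀ (x + h) * v (x + h) - expWeight x₀ x * v x) +
        (expWeight x₀ (x + h) - expWeight x₀ x) * v (x + h))]
  have k4 : A₁ * ‖h‖ ^ β * ∫ p : Plane × Plane,
      (expWeight x₀ (p.2 + p.1) * v (p.2 + p.1) - expWeight x₀ p.2 * v p.2) ^ 2 ∂(ν.prod volume) ≤
      A₁ * ‖h‖ ^ β * (A₂ * (V + W)) := by gcongr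
  have k5 : Real.exp 1 ^ 2 * ‖h‖ ^ 2 * V ≤ Real.exp 1 ^ 2 * ‖h‖ ^ β * (V + W) := by
    gcongr; linarith
  calc _ ≤ _ := k3
    _ ≤ 2 * (A₁ * ‖h‖ ^ β * (A₂ * (V + W))) + 2 * (Real.exp 1 ^ 2 * ‖h‖ ^ β * (V + W)) := by
        have := k1.trans k4
        linarith
    _ = _ := by ring

/-! ### Sup-convolution: principal value solutions are weak solutions. -/

/-- The principal value `∫ (u (x + z) - u x) dν z` exists and equals `- F x` at every point. -/
def PVSolution (ν : Measure Plane) (u F : Plane → ℝ) : Prop :=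
  ∀ x, Tendsto (fun ε : ℝ => ∫ z in {z : Plane | ε < ‖z‖}, (u (x + z) - u x) ∂ν) (𝓝[>] 0)
    (𝓝 (-F x))

theorem PVSolution.neg {ν : Measure Plane} {u F : Plane → ℝ} (h : PVSolution ν u F) :
    PVSolution ν (fun x => -u x) (fun x => -F x) := fun x => by
  have := (h x).neg
  refine this.congr fun ε => ?_
  rw [← integral_neg]
  congr 1; ext z; ring

/-- The sup-convolution of `u` together with a choice of maximiser `Y x`. Only `w` needs to be
measurable, as a supremum of continuous functions. -/
theorem exists_supConvolution {u : Plane → ℝ} (hu : Continuous u) {M : ℝ} (hM : ∀ x, |u x| ≤ M)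
    {c : ℝ} (hc : 0 < c) :
    ∃ (w : Plane → ℝ) (Y : Plane → Plane), Measurable w ∧
      (∀ x, w x = u (Y x) - c * ‖x - Y x‖ ^ 2) ∧ ∀ x y, u y - c * ‖x - y‖ ^ 2 ≤ w x := by
  have hbd : ∀ x, BddAbove (Set.range fun y => u y - c * ‖x - y‖ ^ 2) := fun x => by
    refine ⟨M, ?_⟩
    rintro _ ⟨y, rfl⟩
    have := (abs_le.1 (hM y)).2
    dsimp only
    nlinarith [mul_nonneg hc.le (sq_nonneg ‖x - y‖)]
  have hmax : ∀ x, ∃ y, ∀ y', u y' - c * ‖x - y'‖ ^ 2 ≤ u y - c * ‖x - y‖ ^ 2 := fun x => by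
    have hM0 : 0 ≤ M := (abs_nonneg _).trans (hM x)
    -- Outside this radius the penalty exceeds the oscillation 2M, so a competitor there is no
    -- better than y = x and the maximum may be sought on a compact ball.
    set R := Real.sqrt (2 * M / c) with hR
    have hR2 : c * R ^ 2 = 2 * M := by
      rw [hR, Real.sq_sqrt (by positivity)]; field_simp
    obtain ⟨y, hy, hmax⟩ := (isCompact_closedBall x R).exists_isMaxOn
      (f := fun y => u y - c * ‖x - y‖ ^ 2) ⟨x, by simp [hR]⟩
      (Continuous.continuousOn (by fun_prop))
    refine ⟨y, fun y' => ?_⟩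
    by_cases hy' : y' ∈ Metric.closedBall x R
    · exact hmax hy'
    · rw [Metric.mem_closedBall, not_le, dist_eq_norm, norm_sub_rev] at hy'
      have h1 : u x - c * ‖x - x‖ ^ 2 ≤ u y - c * ‖x - y‖ ^ 2 :=
        hmax (Metric.mem_closedBall_self (Real.sqrt_nonneg _))
      refine le_trans ?_ h1
      have h2 := (abs_le.1 (hM y')).2
      have h3 := (abs_le.1 (hM x)).1
      have h4 : c * R ^ 2 ≤ c * ‖x - y'‖ ^ 2 := by
        have : 0 ≤ R := Real.sqrt_nonneg _
        gcongr
      simp only [sub_self, norm_zero]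
      linarith
  choose Y hY using hmax
  refine ⟨fun x => ⨆ y, (u y - c * ‖x - y‖ ^ 2), Y, ?_, fun x => ?_, fun x y => ?_⟩
  · exact (lowerSemicontinuous_ciSup hbd fun y =>
      Continuous.lowerSemicontinuous (by fun_prop)).measurable
  · exact le_antisymm (ciSup_le (hY x)) (le_ciSup (hbd x) (Y x))
  · exact le_ciSup (hbd x) y

section SupConvolution

variable {u w : Plane → ℝ} {Y : Plane → Plane} {c M : ℝ}

theorem supConvolution_le (hw : ∀ x, w x = u (Y x) - c * ‖x - Y x‖ ^ 2) (hc : 0 < c)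
    (x : Plane) : w x ≤ u (Y x) := by
  rw [hw]; nlinarith [mul_nonneg hc.le (sq_nonneg ‖x - Y x‖)]

theorem le_supConvolution (hw' : ∀ x y, u y - c * ‖x - y‖ ^ 2 ≤ w x) (x : Plane) : u x ≤ w x := by
  simpa using hw' x x

theorem abs_supConvolution_le (hM : ∀ x, |u x| ≤ M) (hc : 0 < c)
    (hw : ∀ x, w x = u (Y x) - c * ‖x - Y x‖ ^ 2) (hw' : ∀ x y, u y - c * ‖x - y‖ ^ 2 ≤ w x)
    (x : Plane) : |w x| ≤ M :=
  abs_le.2 ⟨(abs_le.1 (hM x)).1.trans (le_supConvolution hw' x),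
    (supConvolution_le hw hc x).trans (abs_le.1 (hM _)).2⟩

theorem sq_dist_supConvolution_le (hM : ∀ x, |u x| ≤ M)
    (hw : ∀ x, w x = u (Y x) - c * ‖x - Y x‖ ^ 2) (hw' : ∀ x y, u y - c * ‖x - y‖ ^ 2 ≤ w x)
    (x : Plane) : c * ‖x - Y x‖ ^ 2 ≤ 2 * M := by
  have h1 := le_supConvolution hw' x
  rw [hw] at h1
  have h2 := (abs_le.1 (hM x)).1
  have h3 := (abs_le.1 (hM (Y x))).2
  linarith

/-- Semiconvexity: a supremum of paraboloids of opening -c. It gives the uniform lower bound on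
truncated operators. -/
theorem supConvolution_second_diff (hw : ∀ x, w x = u (Y x) - c * ‖x - Y x‖ ^ 2)
    (hw' : ∀ x y, u y - c * ‖x - y‖ ^ 2 ≤ w x) (x z : Plane) :
    -(2 * c) * ‖z‖ ^ 2 ≤ w (x + z) + w (x - z) - 2 * w x := by
  have h1 := hw' (x + z) (Y x)
  have h2 := hw' (x - z) (Y x)
  have h3 := hw x
  have h4 := parallelogram_law_with_norm ℝ (x - Y x) z
  rw [show x + z - Y x = x - Y x + z by abel] at h1
  rw [show x - z - Y x = x - Y x - z by abel] at h2
  rw [h3]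
  have h5 : c * (‖x - Y x + z‖ ^ 2 + ‖x - Y x - z‖ ^ 2) =
    c * (2 * (‖x - Y x‖ ^ 2 + ‖z‖ ^ 2)) := by rw [h4]
  linarith

/-- Translating `u` so that `Y x` goes to x touches `w` from below at x, so the operator on `w` at x
dominates the operator on `u` at `Y x`. -/
theorem supConvolution_increment (hw : ∀ x, w x = u (Y x) - c * ‖x - Y x‖ ^ 2)
    (hw' : ∀ x y, u y - c * ‖x - y‖ ^ 2 ≤ w x) (x z : Plane) :
    u (Y x + z) - u (Y x) ≤ w (x + z) - w x := by
  have h1 := hw' (x + z) (Y x + z)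
  rw [add_sub_add_right_eq_sub] at h1
  rw [hw x]; linarith

end SupConvolution

namespace FiniteRange

variable {ν : Measure Plane} {δ₀ : ℝ}

theorem isFiniteMeasure_restrict (hν : FiniteRange ν δ₀) {r : ℝ} (hr : 0 < r) :
    IsFiniteMeasure (ν.restrict {z : Plane | r < ‖z‖}) := by
  refine ⟨?_⟩
  rw [Measure.restrict_apply_univ]
  refine lt_of_le_of_lt (measure_mono fun z (hz : r < ‖z‖) => ?_)
    (hν.sq.measure_ge_lt_top (ε := r ^ 2) (by positivity))
  change r ^ 2 ≤ ‖z‖ ^ 2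
  gcongr

theorem measurableSet_norm_gt (r : ℝ) : MeasurableSet {z : Plane | r < ‖z‖} :=
  measurableSet_lt measurable_const measurable_norm

theorem restrict (hν : FiniteRange ν δ₀) (r : ℝ) :
    FiniteRange (ν.restrict {z : Plane | r < ‖z‖}) δ₀ where
  neg := by
    have := hν.neg.restrict_preimage (measurableSet_norm_gt r)
    simpa using this
  range := ae_restrict_of_ae hν.range
  sq := hν.sq.restrict

/-- Evenness of the measure symmetrises the increment; finiteness permits splitting the integral. -/
theorem integral_eq_second_diff [IsFiniteMeasure ν] (hν : FiniteRange ν δ₀) {w : Plane → ℝ}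
    (hw : Measurable w) {M : ℝ} (hM : ∀ x, |w x| ≤ M) (x : Plane) :
    ∫ z, (w (x + z) - w x) ∂ν = (1 / 2) * ∫ z, (w (x + z) + w (x - z) - 2 * w x) ∂ν := by
  have i : ∀ f : Plane → Plane, Measurable f → Integrable (fun z => w (f z)) ν := fun f hf =>
    Integrable.of_bound (hw.comp hf).aestronglyMeasurable M
      (Eventually.of_forall fun z => hM _)
  have i1 : Integrable (fun z => w (x + z) - w x) ν := (i _ (by fun_prop)).sub (integrable_const _)
  have i2 : Integrable (fun z => w (x - z) - w x) ν := (i _ (by fun_prop)).sub (integrable_const _)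
  have e : ∫ z, (w (x - z) - w x) ∂ν = ∫ z, (w (x + z) - w x) ∂ν := by
    conv_rhs => rw [← hν.neg.map_eq]
    rw [integral_map measurable_neg.aemeasurable
      (Measurable.aestronglyMeasurable (by fun_prop))]
    simp [sub_eq_add_neg]
  have : ∫ z, (w (x + z) + w (x - z) - 2 * w x) ∂ν =
      (∫ z, (w (x + z) - w x) ∂ν) + ∫ z, (w (x - z) - w x) ∂ν := by
    rw [← integral_add i1 i2]
    congr 1; ext z; ring
  rw [this, e]; ring

/-- Integration by parts for a finite jump measure. -/
theorem integral_mul_eq [IsFiniteMeasure ν] (hν : FiniteRange ν δ₀) {w ζ : Plane → ℝ}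
    (hw : Measurable w) {M : ℝ} (hM : ∀ x, |w x| ≤ M) (hζ : Integrable ζ) :
    ∫ x, ζ x * ∫ z, (w (x + z) - w x) ∂ν =
      (1 / 2) * ∫ p : Plane × Plane, w p.2 * (ζ (p.2 + p.1) + ζ (p.2 - p.1) - 2 * ζ p.2)
        ∂(ν.prod volume) := by
  have hsub : ∀ s : ℝ, MeasurePreserving (fun p : Plane × Plane => (p.1, p.2 + s • p.1))
      (ν.prod volume) (ν.prod volume) := fun s => by
    refine (MeasurePreserving.id ν).skew_product (g := fun z x => x + s • z) (by fun_prop) ?_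
    exact Filter.Eventually.of_forall fun z => (measurePreserving_add_right volume _).map_eq
  have j0 : Integrable (fun p : Plane × Plane => ζ p.2) (ν.prod volume) := by
    simpa using (integrable_const (1 : ℝ)).mul_prod (μ := ν) hζ
  have j1 : Integrable (fun p : Plane × Plane => ζ (p.2 + p.1)) (ν.prod volume) := by
    simpa [Function.comp_def] using (hsub 1).integrable_comp_of_integrable j0
  have j2 : Integrable (fun p : Plane × Plane => ζ (p.2 - p.1)) (ν.prod volume) := by
    simpa [Function.comp_def, ← sub_eq_add_neg] using (hsub (-1)).integrable_comp_of_integrable j0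
  have hwm : ∀ s : ℝ, Measurable (fun p : Plane × Plane => w (p.2 + s • p.1)) := fun s => by
    fun_prop
  have b : ∀ {f : Plane × Plane → ℝ} (_ : Integrable f (ν.prod volume)) (s : ℝ),
      Integrable (fun p : Plane × Plane => w (p.2 + s • p.1) * f p) (ν.prod volume) := fun hf s =>
    hf.bdd_mul (hwm s).aestronglyMeasurable (Eventually.of_forall fun p => hM _)
  have k1 := b j0 1
  have k0 := b j0 0
  have k0' := b j1 0
  have k0'' := b j2 0
  simp only [one_smul, zero_smul, add_zero] at k1 k0 k0' k0''
  have e1 : ∫ x, ζ x * ∫ z, (w (x + z) - w x) ∂ν =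
      ∫ p : Plane × Plane, (w (p.2 + p.1) * ζ p.2 - w p.2 * ζ p.2) ∂(ν.prod volume) := by
    have j : Integrable (fun p : Plane × Plane => w (p.2 + p.1) * ζ p.2 - w p.2 * ζ p.2)
        (ν.prod volume) := k1.sub k0
    rw [integral_prod_symm _ j]
    congr 1; ext x
    rw [← integral_const_mul]
    congr 1; ext z; ring
  -- The cross term is moved onto `ζ` in two ways, by translation here and by exchanging endpoints
  -- next; their mean is the second difference of `ζ`.
  have e2 : ∫ p : Plane × Plane, w (p.2 + p.1) * ζ p.2 ∂(ν.prod volume) =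
      ∫ p : Plane × Plane, w p.2 * ζ (p.2 - p.1) ∂(ν.prod volume) := by
    have h := (hsub 1).map_eq
    conv_rhs => rw [← h]
    rw [integral_map (hsub 1).measurable.aemeasurable (by rw [h]; exact k0''.aestronglyMeasurable)]
    simp
  have e3 : ∫ p : Plane × Plane, w (p.2 + p.1) * ζ p.2 ∂(ν.prod volume) =
      ∫ p : Plane × Plane, w p.2 * ζ (p.2 + p.1) ∂(ν.prod volume) := by
    rw [← hν.integral_flip k1.aestronglyMeasurable]
    simp
  rw [e1, integral_sub k1 k0]
  have : ∫ p : Plane × Plane, w p.2 * (ζ (p.2 + p.1) + ζ (p.2 - p.1) - 2 * ζ p.2)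
        ∂(ν.prod volume) = (∫ p : Plane × Plane, w p.2 * ζ (p.2 + p.1) ∂(ν.prod volume)) +
        (∫ p : Plane × Plane, w p.2 * ζ (p.2 - p.1) ∂(ν.prod volume)) -
        2 * ∫ p : Plane × Plane, w p.2 * ζ p.2 ∂(ν.prod volume) := by
    have k : Integrable (fun p : Plane × Plane =>
      w p.2 * ζ (p.2 + p.1) + w p.2 * ζ (p.2 - p.1)) (ν.prod volume) := k0'.add k0''
    rw [← integral_const_mul, ← integral_add k0' k0'', ← integral_sub k (k0.const_mul 2)]
    congr 1; ext p; ring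
  rw [this, ← e2, ← e3]; ring

end FiniteRange

/-- A nonnegative test function: continuous, compactly supported, with second differences of
quadratic order. -/
structure IsTest (ζ : Plane → ℝ) : Prop where
  cont : Continuous ζ
  supp : HasCompactSupport ζ
  nonneg : ∀ x, 0 ≤ ζ x
  sec : ∃ C, ∀ x z, |ζ (x + z) + ζ (x - z) - 2 * ζ x| ≤ C * ‖z‖ ^ 2

/-- Jumps have length at most `δ₀`, so the second difference of `ζ` vanishes off the `δ₀`-thickening
of its support. The dominating `D` does not depend on `w`, which serves dominated convergence along
sequences of `w`. -/
theorem IsTest.integrable_second_diff {ν : Measure Plane} [SFinite ν] {δ₀ : ℝ}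
    (hν : FiniteRange ν δ₀) {w ζ : Plane → ℝ} (hw : Measurable w) {M : ℝ} (hM : ∀ x, |w x| ≤ M)
    (hζ : IsTest ζ) :
    ∃ D : Plane × Plane → ℝ, Integrable D (ν.prod volume) ∧
      (∀ᵐ p ∂(ν.prod volume), |ζ (p.2 + p.1) + ζ (p.2 - p.1) - 2 * ζ p.2| ≤ D p) ∧
    Integrable (fun p : Plane × Plane => w p.2 * (ζ (p.2 + p.1) + ζ (p.2 - p.1) - 2 * ζ p.2))
      (ν.prod volume) := by
  obtain ⟨C, hC⟩ := hζ.sec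
  have hc := hζ.cont
  set K := Metric.cthickening δ₀ (tsupport ζ) with hK
  have hKc : IsCompact K := hζ.supp.isCompact.cthickening
  have hKi : Integrable (K.indicator fun _ => (1 : ℝ)) :=
    (integrable_indicator_iff hKc.measurableSet).2 (integrableOn_const hKc.measure_lt_top.ne)
  have hout : ∀ x z, ‖z‖ ≤ δ₀ → x ∉ K → ζ (x + z) = 0 := fun x z hz hx => by
    by_contra h
    refine hx (Metric.mem_cthickening_of_dist_le x (x + z) δ₀ _ (subset_tsupport _ h) ?_)
    simpa [dist_eq_norm] using hz
  have hb : ∀ x z, ‖z‖ ≤ δ₀ → |ζ (x + z) + ζ (x - z) - 2 * ζ x| ≤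
      C * ‖z‖ ^ 2 * K.indicator (fun _ => 1) x := fun x z hz => by
    by_cases hx : x ∈ K
    · simpa [hx] using hC x z
    · have h1 := hout x z hz hx
      have h2 := hout x (-z) (by simpa using hz) hx
      have h3 := hout x 0 (by simpa using (norm_nonneg z).trans hz) hx
      rw [← sub_eq_add_neg] at h2
      rw [add_zero] at h3
      simp [h1, h2, h3, hx]
  refine ⟨fun p => C * (‖p.1‖ ^ 2 * K.indicator (fun _ => 1) p.2),
    (hν.sq.mul_prod hKi).const_mul C, ?_, ?_⟩
  · filter_upwards [hν.ae_prod] with p hp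
    have := hb p.2 p.1 hp
    rwa [mul_assoc] at this
  · refine hν.integrable_prod (Measurable.aestronglyMeasurable (by fun_prop)) hKi (C := M * C)
      fun z x hz => ?_
    rw [abs_mul]
    calc _ ≤ M * (C * ‖z‖ ^ 2 * K.indicator (fun _ => 1) x) := by
          have := (abs_nonneg _).trans (hM x)
          gcongr
          · exact hM x
          · exact hb x z hz
      _ = _ := by ring

/-- The truncated regions increase to {z ≠ 0}; the hypothesis at z = 0 covers a possible atom of `ν`
there. -/
theorem tendsto_integral_truncation {ν : Measure Plane} [SFinite ν]
    {G : Plane × Plane → ℝ} (hG : Integrable G (ν.prod volume))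
    (h0 : ∀ x, G (0, x) = 0) :
    Tendsto (fun n : ℕ => ∫ p, G p
      ∂((ν.restrict {z : Plane | 1 / ((n : ℝ) + 1) < ‖z‖}).prod (volume : Measure Plane))) atTop
      (𝓝 (∫ p, G p ∂(ν.prod volume))) := by
  set S : ℕ → Set (Plane × Plane) := fun n => {p | 1 / ((n : ℝ) + 1) < ‖p.1‖} with hS
  have hm : ∀ n, MeasurableSet (S n) := fun n =>
    measurableSet_lt measurable_const (by fun_prop)
  have e : ∀ n : ℕ, (ν.restrict {z : Plane | 1 / ((n : ℝ) + 1) < ‖z‖}).prod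
      (volume : Measure Plane) = (ν.prod volume).restrict (S n) := fun n => by
    have := Measure.prod_restrict (μ := ν) (ν := (volume : Measure Plane))
      {z : Plane | 1 / ((n : ℝ) + 1) < ‖z‖} Set.univ
    rw [Measure.restrict_univ] at this
    rw [this]
    congr 1; ext p; simp [hS]
  simp only [e]
  have hmono : Monotone S := fun n k hnk p hp => by
    change 1 / ((n : ℝ) + 1) < ‖p.1‖ at hp
    change 1 / ((k : ℝ) + 1) < ‖p.1‖
    refine lt_of_le_of_lt ?_ hp
    have : (n : ℝ) ≤ k := by exact_mod_cast hnk
    gcongr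
  have := tendsto_setIntegral_of_monotone hm hmono hG.integrableOn
  rwa [setIntegral_eq_integral_of_forall_compl_eq_zero] at this
  rintro ⟨z, x⟩ hp
  have : z = 0 := by
    by_contra hz
    refine hp ?_
    obtain ⟨n, hn⟩ := exists_nat_one_div_lt (norm_pos_iff.2 hz)
    exact Set.mem_iUnion.2 ⟨n, hn⟩
  rw [this, h0]

/-- The sup-convolution of a principal value solution is a weak subsolution. -/
theorem PVSolution.supConvolution_weak_le {ν : Measure Plane} [SFinite ν] {δ₀ : ℝ}
    (hν : FiniteRange ν δ₀) {u F ζ w : Plane → ℝ} {Y : Plane → Plane} {c M ω : ℝ}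
    (hu : Continuous u) (hM : ∀ x, |u x| ≤ M) (hF : Continuous F) (h : PVSolution ν u F)
    (hζ : IsTest ζ) (hc : 0 < c) (hwm : Measurable w)
    (hw : ∀ x, w x = u (Y x) - c * ‖x - Y x‖ ^ 2) (hw' : ∀ x y, u y - c * ‖x - y‖ ^ 2 ≤ w x)
    (hω : ∀ x ∈ tsupport ζ, F (Y x) < F x + ω) :
    ∫ x, ζ x * (-F x - ω) ≤
      (1 / 2) * ∫ p : Plane × Plane, w p.2 * (ζ (p.2 + p.1) + ζ (p.2 - p.1) - 2 * ζ p.2)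
        ∂(ν.prod volume) := by
  have hwM := abs_supConvolution_le hM hc hw hw'
  obtain ⟨D, -, -, hI⟩ := hζ.integrable_second_diff hν hwm hwM
  have hlim := (tendsto_integral_truncation hI (fun x => by simp; ring_nf; simp)).const_mul
    (1 / 2)
  have hcζ := hζ.cont
  have hζi : Integrable ζ := hcζ.integrable_of_hasCompactSupport hζ.supp
  set r : ℕ → ℝ := fun n => 1 / ((n : ℝ) + 1) with hr
  have hr0 : ∀ n, 0 < r n := fun n => by positivity
  set T : ℕ → Plane → ℝ := fun n x => ∫ z in {z : Plane | r n < ‖z‖}, (w (x + z) - w x) ∂ν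
    with hT
  have hfin : ∀ n, IsFiniteMeasure (ν.restrict {z : Plane | r n < ‖z‖}) := fun n =>
    hν.isFiniteMeasure_restrict (hr0 n)
  have e : ∀ n, ∫ x, ζ x * T n x = (1 / 2) * ∫ p : Plane × Plane,
      w p.2 * (ζ (p.2 + p.1) + ζ (p.2 - p.1) - 2 * ζ p.2)
        ∂((ν.restrict {z : Plane | r n < ‖z‖}).prod (volume : Measure Plane)) := fun n =>
    (hν.restrict (r n)).integral_mul_eq hwm hwM hζi
  -- Semiconvexity integrated against the truncated measure, uniformly in `n`.
  have hTlow : ∀ n x, -(c * ∫ z, ‖z‖ ^ 2 ∂ν) ≤ T n x := fun n x => by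
    have h1 := (hν.restrict (r n)).integral_eq_second_diff hwm hwM x
    have h2 : ∫ z in {z : Plane | r n < ‖z‖}, ‖z‖ ^ 2 ∂ν ≤ ∫ z, ‖z‖ ^ 2 ∂ν :=
      setIntegral_le_integral hν.sq (Eventually.of_forall fun z => by positivity)
    have h3 : ∫ z in {z : Plane | r n < ‖z‖}, -(2 * c) * ‖z‖ ^ 2 ∂ν ≤
        ∫ z in {z : Plane | r n < ‖z‖}, (w (x + z) + w (x - z) - 2 * w x) ∂ν := by
      refine integral_mono (hν.sq.restrict.const_mul _) ?_ fun z =>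
        supConvolution_second_diff hw hw' x z
      refine Integrable.of_bound (Measurable.aestronglyMeasurable (by fun_prop)) (4 * M)
        (Eventually.of_forall fun z => ?_)
      rw [Real.norm_eq_abs, abs_le]
      have a1 := abs_le.1 (hwM x)
      have a2 := abs_le.1 (hwM (x + z))
      have a3 := abs_le.1 (hwM (x - z))
      constructor <;> linarith
    rw [integral_const_mul] at h3
    rw [hT]; dsimp only
    rw [h1]
    nlinarith
  have hTup : ∀ n x, |T n x| ≤ 2 * M * (ν.restrict {z : Plane | r n < ‖z‖}).real Set.univ :=
    fun n x => by
      refine norm_integral_le_of_norm_le_const (f := fun z => w (x + z) - w x)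
        (μ := ν.restrict {z : Plane | r n < ‖z‖}) (Eventually.of_forall fun z => ?_)
      rw [Real.norm_eq_abs, abs_le]
      have a1 := abs_le.1 (hwM x)
      have a2 := abs_le.1 (hwM (x + z))
      constructor <;> linarith
  have hTm : ∀ n, StronglyMeasurable (T n) := fun n =>
    StronglyMeasurable.integral_prod_right (f := fun x z => w (x + z) - w x)
      (Measurable.stronglyMeasurable (by fun_prop))
  have hTge : ∀ n x, ∫ z in {z : Plane | r n < ‖z‖}, (u (Y x + z) - u (Y x)) ∂ν ≤ T n x :=
    fun n x => by
      have b : ∀ {v : Plane → ℝ} (_ : Measurable v) (_ : ∀ x, |v x| ≤ M) (y : Plane),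
          Integrable (fun z => v (y + z) - v y) (ν.restrict {z : Plane | r n < ‖z‖}) :=
        fun hv hvM y => by
          refine Integrable.of_bound (Measurable.aestronglyMeasurable (by fun_prop)) (2 * M)
            (Eventually.of_forall fun z => ?_)
          rw [Real.norm_eq_abs, abs_le]
          have a1 := abs_le.1 (hvM y)
          have a2 := abs_le.1 (hvM (y + z))
          constructor <;> linarith
      exact integral_mono (b hu.measurable hM _) (b hwm hwM _) fun z =>
        supConvolution_increment hw hw' x z
  have hrlim : Tendsto r atTop (𝓝[>] 0) :=
    tendsto_nhdsWithin_iff.2 ⟨tendsto_one_div_add_atTop_nhds_zero_nat,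
      Eventually.of_forall fun n => hr0 n⟩
  -- `T n` has a lower bound uniform in `n` but no such upper bound. Capping it at the expected
  -- value -F - ω allows dominated convergence, and the cap is eventually reached at each point of
  -- the support.
  set m : ℕ → Plane → ℝ := fun n x => ζ x * min (T n x) (-F x - ω) with hm
  have hbound : Integrable fun x => ζ x * ((c * ∫ z, ‖z‖ ^ 2 ∂ν) + |F x| + |ω|) := by
    refine Continuous.integrable_of_hasCompactSupport (by fun_prop) ?_
    exact hζ.supp.mul_right
  have hmb : ∀ n x, ‖m n x‖ ≤ ζ x * ((c * ∫ z, ‖z‖ ^ 2 ∂ν) + |F x| + |ω|) := fun n x => by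
    have h0 := hζ.nonneg x
    have hpos := mul_nonneg hc.le hν.nonneg_sq
    rw [Real.norm_eq_abs, abs_mul, abs_of_nonneg h0]
    gcongr
    rw [abs_le]
    have a1 := abs_le.1 (le_refl |F x|)
    have a2 := abs_le.1 (le_refl |ω|)
    have a3 := hTlow n x
    constructor
    · exact le_min (by linarith [abs_nonneg (F x), abs_nonneg ω]) (by linarith)
    · exact (min_le_right _ _).trans (by linarith)
  have hmm : ∀ n, AEStronglyMeasurable (m n) := fun n =>
    ((hcζ.measurable).mul ((hTm n).measurable.min
      (by fun_prop : Measurable fun x => -F x - ω))).aestronglyMeasurable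
  have hmlim : Tendsto (fun n => ∫ x, m n x) atTop (𝓝 (∫ x, ζ x * (-F x - ω))) := by
    refine tendsto_integral_of_dominated_convergence _ hmm hbound
      (fun n => Eventually.of_forall (hmb n)) (Eventually.of_forall fun x => ?_)
    by_cases hx : x ∈ tsupport ζ
    · have h1 := ((h (Y x)).comp hrlim).eventually
        (lt_mem_nhds (show -F x - ω < -F (Y x) by linarith [hω x hx]))
      refine tendsto_nhds_of_eventually_eq ?_
      filter_upwards [h1] with n hn
      simp only [hm]
      rw [min_eq_right]
      exact hn.le.trans (hTge n x)
    · have : ζ x = 0 := image_eq_zero_of_notMem_tsupport hx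
      simp [hm, this]
  refine le_of_tendsto_of_tendsto hmlim hlim (Eventually.of_forall fun n => ?_)
  dsimp only
  rw [← e n]
  refine integral_mono (hbound.mono' (hmm n) (Eventually.of_forall (hmb n))) ?_ fun x =>
    mul_le_mul_of_nonneg_left (min_le_left _ _) (hζ.nonneg x)
  exact hζi.mul_bdd (hTm n).aestronglyMeasurable (Eventually.of_forall (hTup n))

/-- A principal value solution is a weak subsolution. -/
theorem PVSolution.weak_le {ν : Measure Plane} [SFinite ν] {δ₀ : ℝ}
    (hν : FiniteRange ν δ₀) {u F ζ : Plane → ℝ} {M : ℝ}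
    (hu : Continuous u) (hM : ∀ x, |u x| ≤ M) (hF : Continuous F) (h : PVSolution ν u F)
    (hζ : IsTest ζ) :
    -∫ x, ζ x * F x ≤
      (1 / 2) * ∫ p : Plane × Plane, u p.2 * (ζ (p.2 + p.1) + ζ (p.2 - p.1) - 2 * ζ p.2)
        ∂(ν.prod volume) := by
  have hcζ := hζ.cont
  have hζi : Integrable ζ := hcζ.integrable_of_hasCompactSupport hζ.supp
  have hζF : Integrable (fun x => ζ x * F x) :=
    Continuous.integrable_of_hasCompactSupport (by fun_prop) hζ.supp.mul_right
  have hc0 : ∀ n : ℕ, (0 : ℝ) < n + 1 := fun n => by positivity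
  choose w Y hwm hw hw' using fun n : ℕ => exists_supConvolution hu hM (hc0 n)
  have hwM := fun n => abs_supConvolution_le hM (hc0 n) (hw n) (hw' n)
  have hYlim : Tendsto (fun n : ℕ => Real.sqrt (2 * M / (n + 1))) atTop (𝓝 0) := by
    have : Tendsto (fun n : ℕ => 2 * M / ((n : ℝ) + 1)) atTop (𝓝 0) :=
      tendsto_const_nhds.div_atTop
        (tendsto_atTop_add_const_right _ _ tendsto_natCast_atTop_atTop)
    simpa using this.sqrt
  have hY : ∀ n x, dist (Y n x) x ≤ Real.sqrt (2 * M / (n + 1)) := fun n x => by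
    refine Real.le_sqrt_of_sq_le ?_
    rw [le_div_iff₀ (hc0 n), dist_eq_norm, norm_sub_rev, mul_comm]
    exact sq_dist_supConvolution_le hM (hw n) (hw' n) x
  have hYx : ∀ x, Tendsto (fun n => Y n x) atTop (𝓝 x) := fun x =>
    tendsto_iff_dist_tendsto_zero.2
      (squeeze_zero (fun n => dist_nonneg) (fun n => hY n x) hYlim)
  have hwlim : ∀ x, Tendsto (fun n => w n x) atTop (𝓝 (u x)) := fun x =>
    tendsto_of_tendsto_of_tendsto_of_le_of_le tendsto_const_nhds
      ((hu.tendsto x).comp (hYx x)) (fun n => le_supConvolution (hw' n) x)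
      (fun n => supConvolution_le (hw n) (hc0 n) x)
  obtain ⟨D, hD, hDb, hI⟩ := hζ.integrable_second_diff hν hu.measurable hM
  have hlim : Tendsto (fun n => ∫ p : Plane × Plane,
      w n p.2 * (ζ (p.2 + p.1) + ζ (p.2 - p.1) - 2 * ζ p.2) ∂(ν.prod volume)) atTop
      (𝓝 (∫ p : Plane × Plane, u p.2 * (ζ (p.2 + p.1) + ζ (p.2 - p.1) - 2 * ζ p.2)
        ∂(ν.prod volume))) := by
    refine tendsto_integral_of_dominated_convergence (fun p => M * D p) (fun n => ?_)
      (hD.const_mul M) (fun n => ?_) (Eventually.of_forall fun p => (hwlim p.2).mul_const _)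
    · have := hwm n
      exact Measurable.aestronglyMeasurable (by fun_prop)
    · filter_upwards [hDb] with p hp
      rw [Real.norm_eq_abs, abs_mul]
      have := (abs_nonneg _).trans (hM p.2)
      gcongr
      exact hwM n _
  have key : ∀ ω : ℝ, 0 < ω → -(∫ x, ζ x * F x) - ω * ∫ x, ζ x ≤
      (1 / 2) * ∫ p : Plane × Plane, u p.2 * (ζ (p.2 + p.1) + ζ (p.2 - p.1) - 2 * ζ p.2)
        ∂(ν.prod volume) := fun ω hω => by
    -- As the penalty grows the maximisers approach x uniformly, so uniform continuity of F near the
    -- support of `ζ` makes F(Y x) - F(x) less than ω.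
    have hK : IsCompact (tsupport ζ) := hζ.supp
    have huc := (hK.cthickening (r := 1)).uniformContinuousOn_of_continuous hF.continuousOn
    obtain ⟨δ, hδ, hδ'⟩ := Metric.uniformContinuousOn_iff.1 huc ω hω
    have hev := hYlim.eventually (gt_mem_nhds (lt_min hδ one_pos))
    refine ge_of_tendsto (hlim.const_mul (1 / 2)) ?_
    filter_upwards [hev] with n hn
    have := h.supConvolution_weak_le (ω := ω) hν hu hM hF hζ (hc0 n) (hwm n) (hw n) (hw' n)
      fun x hx => by
        have h1 := (hY n x).trans_lt hn
        have h2 := hδ' (Y n x)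
          (Metric.mem_cthickening_of_dist_le _ x 1 _ hx (h1.le.trans (min_le_right _ _))) x
          (Metric.self_subset_cthickening _ hx) (h1.trans_le (min_le_left _ _))
        rw [Real.dist_eq] at h2
        linarith [(abs_lt.1 h2).2]
    refine le_trans (le_of_eq ?_) this
    rw [← integral_const_mul, ← integral_neg, ← integral_sub hζF.fun_neg (hζi.const_mul ω)]
    congr 1; ext x; ring
  have hlim2 : Tendsto (fun ω : ℝ => -(∫ x, ζ x * F x) - ω * ∫ x, ζ x) (𝓝[>] 0)
      (𝓝 (-(∫ x, ζ x * F x) - 0 * ∫ x, ζ x)) :=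
    ((continuous_const.sub (continuous_id.mul continuous_const)).tendsto 0).mono_left
      nhdsWithin_le_nhds
  rw [zero_mul, sub_zero] at hlim2
  exact le_of_tendsto hlim2 (eventually_mem_nhdsWithin.mono fun ω hω => key ω hω)

/-- A principal value solution is a weak solution. -/
theorem PVSolution.weak_eq {ν : Measure Plane} [SFinite ν] {δ₀ : ℝ}
    (hν : FiniteRange ν δ₀) {u F ζ : Plane → ℝ} {M : ℝ}
    (hu : Continuous u) (hM : ∀ x, |u x| ≤ M) (hF : Continuous F) (h : PVSolution ν u F)
    (hζ : IsTest ζ) :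
    (1 / 2) * ∫ p : Plane × Plane, u p.2 * (ζ (p.2 + p.1) + ζ (p.2 - p.1) - 2 * ζ p.2)
        ∂(ν.prod volume) = -∫ x, ζ x * F x := by
  have h1 := h.weak_le hν hu hM hF hζ
  have h2 := h.neg.weak_le hν hu.neg (M := M) (fun x => by simpa using hM x) hF.neg hζ
  have e1 : ∫ p : Plane × Plane, -u p.2 * (ζ (p.2 + p.1) + ζ (p.2 - p.1) - 2 * ζ p.2)
        ∂(ν.prod volume) = -∫ p : Plane × Plane,
          u p.2 * (ζ (p.2 + p.1) + ζ (p.2 - p.1) - 2 * ζ p.2) ∂(ν.prod volume) := by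
    rw [← integral_neg]; congr 1; ext p; ring
  have e2 : ∫ x, ζ x * -F x = -∫ x, ζ x * F x := by
    rw [← integral_neg]; congr 1; ext p; ring
  simp only [Pi.neg_apply] at h2
  rw [e1, e2] at h2
  linarith

/-- The map y ↦ ρ(x+y) + ρ(x-y) has derivative of size at most 2L|y|, L being a Lipschitz constant
of the derivative of ρ; the mean value inequality on the ball of radius |z| gives the quadratic
bound. -/
theorem ContDiff.exists_second_diff_le {ρ : Plane → ℝ} (hρ : ContDiff ℝ 2 ρ)
    (hs : HasCompactSupport ρ) :
    ∃ C, 0 ≤ C ∧ ∀ x z, |ρ (x + z) + ρ (x - z) - 2 * ρ x| ≤ C * ‖z‖ ^ 2 := by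
  obtain ⟨L, hL⟩ := ContDiff.lipschitzWith_of_hasCompactSupport (𝕂 := ℝ) (n := 1) (hs.fderiv ℝ)
    (hρ.fderiv_right (m := 1) (by norm_num)) (by norm_num)
  have hd : Differentiable ℝ ρ := hρ.differentiable (by norm_num)
  refine ⟨2 * L, by positivity, fun x z => ?_⟩
  have h1 : ∀ y, HasFDerivAt (fun y => ρ (x + y) + ρ (x - y))
      (fderiv ℝ ρ (x + y) - fderiv ℝ ρ (x - y)) y := fun y => by
    have a := (hd (x + y)).hasFDerivAt.comp y ((hasFDerivAt_id y).const_add x)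
    have b := (hd (x - y)).hasFDerivAt.comp y ((hasFDerivAt_id y).const_sub x)
    convert! a.add b using 1
    ext w; simp [sub_eq_add_neg]
  have h2 : ∀ y ∈ Metric.closedBall (0 : Plane) ‖z‖,
      ‖fderiv ℝ ρ (x + y) - fderiv ℝ ρ (x - y)‖ ≤ 2 * L * ‖z‖ := fun y hy => by
    have := hL.dist_le_mul (x + y) (x - y)
    rw [dist_eq_norm, dist_eq_norm] at this
    have e : x + y - (x - y) = (2 : ℝ) • y := by rw [two_smul]; abel
    rw [e, norm_smul] at this
    have hy' : ‖y‖ ≤ ‖z‖ := by simpa using hy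
    calc _ ≤ _ := this
      _ = 2 * L * ‖y‖ := by simp; ring
      _ ≤ _ := by gcongr
  have h3 := (convex_closedBall (0 : Plane) ‖z‖).norm_image_sub_le_of_norm_hasFDerivWithin_le
    (fun y _ => (h1 y).hasFDerivWithinAt) h2 (Metric.mem_closedBall_self (norm_nonneg z))
    (show z ∈ Metric.closedBall (0 : Plane) ‖z‖ by simp)
  rw [Real.norm_eq_abs] at h3
  simp only [add_zero, sub_zero] at h3
  calc _ = |ρ (x + z) + ρ (x - z) - (ρ x + ρ x)| := by ring_nf
    _ ≤ _ := h3
    _ = _ := by ring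

/-! ### Mollification: approximation by regular solutions. -/

/-- The convolution of `u` with `ρ`. -/
noncomputable def mollify (ρ u : Plane → ℝ) (x : Plane) : ℝ := ∫ y, u y * ρ (x - y)

/-- A mollifier: a nonnegative `C²` function with compact support and integral one. -/
structure IsMollifier (ρ : Plane → ℝ) : Prop where
  smooth : ContDiff ℝ 2 ρ
  supp : HasCompactSupport ρ
  nonneg : ∀ x, 0 ≤ ρ x
  integral : ∫ x, ρ x = 1

namespace IsMollifier

variable {ρ u : Plane → ℝ} {M : ℝ}

theorem integrable (hρ : IsMollifier ρ) : Integrable ρ :=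
  hρ.smooth.continuous.integrable_of_hasCompactSupport hρ.supp

theorem integrable_mul (hρ : IsMollifier ρ) (hu : Measurable u) (hM : ∀ x, |u x| ≤ M)
    (x : Plane) : Integrable (fun y => u y * ρ (x - y)) :=
  (hρ.integrable.comp_sub_left x).bdd_mul hu.aestronglyMeasurable (Eventually.of_forall hM)

theorem isTest (hρ : IsMollifier ρ) (x : Plane) : IsTest (fun y => ρ (x - y)) where
  cont := hρ.smooth.continuous.comp (by fun_prop)
  supp := hρ.supp.comp_homeomorph (Homeomorph.subLeft x)
  nonneg y := hρ.nonneg _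
  sec := by
    obtain ⟨C, -, hC⟩ := hρ.smooth.exists_second_diff_le hρ.supp
    refine ⟨C, fun y z => ?_⟩
    have := hC (x - y) z
    rw [show x - (y + z) = x - y - z by abel, show x - (y - z) = x - y + z by abel,
      add_comm (ρ (x - y - z))]
    exact this

theorem abs_mollify_le (hρ : IsMollifier ρ) (hM : ∀ x, |u x| ≤ M)
    (x : Plane) : |mollify ρ u x| ≤ M := by
  have h1 : ∫ y, M * ρ (x - y) = M := by
    rw [integral_const_mul, integral_sub_left_eq_self ρ, hρ.integral, mul_one]
  rw [← h1, mollify, ← Real.norm_eq_abs]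
  refine norm_integral_le_of_norm_le ((hρ.integrable.comp_sub_left x).const_mul M)
    (Eventually.of_forall fun y => ?_)
  rw [Real.norm_eq_abs, abs_mul, abs_of_nonneg (hρ.nonneg _)]
  have := hρ.nonneg (x - y)
  gcongr
  exact hM y

theorem abs_integral_le_of_support {w d : Plane → ℝ} {K : Set Plane} (hK : IsCompact K) {B : ℝ}
    (hw : ∀ x, |w x| ≤ M) (x : Plane)
    (hd : ∀ y, |d y| ≤ B) (hd0 : ∀ y ∉ K, d y = 0) :
    |∫ y, w y * d (x - y)| ≤ M * B * volume.real K := by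
  have e : ∫ y, (K.indicator (fun _ => M * B)) (x - y) = M * B * volume.real K := by
    rw [integral_sub_left_eq_self (K.indicator fun _ => M * B), integral_indicator hK.measurableSet]
    simp [mul_comm]
  rw [← e]
  have hi : Integrable (K.indicator fun _ => M * B) :=
    (integrable_indicator_iff hK.measurableSet).2 (integrableOn_const hK.measure_lt_top.ne)
  rw [← Real.norm_eq_abs]
  refine norm_integral_le_of_norm_le (hi.comp_sub_left x) (Eventually.of_forall fun y => ?_)
  by_cases hy : x - y ∈ K
  · rw [Set.indicator_of_mem hy, Real.norm_eq_abs, abs_mul]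
    have := (abs_nonneg _).trans (hw x)
    gcongr
    · exact hw y
    · exact hd _
  · simp [hd0 _ hy, hy]

theorem eq_zero_of_notMem_cthickening {ρ : Plane → ℝ} {x z : Plane} (hz : ‖z‖ ≤ 1)
    (hx : x ∉ Metric.cthickening 1 (tsupport ρ)) : ρ (x + z) = 0 := by
  by_contra h
  refine hx (Metric.mem_cthickening_of_dist_le x (x + z) 1 _ (subset_tsupport _ h) ?_)
  simpa [dist_eq_norm] using hz

theorem exists_lipschitz (hρ : IsMollifier ρ) (hu : Measurable u) (hM : ∀ x, |u x| ≤ M) :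
    ∃ C, 0 ≤ C ∧ ∀ x z, |mollify ρ u (x + z) - mollify ρ u x| ≤ C * ‖z‖ := by
  obtain ⟨L, hL⟩ := ContDiff.lipschitzWith_of_hasCompactSupport (𝕂 := ℝ) (n := 2) hρ.supp
    hρ.smooth (by norm_num)
  set K := Metric.cthickening 1 (tsupport ρ) with hK
  have hKc : IsCompact K := hρ.supp.isCompact.cthickening
  have hM0 : 0 ≤ M := (abs_nonneg _).trans (hM 0)
  refine ⟨M * L * volume.real K + 2 * M, by positivity, fun x z => ?_⟩
  have b1 := hρ.abs_mollify_le hM (x + z)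
  have b2 := hρ.abs_mollify_le hM x
  -- For short z the increment of the mollifier lives in a fixed compact set; for long z the bound
  -- 2M on the increment suffices.
  rcases le_or_gt ‖z‖ 1 with hz | hz
  · have e : mollify ρ u (x + z) - mollify ρ u x =
        ∫ y, u y * (fun t => ρ (t + z) - ρ t) (x - y) := by
      rw [mollify, mollify, ← integral_sub (hρ.integrable_mul hu hM _) (hρ.integrable_mul hu hM _)]
      congr 1; ext y
      rw [show x + z - y = x - y + z by abel]; ring
    rw [e]
    refine (abs_integral_le_of_support hKc hM x (B := L * ‖z‖)
      (d := fun t => ρ (t + z) - ρ t) (fun y => ?_)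
      fun y hy => ?_).trans ?_
    · have := hL.dist_le_mul (y + z) y
      simpa [Real.dist_eq, dist_eq_norm] using this
    · have h1 := eq_zero_of_notMem_cthickening hz hy
      have h2 := eq_zero_of_notMem_cthickening (z := 0) (by simp) hy
      rw [add_zero] at h2
      rw [h1, h2, sub_zero]
    · nlinarith [norm_nonneg z, mul_nonneg hM0 (norm_nonneg z)]
  · have h0 : 0 ≤ M * L * volume.real K := by positivity
    have : |mollify ρ u (x + z) - mollify ρ u x| ≤ 2 * M := by
      have a1 := abs_le.1 b1
      have a2 := abs_le.1 b2
      rw [abs_le]; constructor <;> linarith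
    nlinarith

theorem continuous_mollify (hρ : IsMollifier ρ) (hu : Measurable u) (hM : ∀ x, |u x| ≤ M) :
    Continuous (mollify ρ u) := by
  obtain ⟨C, hC, h⟩ := hρ.exists_lipschitz hu hM
  refine (LipschitzWith.of_dist_le_mul (K := ⟨C, hC⟩) fun x y => ?_).continuous
  have := h y (x - y)
  rw [add_sub_cancel] at this
  rw [Real.dist_eq, dist_eq_norm]
  exact this

/-- The second difference is moved onto the kernel, in the form in which the weak equation is
tested. -/
theorem mollify_second_diff (hρ : IsMollifier ρ) (hu : Measurable u) (hM : ∀ x, |u x| ≤ M)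
    (x z : Plane) : mollify ρ u (x + z) + mollify ρ u (x - z) - 2 * mollify ρ u x =
      ∫ y, u y * (ρ (x - (y + z)) + ρ (x - (y - z)) - 2 * ρ (x - y)) := by
  have i1 := hρ.integrable_mul hu hM (x + z)
  have i2 := hρ.integrable_mul hu hM (x - z)
  have i0 := hρ.integrable_mul hu hM x
  have i3 : Integrable (fun y => u y * ρ (x + z - y) + u y * ρ (x - z - y)) := i1.add i2
  rw [mollify, mollify, mollify, ← integral_const_mul, ← integral_add i1 i2,
    ← integral_sub i3 (i0.const_mul 2)]
  congr 1; ext y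
  rw [show x - (y + z) = x - z - y by abel, show x - (y - z) = x + z - y by abel]
  ring

theorem exists_second_diff (hρ : IsMollifier ρ) (hu : Measurable u) (hM : ∀ x, |u x| ≤ M) :
    ∃ C, ∀ x z, |mollify ρ u (x + z) + mollify ρ u (x - z) - 2 * mollify ρ u x| ≤
      C * ‖z‖ ^ 2 := by
  obtain ⟨L, hL0, hL⟩ := hρ.smooth.exists_second_diff_le hρ.supp
  set K := Metric.cthickening 1 (tsupport ρ) with hK
  have hKc : IsCompact K := hρ.supp.isCompact.cthickening
  have hM0 : 0 ≤ M := (abs_nonneg _).trans (hM 0)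
  refine ⟨M * L * volume.real K + 4 * M, fun x z => ?_⟩
  have b1 := hρ.abs_mollify_le hM (x + z)
  have b2 := hρ.abs_mollify_le hM x
  have b3 := hρ.abs_mollify_le hM (x - z)
  rcases le_or_gt ‖z‖ 1 with hz | hz
  · have e : mollify ρ u (x + z) + mollify ρ u (x - z) - 2 * mollify ρ u x =
        ∫ y, u y * (fun t => ρ (t + z) + ρ (t - z) - 2 * ρ t) (x - y) := by
      rw [hρ.mollify_second_diff hu hM]
      congr 1; ext y
      rw [show x - (y + z) = x - y - z by abel, show x - (y - z) = x - y + z by abel]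
      ring
    rw [e]
    refine (abs_integral_le_of_support hKc hM x (B := L * ‖z‖ ^ 2)
      (d := fun t => ρ (t + z) + ρ (t - z) - 2 * ρ t) (fun y => hL y z)
      fun y hy => ?_).trans ?_
    · have h1 := eq_zero_of_notMem_cthickening hz hy
      have h2 := eq_zero_of_notMem_cthickening (z := 0) (by simp) hy
      have h3 := eq_zero_of_notMem_cthickening (z := -z) (by simpa using hz) hy
      rw [add_zero] at h2
      rw [← sub_eq_add_neg] at h3
      rw [h1, h2, h3]; ring
    · nlinarith [sq_nonneg ‖z‖, mul_nonneg hM0 (sq_nonneg ‖z‖)]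
  · have h0 : 0 ≤ M * L * volume.real K := by positivity
    have : |mollify ρ u (x + z) + mollify ρ u (x - z) - 2 * mollify ρ u x| ≤ 4 * M := by
      have a1 := abs_le.1 b1
      have a2 := abs_le.1 b2
      have a3 := abs_le.1 b3
      rw [abs_le]; constructor <;> linarith
    have hz2 : 1 ≤ ‖z‖ ^ 2 := by nlinarith
    nlinarith

end IsMollifier

/-- Mollifying a principal value solution gives a regular solution. -/
theorem PVSolution.regularSolution_mollify {ν : Measure Plane} [SFinite ν] {δ₀ : ℝ}
    (hν : FiniteRange ν δ₀) {u F ρ : Plane → ℝ} {M M' : ℝ}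
    (hu : Continuous u) (hM : ∀ x, |u x| ≤ M) (hF : Continuous F) (hM' : ∀ x, |F x| ≤ M')
    (h : PVSolution ν u F) (hρ : IsMollifier ρ) :
    RegularSolution ν (mollify ρ u) (mollify ρ F) where
  cont := hρ.continuous_mollify hu.measurable hM
  bdd := ⟨M, hρ.abs_mollify_le hM⟩
  lip := by
    obtain ⟨C, -, hC⟩ := hρ.exists_lipschitz hu.measurable hM
    exact ⟨C, hC⟩
  sec := hρ.exists_second_diff hu.measurable hM
  contg := hρ.continuous_mollify hF.measurable hM'
  bddg := ⟨M', hρ.abs_mollify_le hM'⟩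
  eq x := by
    -- The weak equation tested with y ↦ ρ(x - y) is the pointwise equation of the mollified
    -- function at x.
    have h1 := h.weak_eq hν hu hM hF (hρ.isTest x)
    obtain ⟨D, -, -, hI⟩ := (hρ.isTest x).integrable_second_diff hν hu.measurable hM
    rw [integral_prod _ hI] at h1
    simp only [hρ.mollify_second_diff hu.measurable hM]
    rw [h1, mollify]
    congr 2; ext y; ring

/-- Mollifiers supported in the unit ball that approximate the identity. -/
theorem exists_mollifiers : ∃ ρ : ℕ → Plane → ℝ, (∀ n, IsMollifier (ρ n)) ∧
    (∀ n x, 1 < ‖x‖ → ρ n x = 0) ∧ ∀ w : Plane → ℝ, Continuous w → ∀ x,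
      Tendsto (fun n => mollify (ρ n) w x) atTop (𝓝 (w x)) := by
  set φ : ℕ → ContDiffBump (0 : Plane) := fun n =>
    ⟨1 / ((n : ℝ) + 1) / 2, 1 / ((n : ℝ) + 1), by positivity, half_lt_self (by positivity)⟩
  have hφ : Tendsto (fun n => (φ n).rOut) atTop (𝓝 0) := tendsto_one_div_add_atTop_nhds_zero_nat
  refine ⟨fun n => (φ n).normed volume, fun n =>
    { smooth := (φ n).contDiff_normed
      supp := (φ n).hasCompactSupport_normed
      nonneg := (φ n).nonneg_normed
      integral := (φ n).integral_normed }, fun n x hx => ?_, fun w hw x => ?_⟩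
  · by_contra h
    have h1 : x ∈ Function.support ((φ n).normed volume) := h
    rw [(φ n).support_normed_eq, mem_ball_zero_iff] at h1
    have h2 : (φ n).rOut ≤ 1 := by
      change 1 / ((n : ℝ) + 1) ≤ 1
      rw [div_le_one (by positivity)]
      linarith [(Nat.cast_nonneg n : (0 : ℝ) ≤ n)]
    linarith
  · have := ContDiffBump.convolution_tendsto_right_of_continuous (μ := volume) hφ hw x
    refine this.congr fun n => ?_
    rw [convolution_lsmul_swap, mollify]
    congr 1; ext y; rw [smul_eq_mul, mul_comm]

/-- Bounded principal value solutions are limits of regular solutions. -/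
theorem PVSolution.exists_approx {ν : Measure Plane} [SFinite ν] {δ₀ : ℝ}
    (hν : FiniteRange ν δ₀) {u F : Plane → ℝ} {M M' : ℝ}
    (hu : Continuous u) (hM : ∀ x, |u x| ≤ M) (hF : Continuous F) (hM' : ∀ x, |F x| ≤ M')
    (h : PVSolution ν u F) :
    ∃ v g : ℕ → Plane → ℝ, (∀ n, RegularSolution ν (v n) (g n)) ∧ (∀ n x, |v n x| ≤ M) ∧
      (∀ n x, |g n x| ≤ M') ∧ (∀ x, Tendsto (fun n => v n x) atTop (𝓝 (u x))) ∧
      ∀ x, Tendsto (fun n => g n x) atTop (𝓝 (F x)) := by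
  obtain ⟨ρ, hρ, -, hlim⟩ := exists_mollifiers
  exact ⟨fun n => mollify (ρ n) u, fun n => mollify (ρ n) F,
    fun n => h.regularSolution_mollify hν hu hM hF hM' (hρ n),
    fun n => (hρ n).abs_mollify_le hM, fun n => (hρ n).abs_mollify_le hM', hlim u hu, hlim F hF⟩

namespace RegularSolution

variable {ν : Measure Plane} {v g : Plane → ℝ} {δ₀ : ℝ}

theorem integrable_second_diff (hν : FiniteRange ν δ₀) (hv : RegularSolution ν v g) (x : Plane) :
    Integrable (fun z => v (x + z) + v (x - z) - 2 * v x) ν := by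
  obtain ⟨C, hC⟩ := hv.sec
  have := hv.cont
  exact (hν.sq.const_mul C).mono' (by fun_prop) (Eventually.of_forall fun z => hC x z)

/-- Translation invariance and linearity of the operator; the factor `s` allows difference
quotients. -/
theorem increment (hν : FiniteRange ν δ₀) (hv : RegularSolution ν v g) (h : Plane) (s : ℝ) :
    RegularSolution ν (fun x => s * (v (x + h) - v x)) (fun x => s * (g (x + h) - g x)) where
  cont := by have := hv.cont; fun_prop
  bdd := by
    obtain ⟨C, hC⟩ := hv.bdd
    refine ⟨|s| * (C + C), fun x => ?_⟩
    rw [abs_mul]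
    gcongr
    exact (abs_sub _ _).trans (add_le_add (hC _) (hC _))
  lip := by
    obtain ⟨C, hC⟩ := hv.lip
    refine ⟨|s| * (C + C), fun x z => ?_⟩
    rw [← mul_sub, abs_mul, mul_assoc]
    gcongr
    have e : v (x + z + h) - v (x + z) - (v (x + h) - v x) =
      (v (x + h + z) - v (x + h)) - (v (x + z) - v x) := by
        rw [add_right_comm x z h]; ring
    rw [e, add_mul]
    exact (abs_sub _ _).trans (add_le_add (hC _ _) (hC _ _))
  sec := by
    obtain ⟨C, hC⟩ := hv.sec
    refine ⟨|s| * (C + C), fun x z => ?_⟩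
    have e : s * (v (x + z + h) - v (x + z)) + s * (v (x - z + h) - v (x - z)) -
        2 * (s * (v (x + h) - v x)) =
      s * ((v (x + h + z) + v (x + h - z) - 2 * v (x + h)) -
        (v (x + z) + v (x - z) - 2 * v x)) := by
        rw [add_right_comm x z h, show x - z + h = x + h - z by abel]; ring
    rw [e, abs_mul, mul_assoc, add_mul]
    gcongr
    exact (abs_sub _ _).trans (add_le_add (hC _ _) (hC _ _))
  contg := by have := hv.contg; fun_prop
  bddg := by
    obtain ⟨C, hC⟩ := hv.bddg
    refine ⟨|s| * (C + C), fun x => ?_⟩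
    rw [abs_mul]
    gcongr
    exact (abs_sub _ _).trans (add_le_add (hC _) (hC _))
  eq x := by
    have e : ∀ z, s * (v (x + z + h) - v (x + z)) + s * (v (x - z + h) - v (x - z)) -
        2 * (s * (v (x + h) - v x)) =
      s * ((v (x + h + z) + v (x + h - z) - 2 * v (x + h)) -
        (v (x + z) + v (x - z) - 2 * v x)) := fun z => by
        rw [add_right_comm x z h, show x - z + h = x + h - z by abel]; ring
    simp only [e]
    rw [integral_const_mul, integral_sub (hv.integrable_second_diff hν _)
      (hv.integrable_second_diff hν _)]
    linear_combination s * (hv.eq (x + h)) - s * hv.eq x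

end RegularSolution

theorem expWeight.tendsto_integral (x₀ : Plane) {w : ℕ → Plane → ℝ} {w' : Plane → ℝ} {C : ℝ}
    (hw : ∀ n, Measurable (w n)) (hC : ∀ n x, |w n x| ≤ C)
    (h : ∀ x, Tendsto (fun n => w n x) atTop (𝓝 (w' x))) :
    Tendsto (fun n => ∫ x, expWeight x₀ x ^ 2 * w n x ^ 2) atTop
      (𝓝 (∫ x, expWeight x₀ x ^ 2 * w' x ^ 2)) := by
  have hc := expWeight.continuous x₀
  refine tendsto_integral_of_dominated_convergence (fun x => expWeight x₀ x ^ 2 * C ^ 2)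
    (fun n => ?_) ((expWeight.integrable x₀).mul_const _) (fun n => Eventually.of_forall fun x => ?_)
    (Eventually.of_forall fun x => ((h x).pow 2).const_mul _)
  · have := hw n
    exact Measurable.aestronglyMeasurable (by fun_prop)
  · rw [Real.norm_eq_abs, abs_mul, abs_of_nonneg (sq_nonneg (expWeight x₀ x)), abs_pow]
    have := hC n x
    gcongr

/-! ### Dyadic difference quotients: uniform bounds and geometric convergence. -/

/-- Second increments of a bounded solution are controlled by its first increments. -/
theorem PVSolution.exists_second_increment_le {ν : Measure Plane} [SFinite ν] {δ₀ c β δ₁ : ℝ}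
    (hν : FiniteRange ν δ₀) (hδ : 0 ≤ δ₀) (hd : DominatesBalls ν c β δ₁) (hc : 0 < c)
    (hβ : β ≤ 2) {u F : Plane → ℝ} {M M' K : ℝ}
    (hu : Continuous u) (hM : ∀ x, |u x| ≤ M) (hF : Continuous F) (hM' : ∀ x, |F x| ≤ M')
    (hK : ∀ x y, |F y - F x| ≤ K * |u y - u x|) (h : PVSolution ν u F) :
    ∃ A, 0 ≤ A ∧ ∀ x₀ h : Plane, h ≠ 0 → ‖h‖ ≤ 1 → 2 * ‖h‖ ≤ δ₁ →
      ∫ x, expWeight x₀ x ^ 2 * (u (x + h + h) - u (x + h) - (u (x + h) - u x)) ^ 2 ≤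
        A * ‖h‖ ^ β * ∫ x, expWeight x₀ x ^ 2 * (u (x + h) - u x) ^ 2 := by
  obtain ⟨A, hA, H⟩ := RegularSolution.exists_increment_le hν hδ hd hc hβ
  obtain ⟨v, g, hreg, hvM, hgM, hv, hg⟩ := h.exists_approx hν hu hM hF hM'
  refine ⟨A * (1 + K ^ 2), by positivity, fun x₀ h h0 h1 hδ₁ => ?_⟩
  -- The increment estimate is applied to functions that are themselves increments, hence second
  -- increments on the left.
  have key := fun n => H _ _ ((hreg n).increment hν h 1) x₀ h h0 h1 hδ₁
  simp only [one_mul] at key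
  have hvc := fun n => (hreg n).cont.measurable
  have hgc := fun n => (hreg n).contg.measurable
  have b : ∀ {w : ℕ → Plane → ℝ} {C : ℝ}, (∀ n x, |w n x| ≤ C) →
      ∀ n x, |w n (x + h) - w n x| ≤ C + C := fun hw n x =>
    (abs_sub _ _).trans (add_le_add (hw _ _) (hw _ _))
  have l1 := expWeight.tendsto_integral x₀ (w := fun n x => v n (x + h) - v n x)
    (fun n => by have := hvc n; fun_prop) (b hvM) (fun x => (hv (x + h)).sub (hv x))
  have l2 := expWeight.tendsto_integral x₀ (w := fun n x => g n (x + h) - g n x)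
    (fun n => by have := hgc n; fun_prop) (b hgM) (fun x => (hg (x + h)).sub (hg x))
  have l3 := expWeight.tendsto_integral x₀
    (w := fun n x => v n (x + h + h) - v n (x + h) - (v n (x + h) - v n x))
    (fun n => by have := hvc n; fun_prop)
    (fun n x => b (w := fun n x => v n (x + h) - v n x) (b hvM) n x)
    (fun x => ((hv (x + h + h)).sub (hv (x + h))).sub ((hv (x + h)).sub (hv x)))
  have l4 := le_of_tendsto_of_tendsto' l3 ((l1.add l2).const_mul (A * ‖h‖ ^ β)) key
  refine l4.trans ?_
  -- The right side of the equation for the increment is absorbed through the Lipschitz bound of F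
  -- in terms of `u`.
  have l5 : ∫ x, expWeight x₀ x ^ 2 * (F (x + h) - F x) ^ 2 ≤
      K ^ 2 * ∫ x, expWeight x₀ x ^ 2 * (u (x + h) - u x) ^ 2 := by
    rw [← integral_const_mul]
    refine integral_mono
      (expWeight.integrable_mul x₀ (w := fun x => F (x + h) - F x) (C := M' + M')
        (by have := hF.measurable; fun_prop)
        fun x => (abs_sub _ _).trans (add_le_add (hM' _) (hM' _)))
      ((expWeight.integrable_mul x₀ (w := fun x => u (x + h) - u x) (C := M + M)
        (by have := hu.measurable; fun_prop)
        fun x => (abs_sub _ _).trans (add_le_add (hM _) (hM _))).const_mul _) fun x => ?_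
    have := hK x (x + h)
    have h2 : (F (x + h) - F x) ^ 2 ≤ K ^ 2 * (u (x + h) - u x) ^ 2 := by
      rw [← sq_abs, ← sq_abs (u (x + h) - u x), ← mul_pow]
      gcongr
    calc _ ≤ expWeight x₀ x ^ 2 * (K ^ 2 * (u (x + h) - u x) ^ 2) := by gcongr
      _ = _ := by ring
  have h0 : 0 ≤ A * ‖h‖ ^ β := by positivity
  calc _ ≤ A * ‖h‖ ^ β * ((∫ x, expWeight x₀ x ^ 2 * (u (x + h) - u x) ^ 2) +
        K ^ 2 * ∫ x, expWeight x₀ x ^ 2 * (u (x + h) - u x) ^ 2) := by gcongr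
    _ = _ := by ring

/-- The dyadic difference quotient `2 ^ k (u (x + 2⁻ᵏ e) - u x)`. -/
noncomputable def dyadicQuotient (u : Plane → ℝ) (e : Plane) (k : ℕ) (x : Plane) : ℝ :=
  2 ^ k * (u (x + (2⁻¹ : ℝ) ^ k • e) - u x)

/-- Halving the step changes the quotient by a rescaled second increment, the quantity that carries
the gain |h|^β. -/
theorem dyadicQuotient_succ_sub (u : Plane → ℝ) (e : Plane) (k : ℕ) (x : Plane) :
    dyadicQuotient u e (k + 1) x - dyadicQuotient u e k x =
      -(2 ^ k * (u (x + (2⁻¹ : ℝ) ^ (k + 1) • e + (2⁻¹ : ℝ) ^ (k + 1) • e) -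
        u (x + (2⁻¹ : ℝ) ^ (k + 1) • e) - (u (x + (2⁻¹ : ℝ) ^ (k + 1) • e) - u x))) := by
  have : x + (2⁻¹ : ℝ) ^ (k + 1) • e + (2⁻¹ : ℝ) ^ (k + 1) • e = x + (2⁻¹ : ℝ) ^ k • e := by
    rw [add_assoc, ← add_smul]; congr 2; rw [pow_succ]; ring
  rw [this, dyadicQuotient, dyadicQuotient]; ring

theorem continuous_dyadicQuotient {u : Plane → ℝ} (hu : Continuous u) (e : Plane) (k : ℕ) :
    Continuous (dyadicQuotient u e k) := by
  unfold dyadicQuotient; fun_prop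

theorem abs_dyadicQuotient_le {u : Plane → ℝ} {M : ℝ} (hM : ∀ x, |u x| ≤ M) (e : Plane) (k : ℕ)
    (x : Plane) : |dyadicQuotient u e k x| ≤ 2 ^ k * (M + M) := by
  rw [dyadicQuotient, abs_mul, abs_of_pos (by positivity : (0 : ℝ) < 2 ^ k)]
  gcongr
  exact (abs_sub _ _).trans (add_le_add (hM _) (hM _))

/-- The product of the factors 1 + p^k is at most the exponential of a geometric series. -/
theorem bounded_of_le_geometric_factor {N : ℕ → ℝ} {p : ℝ} (hp : 0 ≤ p) (hp1 : p < 1)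
    (hN : ∀ k, 0 ≤ N k) (h : ∀ k, N (k + 1) ≤ (1 + p ^ k) * N k) (k : ℕ) :
    N k ≤ Real.exp (1 / (1 - p)) * N 0 := by
  have h1 : ∀ k, N k ≤ Real.exp (∑ i ∈ Finset.range k, p ^ i) * N 0 := fun k => by
    induction k with
    | zero => simp
    | succ k ih =>
      rw [Finset.sum_range_succ, Real.exp_add, mul_comm (Real.exp _) (Real.exp _), mul_assoc]
      refine (h k).trans ?_
      have := Real.add_one_le_exp (p ^ k)
      rw [add_comm] at this
      exact mul_le_mul this ih (hN k) (Real.exp_pos _).le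
  refine (h1 k).trans ?_
  have h2 : ∑ i ∈ Finset.range k, p ^ i ≤ 1 / (1 - p) := by
    rw [one_div, ← tsum_geometric_of_lt_one hp hp1]
    exact (summable_geometric_of_lt_one hp hp1).sum_le_tsum _ fun i _ => by positivity
  have := hN 0
  gcongr

/-- Uniform bounds for the dyadic difference quotients of a bounded solution. -/
theorem PVSolution.exists_dyadicQuotient_le {ν : Measure Plane} [SFinite ν] {δ₀ c β δ₁ : ℝ}
    (hν : FiniteRange ν δ₀) (hδ : 0 ≤ δ₀) (hd : DominatesBalls ν c β δ₁) (hc : 0 < c)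
    (hδ₁ : 0 < δ₁) (hβ0 : 0 < β) (hβ : β ≤ 2) {u F : Plane → ℝ} {M M' K : ℝ}
    (hu : Continuous u) (hM : ∀ x, |u x| ≤ M) (hF : Continuous F) (hM' : ∀ x, |F x| ≤ M')
    (hK : ∀ x y, |F y - F x| ≤ K * |u y - u x|) (h : PVSolution ν u F) :
    ∃ r C p : ℝ, 0 < r ∧ 0 ≤ C ∧ 0 < p ∧ p < 1 ∧ ∀ e x₀ : Plane, e ≠ 0 → ‖e‖ ≤ r → ∀ k : ℕ,
      ∫ x, expWeight x₀ x ^ 2 * dyadicQuotient u e k x ^ 2 ≤ C ∧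
      ∫ x, expWeight x₀ x ^ 2 * (dyadicQuotient u e (k + 1) x - dyadicQuotient u e k x) ^ 2 ≤
        C * (p ^ k) ^ 2 := by
  obtain ⟨A, hA, H⟩ := h.exists_second_increment_le hν hδ hd hc hβ hu hM hF hM' hK
  have hM0 : 0 ≤ M := (abs_nonneg _).trans (hM 0)
  -- The gain for squared norms at step 2⁻ᵏ is 2^(-kβ) = (p^k)².
  set p : ℝ := (2⁻¹ : ℝ) ^ (β / 2) with hp
  have hp0 : 0 ≤ p := by positivity
  have hp1 : p < 1 := Real.rpow_lt_one (by norm_num) (by norm_num) (by positivity)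
  have hr : ∃ r : ℝ, 0 < r ∧ A * r ^ β ≤ 1 / 4 := by
    have : Tendsto (fun r : ℝ => A * r ^ β) (𝓝[>] 0) (𝓝 (A * 0 ^ β)) :=
      ((Real.continuous_rpow_const hβ0.le).tendsto 0 |>.const_mul A).mono_left nhdsWithin_le_nhds
    rw [Real.zero_rpow hβ0.ne', mul_zero] at this
    obtain ⟨r, h1, h2⟩ := ((this.eventually (gt_mem_nhds (by norm_num : (0 : ℝ) < 1 / 4))).and
      eventually_mem_nhdsWithin).exists
    exact ⟨r, h2, h1.le⟩
  obtain ⟨r, hr0, hrA⟩ := hr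
  set W := ∫ x, expWeight 0 x ^ 2 with hW
  have hW0 : 0 ≤ W := integral_nonneg fun x => by positivity
  refine ⟨min r (min 1 δ₁), Real.exp (1 / (1 - p)) * (W * (M + M) ^ 2), p, by positivity,
    by positivity, by positivity, hp1, fun e x₀ he her => ?_⟩
  set D := dyadicQuotient u e with hD
  set N : ℕ → ℝ := fun k => ∫ x, expWeight x₀ x ^ 2 * D k x ^ 2 with hN
  have hDm : ∀ k, Measurable (D k) := fun k => (continuous_dyadicQuotient hu e k).measurable
  have hDi : ∀ k, Integrable (fun x => expWeight x₀ x ^ 2 * D k x ^ 2) := fun k =>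
    expWeight.integrable_mul x₀ (hDm k) (abs_dyadicQuotient_le hM e k)
  have hN0 : ∀ k, 0 ≤ N k := fun k => integral_nonneg fun x => by positivity
  -- One factor 1/4 is (2^k)² / (2^(k+1))², the other is the choice A r^β ≤ 1/4; their product is
  -- what makes s = p^k / 4 fit below.
  have hdiff : ∀ k, ∫ x, expWeight x₀ x ^ 2 * (D (k + 1) x - D k x) ^ 2 ≤
      1 / 16 * (p ^ k) ^ 2 * N (k + 1) := fun k => by
    set h := (2⁻¹ : ℝ) ^ (k + 1) • e with hh
    have hn : ‖h‖ = (2⁻¹ : ℝ) ^ (k + 1) * ‖e‖ := by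
      rw [hh, norm_smul, Real.norm_eq_abs, abs_of_pos (by positivity)]
    have h2 : (2⁻¹ : ℝ) ^ (k + 1) ≤ 2⁻¹ := pow_le_of_le_one (by norm_num) (by norm_num) (by simp)
    have hen := norm_nonneg e
    have hmin := her
    simp only [le_min_iff] at hmin
    have h3 := H x₀ h (smul_ne_zero (by positivity) he) (by rw [hn]; nlinarith)
      (by rw [hn]; nlinarith)
    have e1 : ∫ x, expWeight x₀ x ^ 2 * (D (k + 1) x - D k x) ^ 2 = (2 ^ k) ^ 2 *
        ∫ x, expWeight x₀ x ^ 2 * (u (x + h + h) - u (x + h) - (u (x + h) - u x)) ^ 2 := by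
      rw [← integral_const_mul]
      congr 1; ext x
      rw [hD, dyadicQuotient_succ_sub]; ring
    have e2 : N (k + 1) = (2 ^ (k + 1)) ^ 2 *
        ∫ x, expWeight x₀ x ^ 2 * (u (x + h) - u x) ^ 2 := by
      rw [← integral_const_mul, hN]
      dsimp only
      congr 1; ext x
      rw [hD, dyadicQuotient]; ring
    have e3 : ‖h‖ ^ β ≤ (p ^ k) ^ 2 * ‖e‖ ^ β := by
      rw [hn, Real.mul_rpow (by positivity) hen]
      refine mul_le_mul_of_nonneg_right ?_ (by positivity)
      rw [hp, ← Real.rpow_natCast, ← Real.rpow_natCast, ← Real.rpow_natCast,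
        ← Real.rpow_mul (by positivity), ← Real.rpow_mul (by positivity),
        ← Real.rpow_mul (by positivity)]
      refine Real.rpow_le_rpow_of_exponent_ge (by norm_num) (by norm_num) ?_
      push_cast; nlinarith
    have e4 : A * ‖e‖ ^ β ≤ 1 / 4 := le_trans (by gcongr; exact hmin.1) hrA
    have hI : 0 ≤ ∫ x, expWeight x₀ x ^ 2 * (u (x + h) - u x) ^ 2 :=
      integral_nonneg fun x => by positivity
    rw [e1, e2]
    calc _ ≤ (2 ^ k) ^ 2 * (A * ‖h‖ ^ β * ∫ x, expWeight x₀ x ^ 2 * (u (x + h) - u x) ^ 2) := by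
          gcongr
      _ ≤ (2 ^ k) ^ 2 * (A * ((p ^ k) ^ 2 * ‖e‖ ^ β) *
            ∫ x, expWeight x₀ x ^ 2 * (u (x + h) - u x) ^ 2) := by gcongr
      _ = (2 ^ k) ^ 2 * ((A * ‖e‖ ^ β) * (p ^ k) ^ 2 *
            ∫ x, expWeight x₀ x ^ 2 * (u (x + h) - u x) ^ 2) := by ring
      _ ≤ (2 ^ k) ^ 2 * (1 / 4 * (p ^ k) ^ 2 *
            ∫ x, expWeight x₀ x ^ 2 * (u (x + h) - u x) ^ 2) := by gcongr
      _ = _ := by ring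
  have hstep : ∀ k, N (k + 1) ≤ (1 + p ^ k) * N k := fun k => by
    set s := p ^ k / 4 with hs
    have h0 : 0 < p ^ k := by positivity
    have hs0 : 0 < s := by positivity
    have hs1 : s ≤ 1 / 4 := by
      have := pow_le_one₀ (n := k) hp0 hp1.le
      rw [hs]; linarith
    -- Young's inequality with parameter s. The difference is bounded by s² N(k+1), so the last term
    -- is (s² + s) N(k+1) and is absorbed on the left.
    have h1 : N (k + 1) ≤ (1 + s) * N k + (1 + 1 / s) *
        ∫ x, expWeight x₀ x ^ 2 * (D (k + 1) x - D k x) ^ 2 := by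
      have hi : Integrable (fun x => expWeight x₀ x ^ 2 * (D (k + 1) x - D k x) ^ 2) :=
        expWeight.integrable_mul x₀ ((hDm (k + 1)).sub (hDm k)) fun x =>
          (abs_sub _ _).trans (add_le_add (abs_dyadicQuotient_le hM e (k + 1) x)
            (abs_dyadicQuotient_le hM e k x))
      rw [hN]; dsimp only
      rw [← integral_const_mul, ← integral_const_mul, ← integral_add ((hDi k).const_mul _)
        (hi.const_mul _)]
      refine integral_mono (hDi _) (((hDi k).const_mul _).add (hi.const_mul _)) fun x => ?_
      have : D (k + 1) x ^ 2 ≤ (1 + s) * D k x ^ 2 + (1 + 1 / s) * (D (k + 1) x - D k x) ^ 2 := by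
        set a := D k x
        set b := D (k + 1) x - D k x with hb
        have e : D (k + 1) x = a + b := by rw [hb]; ring
        have e2 : (1 + s) * a ^ 2 + (1 + 1 / s) * b ^ 2 - (a + b) ^ 2 = (s * a - b) ^ 2 / s := by
          field_simp; ring
        have : 0 ≤ (s * a - b) ^ 2 / s := by positivity
        rw [e]; linarith
      have h2 := mul_le_mul_of_nonneg_left this (sq_nonneg (expWeight x₀ x))
      dsimp only
      linarith
    have h2 : (1 + 1 / s) * ∫ x, expWeight x₀ x ^ 2 * (D (k + 1) x - D k x) ^ 2 ≤
        (s ^ 2 + s) * N (k + 1) := by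
      have := mul_le_mul_of_nonneg_left (hdiff k) (by positivity : 0 ≤ 1 + 1 / s)
      refine this.trans (le_of_eq ?_)
      have : p ^ k = 4 * s := by rw [hs]; ring
      rw [this]; field_simp; ring
    have h3 : (1 - s - s ^ 2) * N (k + 1) ≤ (1 + s) * N k := by linarith
    have h4 : 0 < 1 - s - s ^ 2 := by nlinarith
    have h5 : 1 + s ≤ (1 + 4 * s) * (1 - s - s ^ 2) := by nlinarith [mul_pos hs0 hs0]
    have : p ^ k = 4 * s := by rw [hs]; ring
    rw [this]
    refine le_of_mul_le_mul_left (h3.trans ?_) h4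
    calc _ ≤ (1 + 4 * s) * (1 - s - s ^ 2) * N k := by have := hN0 k; gcongr
      _ = _ := by ring
  have hbound : ∀ k, N k ≤ Real.exp (1 / (1 - p)) * (W * (M + M) ^ 2) := fun k => by
    refine (bounded_of_le_geometric_factor hp0 hp1 hN0 hstep k).trans ?_
    gcongr
    rw [hW, ← expWeight.integral_eq x₀, ← integral_mul_const]
    refine integral_mono (hDi 0) ((expWeight.integrable x₀).mul_const _) fun x => ?_
    have := abs_dyadicQuotient_le hM e 0 x
    rw [pow_zero, one_mul] at this
    dsimp only
    rw [← sq_abs (D 0 x)]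
    gcongr
  intro k
  refine ⟨hbound k, (hdiff k).trans ?_⟩
  have := hbound (k + 1)
  have h0 := hN0 (k + 1)
  have hpk := sq_nonneg (p ^ k)
  nlinarith [mul_le_mul_of_nonneg_left this hpk, mul_nonneg hpk h0]

/-! ### Stability and the submodularity of the second variation. -/

/-- Nonnegativity of the second variation with potential `c` on `C¹` functions with compact
support. -/
def StableFor (ν : Measure Plane) (c : Plane → ℝ) : Prop :=
  ∀ ζ : Plane → ℝ, ContDiff ℝ 1 ζ → HasCompactSupport ζ →
    ∫ x, c x * ζ x ^ 2 ≤
      (1 / 2) * ∫ p : Plane × Plane, (ζ (p.2 + p.1) - ζ p.2) ^ 2 ∂(ν.prod volume)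

/-- A Lipschitz function with compact support is a weight dominated by a multiple of the indicator
of a compact set. -/
theorem LipschitzWith.isWeight {ζ : Plane → ℝ} {L : NNReal} (hL : LipschitzWith L ζ) {K : Set Plane}
    (hK : IsCompact K) (hK0 : ∀ x ∉ K, ζ x = 0) {B : ℝ} (hB : ∀ x, |ζ x| ≤ B) (δ₀ : ℝ) :
    IsWeight δ₀ ζ ((Metric.cthickening δ₀ K).indicator fun _ => (L : ℝ) + B) where
  cont := hL.continuous
  int := by
    have h1 : IsCompact (Metric.cthickening δ₀ K) := hK.cthickening
    have : Integrable ((Metric.cthickening δ₀ K).indicator fun _ => ((L : ℝ) + B) ^ 2) :=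
      (integrable_indicator_iff h1.measurableSet).2 (integrableOn_const h1.measure_lt_top.ne)
    refine this.congr (Eventually.of_forall fun x => ?_)
    by_cases hx : x ∈ Metric.cthickening δ₀ K <;> simp [hx]
  le x := by
    by_cases hx : x ∈ Metric.cthickening δ₀ K
    · rw [Set.indicator_of_mem hx]
      linarith [hB x, NNReal.coe_nonneg L]
    · rw [hK0 x fun h => hx (Metric.self_subset_cthickening _ h)]
      simp [hx]
  diff x z hz := by
    by_cases hx : x ∈ Metric.cthickening δ₀ K
    · rw [Set.indicator_of_mem hx]
      have h1 := hL.dist_le_mul (x + z) x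
      rw [Real.dist_eq, dist_eq_norm, add_sub_cancel_left] at h1
      have h2 := (abs_nonneg _).trans (hB x)
      nlinarith [norm_nonneg z]
    · rw [hK0 x fun h => hx (Metric.self_subset_cthickening _ h), hK0 (x + z) fun h => hx ?_]
      · simp [hx]
      · refine Metric.mem_cthickening_of_dist_le x (x + z) δ₀ _ h ?_
        simpa [dist_eq_norm] using hz

theorem HasCompactSupport.exists_abs_le {ζ : Plane → ℝ} (hs : HasCompactSupport ζ)
    (hc : Continuous ζ) : ∃ B, ∀ x, |ζ x| ≤ B := by
  obtain ⟨B, hB⟩ := hs.exists_bound_of_continuous hc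
  exact ⟨B, hB⟩

/-- Stability extends to Lipschitz functions with compact support. -/
theorem StableFor.lipschitz {ν : Measure Plane} [SFinite ν] {δ₀ : ℝ} (hν : FiniteRange ν δ₀)
    {c ζ : Plane → ℝ} (h : StableFor ν c) (hc : Continuous c) {L : NNReal}
    (hL : LipschitzWith L ζ) (hs : HasCompactSupport ζ) :
    ∫ x, c x * ζ x ^ 2 ≤
      (1 / 2) * ∫ p : Plane × Plane, (ζ (p.2 + p.1) - ζ p.2) ^ 2 ∂(ν.prod volume) := by
  obtain ⟨ρ, hρ, hρ1, hlim⟩ := exists_mollifiers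
  obtain ⟨B, hB⟩ := hs.exists_abs_le hL.continuous
  have hζm := hL.continuous.measurable
  set ξ : ℕ → Plane → ℝ := fun n => mollify (ρ n) ζ with hξ
  set K := Metric.cthickening 1 (tsupport ζ) with hK
  have hKc : IsCompact K := hs.isCompact.cthickening
  have hξc : ∀ n, ContDiff ℝ 1 (ξ n) := fun n =>
    (hρ n).supp.contDiff_convolution_right (L := ContinuousLinearMap.mul ℝ ℝ)
      (hL.continuous.locallyIntegrable (μ := volume)) ((hρ n).smooth.of_le (by norm_num))
  have hξB : ∀ n x, |ξ n x| ≤ B := fun n => (hρ n).abs_mollify_le hB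
  have hξ0 : ∀ n, ∀ x ∉ K, ξ n x = 0 := fun n x hx => by
    have : ∀ y, ζ y * ρ n (x - y) = 0 := fun y => by
      by_contra hy
      refine hx (Metric.mem_cthickening_of_dist_le x y 1 _
        (subset_tsupport _ (left_ne_zero_of_mul hy)) ?_)
      by_contra hd
      rw [not_le, dist_eq_norm] at hd
      exact right_ne_zero_of_mul hy (hρ1 n _ hd)
    simp [hξ, mollify, this]
  -- A common Lipschitz constant and a common compact support provide one dominating function for
  -- all the mollified energies.
  have hξL : ∀ n, LipschitzWith L (ξ n) := fun n => by
    refine LipschitzWith.of_dist_le_mul fun x y => ?_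
    rw [Real.dist_eq]
    have e : ∀ x, ξ n x = ∫ t, ζ (x - t) * ρ n t := fun x => by
      rw [hξ]; dsimp only
      rw [mollify, ← integral_sub_left_eq_self _ _ x]
      simp
    have i : ∀ x, Integrable (fun t => ζ (x - t) * ρ n t) := fun x =>
      (hρ n).integrable.bdd_mul (c := B) (Measurable.aestronglyMeasurable (by fun_prop))
        (Eventually.of_forall fun t => hB _)
    rw [e, e, ← integral_sub (i x) (i y), ← Real.norm_eq_abs]
    have e2 : ∫ t, (L : ℝ) * dist x y * ρ n t = L * dist x y := by
      rw [integral_const_mul, (hρ n).integral, mul_one]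
    rw [← e2]
    refine norm_integral_le_of_norm_le ((hρ n).integrable.const_mul _)
      (Eventually.of_forall fun t => ?_)
    rw [← sub_mul, Real.norm_eq_abs, abs_mul, abs_of_nonneg ((hρ n).nonneg t)]
    have := (hρ n).nonneg t
    gcongr
    have := hL.dist_le_mul (x - t) (y - t)
    rwa [Real.dist_eq, dist_sub_right] at this
  have hw := fun n => (hξL n).isWeight hKc (hξ0 n) (hξB n) δ₀
  set m := (Metric.cthickening δ₀ K).indicator fun _ => (L : ℝ) + B with hm
  have hcl := hL.continuous
  have hζlim := hlim ζ hcl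
  have l1 : Tendsto (fun n => ∫ x, c x * ξ n x ^ 2) atTop (𝓝 (∫ x, c x * ζ x ^ 2)) := by
    obtain ⟨Cc, hCc⟩ := hKc.exists_bound_of_continuousOn hc.continuousOn
    have hi : Integrable (K.indicator fun _ => Cc * B ^ 2) :=
      (integrable_indicator_iff hKc.measurableSet).2 (integrableOn_const hKc.measure_lt_top.ne)
    refine tendsto_integral_of_dominated_convergence _ (fun n => ?_) hi
      (fun n => Eventually.of_forall fun x => ?_)
      (Eventually.of_forall fun x => ((hζlim x).pow 2).const_mul _)
    · have := (hξc n).continuous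
      fun_prop
    · by_cases hx : x ∈ K
      · rw [Set.indicator_of_mem hx, norm_mul, norm_pow]
        have := (norm_nonneg _).trans (hCc x hx)
        gcongr
        · exact hCc x hx
        · exact hξB n x
      · simp [hξ0 n x hx, hx]
  have l2 : Tendsto (fun n => ∫ p : Plane × Plane, (ξ n (p.2 + p.1) - ξ n p.2) ^ 2
      ∂(ν.prod volume)) atTop
      (𝓝 (∫ p : Plane × Plane, (ζ (p.2 + p.1) - ζ p.2) ^ 2 ∂(ν.prod volume))) := by
    refine tendsto_integral_of_dominated_convergence _ (fun n => ?_)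
      (hν.sq.mul_prod (hw 0).int) (fun n => ?_)
      (Eventually.of_forall fun p => ((hζlim _).sub (hζlim _)).pow 2)
    · have := (hξc n).continuous
      fun_prop
    · filter_upwards [hν.ae_prod] with p hp
      rw [norm_pow, Real.norm_eq_abs, ← mul_pow]
      have := (hw n).diff p.2 p.1 hp
      gcongr
  exact le_of_tendsto_of_tendsto' l1 (l2.const_mul _) fun n =>
    h (ξ n) (hξc n) (HasCompactSupport.intro hKc (hξ0 n))

/-- The source of submodularity: the squared increments of the maximum and minimum fall short of
those of `a` and `b` exactly when the order of `a` and `b` is reversed across the jump. -/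
theorem max_min_increment (a a' b b' : ℝ) :
    (max a' b' - max a b) ^ 2 + (min a' b' - min a b) ^ 2 =
      (a' - a) ^ 2 + (b' - b) ^ 2 -
        2 * (max (b - a) 0 * max (a' - b') 0 + max (a - b) 0 * max (b' - a') 0) := by
  rcases le_total a b with h | h <;> rcases le_total a' b' with h' | h' <;>
    simp [h, h'] <;> ring

/-- The interaction of two competitors is controlled by their second variations. -/
theorem StableFor.interaction_le {ν : Measure Plane} [SFinite ν] {δ₀ : ℝ} (hν : FiniteRange ν δ₀)
    {c a b : Plane → ℝ} (h : StableFor ν c) (hc : Continuous c) {L L' : NNReal}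
    (ha : LipschitzWith L a) (has : HasCompactSupport a)
    (hb : LipschitzWith L' b) (hbs : HasCompactSupport b) :
    Integrable (fun p : Plane × Plane => max (b p.2 - a p.2) 0 *
      max (a (p.2 + p.1) - b (p.2 + p.1)) 0) (ν.prod volume) ∧
    ∫ p : Plane × Plane, max (b p.2 - a p.2) 0 * max (a (p.2 + p.1) - b (p.2 + p.1)) 0
        ∂(ν.prod volume) ≤
      ((1 / 2) * (∫ p : Plane × Plane, (a (p.2 + p.1) - a p.2) ^ 2 ∂(ν.prod volume)) -
        ∫ x, c x * a x ^ 2) +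
      ((1 / 2) * (∫ p : Plane × Plane, (b (p.2 + p.1) - b p.2) ^ 2 ∂(ν.prod volume)) -
        ∫ x, c x * b x ^ 2) := by
  have hac := ha.continuous
  have hbc := hb.continuous
  have hint : ∀ {f : Plane → ℝ} {L : NNReal}, LipschitzWith L f → HasCompactSupport f →
      Integrable (fun p : Plane × Plane => (f (p.2 + p.1) - f p.2) ^ 2) (ν.prod volume) :=
    fun {f L} hf hs => by
      have hfc := hf.continuous
      obtain ⟨B, hB⟩ := hs.exists_abs_le hfc
      have hw := hf.isWeight hs (fun x hx => image_eq_zero_of_notMem_tsupport hx) hB δ₀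
      refine hν.integrable_prod (by fun_prop) hw.int (C := 1) fun z x hz => ?_
      have := hw.diff x z hz
      rw [abs_pow]
      calc _ ≤ (‖z‖ * _) ^ 2 := by gcongr
        _ = _ := by ring
  have hint' : ∀ {f : Plane → ℝ}, Continuous f → HasCompactSupport f →
      Integrable (fun x => c x * f x ^ 2) := fun {f} hf hs => by
    refine Continuous.integrable_of_hasCompactSupport (by fun_prop) ?_
    have : HasCompactSupport (fun x => f x ^ 2) := hs.comp_left (g := fun t => t ^ 2) (by simp)
    exact this.mul_left
  have hKc : IsCompact (tsupport a ∪ tsupport b) := has.isCompact.union hbs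
  have hsM : HasCompactSupport (fun x => max (a x) (b x)) := HasCompactSupport.intro hKc
    fun x hx => by
      rw [Set.mem_union, not_or] at hx
      simp [image_eq_zero_of_notMem_tsupport hx.1, image_eq_zero_of_notMem_tsupport hx.2]
  have hsm : HasCompactSupport (fun x => min (a x) (b x)) := HasCompactSupport.intro hKc
    fun x hx => by
      rw [Set.mem_union, not_or] at hx
      simp [image_eq_zero_of_notMem_tsupport hx.1, image_eq_zero_of_notMem_tsupport hx.2]
  have hLM := ha.max hb
  have hLm := ha.min hb
  -- Stability is used only here: the second variations at the maximum and at the minimum are both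
  -- nonnegative. Maxima and minima are not C¹, whence the extension to Lipschitz functions.
  have s1 := h.lipschitz hν hc hLM hsM
  have s2 := h.lipschitz hν hc hLm hsm
  have iM := hint hLM hsM
  have im := hint hLm hsm
  have ia := hint ha has
  have ib := hint hb hbs
  have e1 : (∫ x, c x * max (a x) (b x) ^ 2) + ∫ x, c x * min (a x) (b x) ^ 2 =
      (∫ x, c x * a x ^ 2) + ∫ x, c x * b x ^ 2 := by
    rw [← integral_add (hint' hLM.continuous hsM) (hint' hLm.continuous hsm),
      ← integral_add (hint' hac has) (hint' hbc hbs)]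
    congr 1; ext x
    rcases le_total (a x) (b x) with hx | hx <;> simp [hx, add_comm]
  have hI : Integrable (fun p : Plane × Plane => max (b p.2 - a p.2) 0 *
      max (a (p.2 + p.1) - b (p.2 + p.1)) 0) (ν.prod volume) := by
    refine (ia.add ib).mono' (by fun_prop) (Eventually.of_forall fun p => ?_)
    have := max_min_increment (a p.2) (a (p.2 + p.1)) (b p.2) (b (p.2 + p.1))
    have h1 : 0 ≤ max (b p.2 - a p.2) 0 * max (a (p.2 + p.1) - b (p.2 + p.1)) 0 := by positivity
    have h2 : 0 ≤ max (a p.2 - b p.2) 0 * max (b (p.2 + p.1) - a (p.2 + p.1)) 0 := by positivity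
    rw [Real.norm_eq_abs, abs_of_nonneg h1, Pi.add_apply]
    nlinarith [sq_nonneg (max (a (p.2 + p.1)) (b (p.2 + p.1)) - max (a p.2) (b p.2)),
      sq_nonneg (min (a (p.2 + p.1)) (b (p.2 + p.1)) - min (a p.2) (b p.2))]
  refine ⟨hI, ?_⟩
  -- Of the two reversal terms only one is kept; the other has a favourable sign.
  have e2 : (∫ p : Plane × Plane, (max (a (p.2 + p.1)) (b (p.2 + p.1)) -
        max (a p.2) (b p.2)) ^ 2 ∂(ν.prod volume)) +
      (∫ p : Plane × Plane, (min (a (p.2 + p.1)) (b (p.2 + p.1)) -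
        min (a p.2) (b p.2)) ^ 2 ∂(ν.prod volume)) ≤
      (∫ p : Plane × Plane, (a (p.2 + p.1) - a p.2) ^ 2 ∂(ν.prod volume)) +
      (∫ p : Plane × Plane, (b (p.2 + p.1) - b p.2) ^ 2 ∂(ν.prod volume)) -
      2 * ∫ p : Plane × Plane, max (b p.2 - a p.2) 0 * max (a (p.2 + p.1) - b (p.2 + p.1)) 0
        ∂(ν.prod volume) := by
    have iab : Integrable (fun p : Plane × Plane =>
      (a (p.2 + p.1) - a p.2) ^ 2 + (b (p.2 + p.1) - b p.2) ^ 2) (ν.prod volume) := ia.add ib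
    rw [← integral_const_mul, ← integral_add iM im, ← integral_add ia ib,
      ← integral_sub iab (hI.const_mul 2)]
    refine integral_mono (iM.add im) (iab.sub (hI.const_mul 2)) fun p => ?_
    have := max_min_increment (a p.2) (a (p.2 + p.1)) (b p.2) (b (p.2 + p.1))
    have h2 : 0 ≤ max (a p.2 - b p.2) 0 * max (b (p.2 + p.1) - a (p.2 + p.1)) 0 := by positivity
    dsimp only
    linarith
  linarith

/-! ### Logarithmic cutoffs and their vanishing energy in the plane. -/

theorem Real.abs_log_sub_log_le {a b d : ℝ} (ha : 1 ≤ a) (hb : 1 ≤ b) (hd : |a - b| ≤ d) :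
    |Real.log a - Real.log b| ≤ (1 + d) * |a - b| / b := by
  have hd0 := (abs_nonneg _).trans hd
  have h1 : Real.log a - Real.log b ≤ (a - b) / b := by
    rw [← Real.log_div (by positivity) (by positivity)]
    refine (Real.log_le_sub_one_of_pos (by positivity)).trans (le_of_eq ?_)
    field_simp
  have h2 : Real.log b - Real.log a ≤ (b - a) / a := by
    rw [← Real.log_div (by positivity) (by positivity)]
    refine (Real.log_le_sub_one_of_pos (by positivity)).trans (le_of_eq ?_)
    field_simp
  have hab := abs_le.1 hd
  have h3 : |a - b| / b ≤ (1 + d) * |a - b| / b := by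
    gcongr
    nlinarith [abs_nonneg (a - b)]
  have h4 : |a - b| / a ≤ (1 + d) * |a - b| / b := by
    rw [div_le_div_iff₀ (by positivity) (by positivity)]
    have : b ≤ (1 + d) * a := by nlinarith
    calc |a - b| * b ≤ |a - b| * ((1 + d) * a) := by gcongr
      _ = _ := by ring
  rw [abs_le]
  constructor
  · have : (b - a) / a ≤ |a - b| / a := by
      gcongr; rw [abs_sub_comm]; exact le_abs_self _
    linarith
  · have : (a - b) / b ≤ |a - b| / b := by
      gcongr; exact le_abs_self _
    linarith

/-- The logarithmic cutoff at scale `exp T`. -/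
noncomputable def logCutoff (T : ℝ) (x : Plane) : ℝ := max (1 - Real.log (1 + ‖x‖) / T) 0

namespace logCutoff

variable {T : ℝ}

theorem nonneg (x : Plane) : 0 ≤ logCutoff T x := le_max_right _ _

theorem le_one (hT : 0 < T) (x : Plane) : logCutoff T x ≤ 1 := by
  refine max_le ?_ zero_le_one
  have : 0 ≤ Real.log (1 + ‖x‖) := Real.log_nonneg (by linarith [norm_nonneg x])
  have : 0 ≤ Real.log (1 + ‖x‖) / T := by positivity
  linarith

theorem abs_le_one (hT : 0 < T) (x : Plane) : |logCutoff T x| ≤ 1 := by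
  rw [abs_of_nonneg (nonneg x)]; exact le_one hT x

theorem eq_zero (hT : 0 < T) {x : Plane} (hx : Real.exp T ≤ ‖x‖) : logCutoff T x = 0 := by
  refine max_eq_right ?_
  have : T ≤ Real.log (1 + ‖x‖) := by
    rw [Real.le_log_iff_exp_le (by positivity)]; linarith
  have : 1 ≤ Real.log (1 + ‖x‖) / T := by rwa [le_div_iff₀ hT, one_mul]
  linarith

theorem abs_sub_le (hT : 0 < T) (x z : Plane) :
    |logCutoff T (x + z) - logCutoff T x| ≤
      |Real.log (1 + ‖x + z‖) - Real.log (1 + ‖x‖)| / T := by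
  refine (abs_max_sub_max_le_abs _ _ _).trans (le_of_eq ?_)
  rw [← abs_of_pos hT, ← abs_div, abs_of_pos hT, ← abs_neg]
  congr 1; ring

/-- The gradient decay 1/((1+|x|)T) of the logarithm survives at finite jump length, with a constant
depending on `δ₀`. -/
theorem abs_sub_le_div (hT : 0 < T) {δ₀ : ℝ} (x z : Plane) (hz : ‖z‖ ≤ δ₀) :
    |logCutoff T (x + z) - logCutoff T x| ≤ (1 + δ₀) * ‖z‖ / (1 + ‖x‖) / T := by
  refine (abs_sub_le hT x z).trans ?_
  have h1 : |1 + ‖x + z‖ - (1 + ‖x‖)| ≤ ‖z‖ := by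
    have := abs_norm_sub_norm_le (x + z) x
    simpa using this
  have h2 := Real.abs_log_sub_log_le (a := 1 + ‖x + z‖) (b := 1 + ‖x‖) (d := δ₀)
    (by linarith [norm_nonneg (x + z)]) (by linarith [norm_nonneg x]) (h1.trans hz)
  have := (norm_nonneg z).trans hz
  gcongr
  refine h2.trans ?_
  gcongr

theorem lipschitz (hT : 0 < T) : ∃ L : NNReal, LipschitzWith L (logCutoff T) := by
  have hlog : ∀ a b : ℝ, 0 ≤ a → 0 ≤ b → Real.log (1 + a) - Real.log (1 + b) ≤ |a - b| := by
    intro a b ha hb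
    rw [← Real.log_div (by positivity) (by positivity)]
    refine (Real.log_le_sub_one_of_pos (by positivity)).trans ?_
    rw [show (1 + a) / (1 + b) - 1 = (a - b) / (1 + b) by field_simp; ring]
    calc _ ≤ |a - b| / (1 + b) := by gcongr; exact le_abs_self _
      _ ≤ _ := div_le_self (abs_nonneg _) (by linarith)
  refine ⟨⟨1 / T, by positivity⟩, LipschitzWith.of_dist_le_mul fun x y => ?_⟩
  have h1 := abs_sub_le hT y (x - y)
  rw [add_sub_cancel] at h1
  rw [Real.dist_eq, dist_eq_norm]
  refine h1.trans ?_
  change _ ≤ 1 / T * ‖x - y‖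
  rw [one_div, inv_mul_eq_div]
  gcongr
  refine le_trans ?_ (abs_norm_sub_norm_le x y)
  rw [abs_le]
  have a1 := hlog ‖x‖ ‖y‖ (norm_nonneg _) (norm_nonneg _)
  have a2 := hlog ‖y‖ ‖x‖ (norm_nonneg _) (norm_nonneg _)
  rw [abs_sub_comm] at a2
  constructor <;> linarith

theorem hasCompactSupport (hT : 0 < T) : HasCompactSupport (logCutoff T) := by
  refine HasCompactSupport.intro (isCompact_closedBall (0 : Plane) (Real.exp T)) fun x hx => ?_
  rw [mem_closedBall_zero_iff, not_le] at hx
  exact eq_zero hT hx.le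

theorem tendsto_one (x : Plane) :
    Tendsto (fun n : ℕ => logCutoff ((n : ℝ) + 1) x) atTop (𝓝 1) := by
  have h1 : Tendsto (fun n : ℕ => Real.log (1 + ‖x‖) / ((n : ℝ) + 1)) atTop (𝓝 0) :=
    tendsto_const_nhds.div_atTop (tendsto_atTop_add_const_right _ _ tendsto_natCast_atTop_atTop)
  have h2 := ((tendsto_const_nhds (x := (1 : ℝ))).sub h1).max (tendsto_const_nhds (x := (0 : ℝ)))
  simpa [logCutoff] using h2

end logCutoff

/-- Polar coordinates: the radial factor y turns (1+y)⁻² into at most (1+y)⁻¹. This merely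
logarithmic growth is specific to dimension two. -/
theorem integral_ball_inv_sq_le {R : ℝ} (hR : 0 ≤ R) :
    ∫ x in Metric.ball (0 : Plane) R, ((1 + ‖x‖) ^ 2)⁻¹ ≤
      2 * Real.pi * Real.log (1 + R) := by
  have h := integral_fun_norm_addHaar (volume : Measure Plane)
    ((Set.Iio R).indicator fun y : ℝ => ((1 + y) ^ 2)⁻¹)
  have e : ∀ x : Plane, (Set.Iio R).indicator (fun y : ℝ => ((1 + y) ^ 2)⁻¹) ‖x‖ =
      (Metric.ball (0 : Plane) R).indicator (fun x => ((1 + ‖x‖) ^ 2)⁻¹) x := fun x => by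
    by_cases hx : ‖x‖ < R
    · rw [Set.indicator_of_mem (by exact hx), Set.indicator_of_mem (by simpa using hx)]
    · rw [Set.indicator_of_notMem (by exact hx), Set.indicator_of_notMem (by simpa using hx)]
  simp only [e] at h
  rw [integral_indicator measurableSet_ball] at h
  rw [h, measureReal_def, EuclideanSpace.volume_ball_fin_two]
  have h2 : ∫ y in Set.Ioi (0 : ℝ), y ^ (Module.finrank ℝ Plane - 1) •
      (Set.Iio R).indicator (fun y : ℝ => ((1 + y) ^ 2)⁻¹) y ≤ Real.log (1 + R) := by
    have e1 : ∫ y in (0 : ℝ)..R, (1 + y)⁻¹ = Real.log (1 + R) := by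
      rw [intervalIntegral.integral_comp_add_left (fun y : ℝ => y⁻¹) 1, add_zero,
        integral_inv_of_pos one_pos (by linarith), div_one]
    rw [← e1, intervalIntegral.integral_of_le hR, ← integral_indicator measurableSet_Ioi,
      ← integral_indicator measurableSet_Ioc]
    have hi : IntegrableOn (fun y : ℝ => (1 + y)⁻¹) (Set.Ioc 0 R) := by
      refine (ContinuousOn.integrableOn_Icc ?_).mono_set Set.Ioc_subset_Icc_self
      refine ContinuousOn.inv₀ (by fun_prop) fun y hy => ?_
      linarith [hy.1]
    refine integral_mono_of_nonneg (Eventually.of_forall fun y => ?_)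
      ((integrable_indicator_iff measurableSet_Ioc).2 hi) (Eventually.of_forall fun y => ?_)
    · refine Set.indicator_nonneg (fun y hy => ?_) y
      have hy0 : (0 : ℝ) < y := hy
      exact smul_nonneg (by positivity) (Set.indicator_nonneg (fun y _ => by positivity) _)
    · by_cases h0 : 0 < y
      · by_cases h1 : y < R
        · rw [Set.indicator_of_mem (by exact h0), Set.indicator_of_mem (by exact h1),
            Set.indicator_of_mem (by exact ⟨h0, h1.le⟩)]
          simp only [finrank_euclideanSpace, Fintype.card_fin, Nat.add_one_sub_one, pow_one,
            smul_eq_mul]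
          rw [← div_eq_mul_inv, ← one_div, div_le_div_iff₀ (by positivity) (by positivity)]
          nlinarith
        · rw [Set.indicator_of_mem (by exact h0), Set.indicator_of_notMem (by exact h1), smul_zero]
          refine Set.indicator_nonneg (fun y hy => ?_) y
          have := hy.1
          positivity
      · rw [Set.indicator_of_notMem (by exact h0)]
        refine Set.indicator_nonneg (fun y hy => ?_) y
        have := hy.1
        positivity
  have hp := Real.pi_pos
  simp only [finrank_euclideanSpace, Fintype.card_fin, nsmul_eq_mul, Nat.cast_ofNat,
    ENNReal.ofReal_one, one_pow, one_mul, ENNReal.toReal_ofReal hp.le, smul_eq_mul] at h2 ⊢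
  calc _ ≤ 2 * (Real.pi * Real.log (1 + R)) := by gcongr
    _ = _ := by ring

theorem integrableOn_ball_inv_sq {v : Plane → ℝ} (hv : Measurable v) {B : ℝ}
    (hB : ∀ x, |v x| ≤ B) (R : ℝ) :
    IntegrableOn (fun x => v x ^ 2 * ((1 + ‖x‖) ^ 2)⁻¹) (Metric.ball (0 : Plane) R) := by
  refine Measure.integrableOn_of_bounded (M := B ^ 2) measure_ball_lt_top.ne
    (by fun_prop) (Eventually.of_forall fun x => ?_)
  rw [Real.norm_eq_abs, abs_of_nonneg (by positivity)]
  have hH1 : ((1 + ‖x‖) ^ 2)⁻¹ ≤ 1 := inv_le_one_of_one_le₀ (by nlinarith [norm_nonneg x])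
  have hvB : v x ^ 2 ≤ B ^ 2 := by
    rw [← sq_abs]; gcongr; exact hB x
  calc _ ≤ B ^ 2 * 1 := by gcongr
    _ = _ := mul_one _

theorem inv_sq_div_le {x y : Plane} (h : ‖x - y‖ ≤ 1) :
    ((1 + ‖x‖) ^ 2)⁻¹ / 4 ≤ ((1 + ‖y‖) ^ 2)⁻¹ := by
  have h1 : ‖y‖ ≤ ‖x‖ + 1 := by
    rw [norm_sub_rev] at h
    have := norm_le_norm_add_norm_sub' y x
    linarith
  have h6 : (1 + ‖y‖) ^ 2 ≤ (2 * (1 + ‖x‖)) ^ 2 := by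
    have := norm_nonneg x
    gcongr; linarith
  have h7 : ((2 * (1 + ‖x‖)) ^ 2)⁻¹ ≤ ((1 + ‖y‖) ^ 2)⁻¹ := by gcongr
  refine le_trans (le_of_eq ?_) h7
  rw [mul_pow, mul_inv]; ring

/-- Only centres within distance 1 of x are kept: area π, squared weight at least e⁻², and
(1+|x₀|)⁻² at least a quarter of (1+|x|)⁻². -/
theorem ofReal_le_lintegral_expWeight (a : ℝ) {x : Plane} {R : ℝ} (hx : ‖x‖ < R) :
    ENNReal.ofReal (Real.pi / (4 * Real.exp 1 ^ 2) * (a ^ 2 * ((1 + ‖x‖) ^ 2)⁻¹)) ≤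
      ∫⁻ x₀ in Metric.ball (0 : Plane) (R + 1),
        ENNReal.ofReal (((1 + ‖x₀‖) ^ 2)⁻¹ * (expWeight x₀ x ^ 2 * a ^ 2)) := by
  have hsub : Metric.ball x 1 ⊆ Metric.ball (0 : Plane) (R + 1) := fun y hy => by
    rw [mem_ball_zero_iff]
    have h2 : ‖y - x‖ < 1 := by simpa [dist_eq_norm] using hy
    have := norm_le_norm_add_norm_sub' y x
    linarith
  refine le_trans ?_ (lintegral_mono_set hsub)
  have h3 : ∀ y ∈ Metric.ball x 1,
      ENNReal.ofReal (a ^ 2 * ((1 + ‖x‖) ^ 2)⁻¹ / (4 * Real.exp 1 ^ 2)) ≤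
      ENNReal.ofReal (((1 + ‖y‖) ^ 2)⁻¹ * (expWeight y x ^ 2 * a ^ 2)) := fun y hy => by
    have h2 : ‖x - y‖ ≤ 1 := by
      have : dist y x < 1 := hy
      rw [dist_comm, dist_eq_norm] at this
      exact this.le
    refine ENNReal.ofReal_le_ofReal ?_
    have h4 : (Real.exp 1)⁻¹ ≤ expWeight y x := by
      rw [expWeight, ← Real.exp_neg]; gcongr
    have h5 := inv_sq_div_le h2
    calc a ^ 2 * ((1 + ‖x‖) ^ 2)⁻¹ / (4 * Real.exp 1 ^ 2) =
          ((1 + ‖x‖) ^ 2)⁻¹ / 4 * ((Real.exp 1)⁻¹ ^ 2 * a ^ 2) := by field_simp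
      _ ≤ _ := by gcongr
  refine le_trans (le_of_eq ?_) (setLIntegral_mono' measurableSet_ball h3)
  rw [setLIntegral_const, EuclideanSpace.volume_ball_fin_two, ENNReal.ofReal_one, one_pow,
    one_mul, show Real.pi / (4 * Real.exp 1 ^ 2) * (a ^ 2 * ((1 + ‖x‖) ^ 2)⁻¹) =
      a ^ 2 * ((1 + ‖x‖) ^ 2)⁻¹ / (4 * Real.exp 1 ^ 2) * Real.pi by ring,
    ENNReal.ofReal_mul (by positivity)]

/-- Tonelli: for each centre the inner integral over x is a local mean square, bounded by `C`, and
the integral over centres is logarithmic. -/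
theorem lintegral_ball_expWeight_le {v : Plane → ℝ} (hv : Measurable v) {B : ℝ}
    (hB : ∀ x, |v x| ≤ B) {C : ℝ}
    (hC : ∀ x₀, ∫ x, expWeight x₀ x ^ 2 * v x ^ 2 ≤ C) {R : ℝ} (hR : 0 ≤ R) :
    ∫⁻ x, ∫⁻ x₀ in Metric.ball (0 : Plane) R,
        ENNReal.ofReal (((1 + ‖x₀‖) ^ 2)⁻¹ * (expWeight x₀ x ^ 2 * v x ^ 2)) ≤
      ENNReal.ofReal (C * (2 * Real.pi * Real.log (1 + R))) := by
  have hC0 : 0 ≤ C := le_trans (integral_nonneg fun x => by positivity) (hC 0)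
  have hwm : Measurable fun p : Plane × Plane => expWeight p.2 p.1 := by
    unfold expWeight; fun_prop
  have hi := integrableOn_ball_inv_sq (v := fun _ => 1) measurable_const (B := 1) (by simp) R
  simp only [one_pow, one_mul] at hi
  calc _ = ∫⁻ x₀ in Metric.ball (0 : Plane) R, ∫⁻ x,
        ENNReal.ofReal (((1 + ‖x₀‖) ^ 2)⁻¹ * (expWeight x₀ x ^ 2 * v x ^ 2)) := by
        refine lintegral_lintegral_swap (Measurable.aemeasurable ?_)
        refine ENNReal.measurable_ofReal.comp ?_
        exact Measurable.mul (by fun_prop) ((hwm.pow_const 2).mul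
          ((hv.comp measurable_fst).pow_const 2))
    _ ≤ ∫⁻ x₀ in Metric.ball (0 : Plane) R, ENNReal.ofReal (C * ((1 + ‖x₀‖) ^ 2)⁻¹) := by
        refine lintegral_mono fun x₀ => ?_
        rw [← ofReal_integral_eq_lintegral_ofReal
          ((expWeight.integrable_mul x₀ hv hB).const_mul _)
          (Eventually.of_forall fun x => by positivity), integral_const_mul, mul_comm C]
        exact ENNReal.ofReal_le_ofReal (mul_le_mul_of_nonneg_left (hC x₀) (by positivity))
    _ = ENNReal.ofReal (∫ x₀ in Metric.ball (0 : Plane) R, C * ((1 + ‖x₀‖) ^ 2)⁻¹) := by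
        rw [ofReal_integral_eq_lintegral_ofReal (hi.const_mul C)
          (Eventually.of_forall fun x => by positivity)]
    _ ≤ _ := by
        refine ENNReal.ofReal_le_ofReal ?_
        rw [integral_const_mul]
        have := integral_ball_inv_sq_le hR
        gcongr

/-- A function with uniformly bounded local mean squares has logarithmic growth against
`(1 + |x|)⁻²`. -/
theorem integral_ball_mul_inv_sq_le {v : Plane → ℝ} (hv : Measurable v) {B : ℝ}
    (hB : ∀ x, |v x| ≤ B) {C : ℝ}
    (hC : ∀ x₀, ∫ x, expWeight x₀ x ^ 2 * v x ^ 2 ≤ C) {R : ℝ} (hR : 0 ≤ R) :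
    ∫ x in Metric.ball (0 : Plane) R, v x ^ 2 * ((1 + ‖x‖) ^ 2)⁻¹ ≤
      8 * Real.exp 1 ^ 2 * C * Real.log (2 + R) := by
  have hpi := Real.pi_pos
  have hC0 : 0 ≤ C := le_trans (integral_nonneg fun x => by positivity) (hC 0)
  have hlog : 0 ≤ Real.log (1 + (R + 1)) := Real.log_nonneg (by linarith)
  have h1 : ∫⁻ x in Metric.ball (0 : Plane) R, ENNReal.ofReal
      (Real.pi / (4 * Real.exp 1 ^ 2) * (v x ^ 2 * ((1 + ‖x‖) ^ 2)⁻¹)) ≤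
      ENNReal.ofReal (C * (2 * Real.pi * Real.log (1 + (R + 1)))) :=
    (setLIntegral_mono' measurableSet_ball fun x hx =>
      ofReal_le_lintegral_expWeight (v x) (mem_ball_zero_iff.1 hx)).trans
      ((setLIntegral_le_lintegral _ _).trans
        (lintegral_ball_expWeight_le hv hB hC (by linarith)))
  have hi := (integrableOn_ball_inv_sq hv hB R).const_mul (Real.pi / (4 * Real.exp 1 ^ 2))
  rw [← ofReal_integral_eq_lintegral_ofReal hi (Eventually.of_forall fun x => by positivity),
    ENNReal.ofReal_le_ofReal_iff (by positivity), integral_const_mul] at h1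
  have hκ0 : 0 < Real.pi / (4 * Real.exp 1 ^ 2) := by positivity
  refine le_of_mul_le_mul_left (h1.trans (le_of_eq ?_)) hκ0
  rw [show 1 + (R + 1) = 2 + R by ring]
  field_simp; ring

/-- Energy of the logarithmic cutoffs against functions with bounded local mean squares. -/
theorem FiniteRange.exists_logCutoff_le {ν : Measure Plane} [SFinite ν] {δ₀ : ℝ}
    (hν : FiniteRange ν δ₀) (hδ : 0 ≤ δ₀) :
    ∃ A, 0 ≤ A ∧ ∀ (v : Plane → ℝ) (B C : ℝ), Measurable v → (∀ x, |v x| ≤ B) →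
      (∀ x₀, ∫ x, expWeight x₀ x ^ 2 * v x ^ 2 ≤ C) → ∀ T : ℝ, 1 ≤ T →
      ∫ p : Plane × Plane, v p.2 ^ 2 * (logCutoff T (p.2 + p.1) - logCutoff T p.2) ^ 2
        ∂(ν.prod volume) ≤ A * C / T := by
  refine ⟨(∫ z, ‖z‖ ^ 2 ∂ν) * (1 + δ₀) ^ 2 * (8 * Real.exp 1 ^ 2) * (3 + δ₀),
    by have := hν.nonneg_sq; positivity, fun v B C hv hB hC T hT => ?_⟩
  have hT0 : 0 < T := by linarith
  have hC0 : 0 ≤ C := le_trans (integral_nonneg fun x => by positivity) (hC 0)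
  -- Beyond this radius both endpoints of a jump lie where the cutoff vanishes.
  set R := Real.exp T + δ₀ with hR
  have hR0 : 0 ≤ R := by positivity
  have h1 := integral_ball_mul_inv_sq_le hv hB hC hR0
  -- The logarithmic growth costs one factor T against the T⁻² of the squared gradient, leaving 1/T.
  have hlog : Real.log (2 + R) ≤ (3 + δ₀) * T := by
    have e1 : 2 + R ≤ Real.exp T * (3 + δ₀) := by
      have := Real.one_le_exp hT0.le
      rw [hR]; nlinarith
    have e2 := Real.log_le_log (by positivity) e1
    rw [Real.log_mul (by positivity) (by positivity), Real.log_exp] at e2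
    have e3 := Real.log_le_sub_one_of_pos (show 0 < 3 + δ₀ by positivity)
    nlinarith
  have hi : Integrable ((Metric.ball (0 : Plane) R).indicator
      fun x => v x ^ 2 * ((1 + ‖x‖) ^ 2)⁻¹) :=
    (integrable_indicator_iff measurableSet_ball).2 (integrableOn_ball_inv_sq hv hB R)
  have h2 : ∫ p : Plane × Plane, v p.2 ^ 2 * (logCutoff T (p.2 + p.1) - logCutoff T p.2) ^ 2
      ∂(ν.prod volume) ≤ ((1 + δ₀) ^ 2 / T ^ 2) * ((∫ z, ‖z‖ ^ 2 ∂ν) *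
        ∫ x in Metric.ball (0 : Plane) R, v x ^ 2 * ((1 + ‖x‖) ^ 2)⁻¹) := by
    rw [← integral_indicator measurableSet_ball, ← integral_prod_mul, ← integral_const_mul]
    refine integral_mono_of_nonneg (Eventually.of_forall fun p => by positivity)
      ((hν.sq.mul_prod hi).const_mul _) ?_
    filter_upwards [hν.ae_prod] with p hp
    by_cases hx : p.2 ∈ Metric.ball (0 : Plane) R
    · rw [Set.indicator_of_mem hx]
      have h3 := logCutoff.abs_sub_le_div hT0 p.2 p.1 hp
      have h4 : (logCutoff T (p.2 + p.1) - logCutoff T p.2) ^ 2 ≤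
          ((1 + δ₀) * ‖p.1‖ / (1 + ‖p.2‖) / T) ^ 2 := by rw [← sq_abs]; gcongr
      calc _ ≤ v p.2 ^ 2 * ((1 + δ₀) * ‖p.1‖ / (1 + ‖p.2‖) / T) ^ 2 := by gcongr
        _ = _ := by field_simp
    · rw [mem_ball_zero_iff, not_lt] at hx
      have h5 : Real.exp T ≤ ‖p.2 + p.1‖ := by
        have := norm_sub_le (p.2 + p.1) p.1
        rw [add_sub_cancel_right] at this
        linarith
      rw [logCutoff.eq_zero hT0 h5, logCutoff.eq_zero hT0 (by linarith)]
      simp only [sub_zero, ne_eq, OfNat.ofNat_ne_zero, not_false_eq_true, zero_pow, mul_zero]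
      have : 0 ≤ (Metric.ball (0 : Plane) R).indicator
          (fun x => v x ^ 2 * ((1 + ‖x‖) ^ 2)⁻¹) p.2 :=
        Set.indicator_nonneg (fun x _ => by positivity) _
      positivity
  have hM := hν.nonneg_sq
  calc _ ≤ _ := h2
    _ ≤ ((1 + δ₀) ^ 2 / T ^ 2) * ((∫ z, ‖z‖ ^ 2 ∂ν) *
        (8 * Real.exp 1 ^ 2 * C * ((3 + δ₀) * T))) := by gcongr; exact h1.trans (by gcongr)
    _ = _ := by field_simp

/-! ### Interaction of the derivative with competitors. -/

/-- The interaction of the negative and positive parts of `a - b`. -/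
noncomputable def interaction (ν : Measure Plane) (a b : Plane → ℝ) : ENNReal :=
  ∫⁻ p : Plane × Plane, ENNReal.ofReal (max (b p.2 - a p.2) 0 *
    max (a (p.2 + p.1) - b (p.2 + p.1)) 0) ∂(ν.prod volume)

/-- The second variation at `ψ`. -/
noncomputable def secondVariation (ν : Measure Plane) (c ψ : Plane → ℝ) : ℝ :=
  (1 / 2) * (∫ p : Plane × Plane, (ψ (p.2 + p.1) - ψ p.2) ^ 2 ∂(ν.prod volume)) -
    ∫ x, c x * ψ x ^ 2

theorem FiniteRange.ae_shift {ν : Measure Plane} [SFinite ν] {δ₀ : ℝ} (hν : FiniteRange ν δ₀)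
    {P : Plane → Prop} (h : ∀ᵐ x : Plane, P x) :
    ∀ᵐ p : Plane × Plane ∂(ν.prod volume), P p.2 ∧ P (p.2 + p.1) := by
  have h1 := (Measure.quasiMeasurePreserving_snd (μ := ν) (ν := (volume : Measure Plane))).ae h
  have h2 := hν.measurePreserving_flip.quasiMeasurePreserving.ae h1
  exact h1.and h2

/-- Fatou's lemma; the interaction takes values in `ENNReal` so that no integrability of the limit
is required. -/
theorem interaction_le_of_tendsto {ν : Measure Plane} [SFinite ν] {δ₀ : ℝ} (hν : FiniteRange ν δ₀)
    {a : ℕ → Plane → ℝ} {a' b : Plane → ℝ} (ha : ∀ n, Measurable (a n)) (hb : Measurable b)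
    (hlim : ∀ᵐ x, Tendsto (fun n => a n x) atTop (𝓝 (a' x))) {B : ℕ → ℝ} {B' : ℝ}
    (hB : ∀ᶠ n in atTop, interaction ν (a n) b ≤ ENNReal.ofReal (B n))
    (hBlim : Tendsto B atTop (𝓝 B')) : interaction ν a' b ≤ ENNReal.ofReal B' := by
  rw [interaction]
  calc _ = ∫⁻ p : Plane × Plane, liminf (fun n => ENNReal.ofReal (max (b p.2 - a n p.2) 0 *
            max (a n (p.2 + p.1) - b (p.2 + p.1)) 0)) atTop ∂(ν.prod volume) := by
        refine lintegral_congr_ae ?_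
        filter_upwards [hν.ae_shift hlim] with p hp
        refine (Tendsto.liminf_eq ?_).symm
        refine (ENNReal.continuous_ofReal.tendsto _).comp ?_
        exact ((tendsto_const_nhds.sub hp.1).max tendsto_const_nhds).mul
          ((hp.2.sub tendsto_const_nhds).max tendsto_const_nhds)
    _ ≤ liminf (fun n => interaction ν (a n) b) atTop := by
        refine lintegral_liminf_le fun n => ?_
        have := ha n
        fun_prop
    _ ≤ liminf (fun n => ENNReal.ofReal (B n)) atTop := liminf_le_liminf hB
    _ = _ := ((ENNReal.continuous_ofReal.tendsto _).comp hBlim).liminf_eq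

theorem LipschitzWith.mul_bounded {a v : Plane → ℝ} {L : NNReal} (ha : LipschitzWith L a)
    {A B C : ℝ} (hA : ∀ x, |a x| ≤ A) (hB : ∀ x, |v x| ≤ B)
    (hC : ∀ x z, |v (x + z) - v x| ≤ C * ‖z‖) :
    ∃ L' : NNReal, LipschitzWith L' (fun x => a x * v x) := by
  refine ⟨Real.toNNReal (A * C + L * B), LipschitzWith.of_dist_le_mul fun x y => ?_⟩
  have h1 := hC y (x - y)
  rw [add_sub_cancel] at h1
  have h2 := ha.dist_le_mul x y
  rw [Real.dist_eq] at h2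
  rw [Real.dist_eq, show a x * v x - a y * v y = a x * (v x - v y) + (a x - a y) * v y by ring]
  refine (abs_add_le _ _).trans ?_
  rw [abs_mul, abs_mul]
  have hA0 := (abs_nonneg _).trans (hA x)
  calc _ ≤ A * (C * ‖x - y‖) + (L * dist x y) * B := by
        gcongr
        · exact hA x
        · exact hB y
    _ = (A * C + L * B) * dist x y := by rw [dist_eq_norm]; ring
    _ ≤ _ := by gcongr; exact Real.le_coe_toNNReal _

theorem RegularSolution.interaction_le {ν : Measure Plane} [SFinite ν] {δ₀ : ℝ}
    (hν : FiniteRange ν δ₀) {v g c ψ : Plane → ℝ} (hv : RegularSolution ν v g)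
    (hs : StableFor ν c) (hc : Continuous c) {T : ℝ} (hT : 0 < T) {L : NNReal}
    (hψ : LipschitzWith L ψ) (hψs : HasCompactSupport ψ) :
    interaction ν (fun x => logCutoff T x * v x) ψ ≤ ENNReal.ofReal
      ((∫ x, (g x * v x - c x * v x ^ 2) * logCutoff T x ^ 2) +
      (1 / 2) * (∫ p : Plane × Plane,
        v p.2 ^ 2 * (logCutoff T (p.2 + p.1) - logCutoff T p.2) ^ 2 ∂(ν.prod volume)) +
      secondVariation ν c ψ) := by
  obtain ⟨L₁, hL₁⟩ := logCutoff.lipschitz hT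
  obtain ⟨B, hB⟩ := hv.bdd
  obtain ⟨C, hC⟩ := hv.lip
  obtain ⟨L₂, hL₂⟩ := hL₁.mul_bounded (logCutoff.abs_le_one hT) hB hC
  have hsupp := logCutoff.hasCompactSupport hT
  have hη := hL₁.isWeight hsupp (fun x hx => image_eq_zero_of_notMem_tsupport hx)
    (logCutoff.abs_le_one hT) δ₀
  have hηc := hL₁.continuous
  have hvc := hv.cont
  have hgc := hv.contg
  -- The competitors are ηv and ψ; the energy identity then replaces the energy of ηv by the defect
  -- in the linearised equation plus the cutoff energy.
  obtain ⟨hI, hle⟩ := hs.interaction_le hν hc hL₂ hsupp.mul_right hψ hψs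
  have e1 := hv.energy_identity hν hη
  have e2 := hν.integral_weight_le hvc.measurable hB hη
  rw [interaction, ← ofReal_integral_eq_lintegral_ofReal hI
    (Eventually.of_forall fun p => by positivity)]
  refine ENNReal.ofReal_le_ofReal (hle.trans ?_)
  have hs2 : HasCompactSupport (fun x => logCutoff T x ^ 2) :=
    hsupp.comp_left (g := fun t => t ^ 2) (by simp)
  have i1 : Integrable (fun x => g x * v x * logCutoff T x ^ 2) :=
    Continuous.integrable_of_hasCompactSupport (by fun_prop) hs2.mul_left
  have i2 : Integrable (fun x => c x * v x ^ 2 * logCutoff T x ^ 2) :=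
    Continuous.integrable_of_hasCompactSupport (by fun_prop) hs2.mul_left
  have e3 : ∫ x, (g x * v x - c x * v x ^ 2) * logCutoff T x ^ 2 =
      (∫ x, g x * v x * logCutoff T x ^ 2) - ∫ x, c x * (logCutoff T x * v x) ^ 2 := by
    have : (fun x => c x * (logCutoff T x * v x) ^ 2) =
        fun x => c x * v x ^ 2 * logCutoff T x ^ 2 := by ext x; ring
    rw [this, ← integral_sub i1 i2]
    congr 1; ext x; ring
  rw [e1, e3, secondVariation]
  linarith

/-- The interaction bound for the dyadic difference quotients of a stable solution. -/
theorem PVSolution.interaction_dyadicQuotient_le {ν : Measure Plane} [SFinite ν] {δ₀ : ℝ}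
    (hν : FiniteRange ν δ₀) {u F c ψ : Plane → ℝ} {M M' : ℝ}
    (hu : Continuous u) (hM : ∀ x, |u x| ≤ M) (hF : Continuous F) (hM' : ∀ x, |F x| ≤ M')
    (h : PVSolution ν u F) (hs : StableFor ν c) (hc : Continuous c) {T : ℝ} (hT : 0 < T)
    {L : NNReal} (hψ : LipschitzWith L ψ) (hψs : HasCompactSupport ψ) (e : Plane) (k : ℕ) :
    interaction ν (fun x => logCutoff T x * dyadicQuotient u e k x) ψ ≤ ENNReal.ofReal
      ((∫ x, (dyadicQuotient F e k x * dyadicQuotient u e k x -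
        c x * dyadicQuotient u e k x ^ 2) * logCutoff T x ^ 2) +
      (1 / 2) * (∫ p : Plane × Plane, dyadicQuotient u e k p.2 ^ 2 *
        (logCutoff T (p.2 + p.1) - logCutoff T p.2) ^ 2 ∂(ν.prod volume)) +
      secondVariation ν c ψ) := by
  obtain ⟨v, g, hreg, hvM, hgM, hv, hg⟩ := h.exists_approx hν hu hM hF hM'
  have hreg' : ∀ n, RegularSolution ν (dyadicQuotient (v n) e k) (dyadicQuotient (g n) e k) :=
    fun n => (hreg n).increment hν _ _
  obtain ⟨L₁, hL₁⟩ := logCutoff.lipschitz hT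
  have hsupp := logCutoff.hasCompactSupport hT
  have hη := hL₁.isWeight hsupp (fun x hx => image_eq_zero_of_notMem_tsupport hx)
    (logCutoff.abs_le_one hT) δ₀
  have hηc := hL₁.continuous
  have hvb : ∀ n x, |dyadicQuotient (v n) e k x| ≤ 2 ^ k * (M + M) := fun n =>
    abs_dyadicQuotient_le (hvM n) e k
  have hgb : ∀ n x, |dyadicQuotient (g n) e k x| ≤ 2 ^ k * (M' + M') := fun n =>
    abs_dyadicQuotient_le (hgM n) e k
  have hvl : ∀ x, Tendsto (fun n => dyadicQuotient (v n) e k x) atTop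
      (𝓝 (dyadicQuotient u e k x)) := fun x => ((hv _).sub (hv x)).const_mul _
  have hgl : ∀ x, Tendsto (fun n => dyadicQuotient (g n) e k x) atTop
      (𝓝 (dyadicQuotient F e k x)) := fun x => ((hg _).sub (hg x)).const_mul _
  have hs2 : HasCompactSupport (fun x => logCutoff T x ^ 2) :=
    hsupp.comp_left (g := fun t => t ^ 2) (by simp)
  have l1 : Tendsto (fun n => ∫ x, (dyadicQuotient (g n) e k x * dyadicQuotient (v n) e k x -
        c x * dyadicQuotient (v n) e k x ^ 2) * logCutoff T x ^ 2) atTop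
      (𝓝 (∫ x, (dyadicQuotient F e k x * dyadicQuotient u e k x -
        c x * dyadicQuotient u e k x ^ 2) * logCutoff T x ^ 2)) := by
    refine tendsto_integral_of_dominated_convergence
      (fun x => (2 ^ k * (M' + M') * (2 ^ k * (M + M)) + |c x| * (2 ^ k * (M + M)) ^ 2) *
        logCutoff T x ^ 2) (fun n => ?_) ?_ (fun n => Eventually.of_forall fun x => ?_)
      (Eventually.of_forall fun x =>
        (((hgl x).mul (hvl x)).sub (((hvl x).pow 2).const_mul _)).mul_const _)
    · have h1 := (hreg' n).cont
      have h2 := (hreg' n).contg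
      fun_prop
    · exact Continuous.integrable_of_hasCompactSupport (by fun_prop) hs2.mul_left
    · rw [Real.norm_eq_abs, abs_mul, abs_of_nonneg (sq_nonneg (logCutoff T x))]
      refine mul_le_mul_of_nonneg_right ((abs_sub _ _).trans ?_) (sq_nonneg _)
      rw [abs_mul, abs_mul, abs_pow]
      have a1 := hgb n x
      have a2 := hvb n x
      have a3 := (abs_nonneg _).trans a1
      gcongr
  have l2 : Tendsto (fun n => ∫ p : Plane × Plane, dyadicQuotient (v n) e k p.2 ^ 2 *
        (logCutoff T (p.2 + p.1) - logCutoff T p.2) ^ 2 ∂(ν.prod volume)) atTop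
      (𝓝 (∫ p : Plane × Plane, dyadicQuotient u e k p.2 ^ 2 *
        (logCutoff T (p.2 + p.1) - logCutoff T p.2) ^ 2 ∂(ν.prod volume))) := by
    have hi := hν.integrable_weight_sq (v := fun _ => 2 ^ k * (M + M)) measurable_const
      (C := |2 ^ k * (M + M)|) (fun _ => le_rfl) hη
    refine tendsto_integral_of_dominated_convergence _ (fun n => ?_) hi
      (fun n => Eventually.of_forall fun p => ?_)
      (Eventually.of_forall fun p => ((hvl p.2).pow 2).mul_const _)
    · have h1 := (hreg' n).cont
      fun_prop
    · rw [norm_mul, norm_pow, norm_pow, Real.norm_eq_abs, Real.norm_eq_abs, sq_abs (_ - _)]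
      have a2 := hvb n p.2
      gcongr
  have hum := (continuous_dyadicQuotient hu e k).measurable
  refine interaction_le_of_tendsto hν (a := fun n x => logCutoff T x * dyadicQuotient (v n) e k x)
    (fun n => ?_) hψ.continuous.measurable
    (Eventually.of_forall fun x => (hvl x).const_mul _)
    (Eventually.of_forall fun n => (hreg' n).interaction_le hν hs hc hT hψ hψs)
    ((l1.add (l2.const_mul _)).add_const _)
  have h1 := (hreg' n).cont
  fun_prop

/-- In the limit of the dyadic difference quotients the interaction is controlled by the second
variation of the competitor alone. -/
theorem PVSolution.interaction_limit_le {ν : Measure Plane} [SFinite ν] {δ₀ : ℝ}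
    (hν : FiniteRange ν δ₀) (hδ : 0 ≤ δ₀) {u F c : Plane → ℝ} {M M' : ℝ}
    (hu : Continuous u) (hM : ∀ x, |u x| ≤ M) (hF : Continuous F) (hM' : ∀ x, |F x| ≤ M')
    (h : PVSolution ν u F) (hs : StableFor ν c) (hc : Continuous c)
    (hlin : ∀ R ω : ℝ, 0 < ω → ∃ δ > 0, ∀ x h : Plane, ‖x‖ ≤ R → ‖h‖ < δ →
      |F (x + h) - F x - c x * (u (x + h) - u x)| ≤ ω * |u (x + h) - u x|)
    {e : Plane} {C : ℝ}
    (hC : ∀ x₀ k, ∫ x, expWeight x₀ x ^ 2 * dyadicQuotient u e k x ^ 2 ≤ C)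
    {v : Plane → ℝ} {ks : ℕ → ℕ} (hks : Tendsto ks atTop atTop)
    (hv : ∀ᵐ x, Tendsto (fun n => dyadicQuotient u e (ks n) x) atTop (𝓝 (v x)))
    (hvm : Measurable v)
    {ψ : Plane → ℝ} {L : NNReal} (hψ : LipschitzWith L ψ) (hψs : HasCompactSupport ψ) :
    interaction ν v ψ ≤ ENNReal.ofReal (secondVariation ν c ψ) := by
  obtain ⟨A, hA, hcut⟩ := hν.exists_logCutoff_le hδ
  have hC0 : 0 ≤ C := le_trans (integral_nonneg fun x => by positivity) (hC 0 0)
  have hDm : ∀ k, Continuous (dyadicQuotient u e k) := fun k => continuous_dyadicQuotient hu e k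
  have hDb := abs_dyadicQuotient_le hM e
  have hψm := hψ.continuous.measurable
  -- the error made in linearising the nonlinearity
  have herr : ∀ T : ℝ, 0 < T → ∀ ε : ℝ, 0 < ε → ∀ᶠ k in atTop,
      ∫ x, (dyadicQuotient F e k x * dyadicQuotient u e k x -
        c x * dyadicQuotient u e k x ^ 2) * logCutoff T x ^ 2 ≤ ε := fun T hT ε hε => by
    set R := Real.exp T with hR
    -- On the support of the cutoff exp(R) times the exponential weight is at least 1, so the error
    -- is at most ω exp(R)² C; the 1 avoids a zero denominator.
    set ω := ε / (Real.exp R ^ 2 * C + 1) with hω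
    have hω0 : 0 < ω := by positivity
    obtain ⟨δ, hδ0, hδ⟩ := hlin R ω hω0
    have hsmall : Tendsto (fun k : ℕ => ‖(2⁻¹ : ℝ) ^ k • e‖) atTop (𝓝 0) := by
      have h1 : Tendsto (fun k : ℕ => (2⁻¹ : ℝ) ^ k) atTop (𝓝 0) :=
        tendsto_pow_atTop_nhds_zero_of_lt_one (by norm_num) (by norm_num)
      simpa using (h1.smul_const e).norm
    filter_upwards [hsmall.eventually (gt_mem_nhds hδ0)] with k hk
    have hpt : ∀ x, (dyadicQuotient F e k x * dyadicQuotient u e k x -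
        c x * dyadicQuotient u e k x ^ 2) * logCutoff T x ^ 2 ≤
        ω * Real.exp R ^ 2 * (expWeight 0 x ^ 2 * dyadicQuotient u e k x ^ 2) := fun x => by
      rcases le_or_gt R ‖x‖ with hx | hx
      · rw [logCutoff.eq_zero hT hx]
        have : 0 ≤ ω * Real.exp R ^ 2 * (expWeight 0 x ^ 2 * dyadicQuotient u e k x ^ 2) := by
          positivity
        simpa using this
      · have h1 := hδ x _ hx.le hk
        have h2 : |dyadicQuotient F e k x - c x * dyadicQuotient u e k x| ≤
            ω * |dyadicQuotient u e k x| := by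
          have h3 : (0 : ℝ) < 2 ^ k := by positivity
          rw [dyadicQuotient, dyadicQuotient, ← mul_left_comm, ← mul_sub, abs_mul, abs_mul,
            abs_of_pos h3, mul_left_comm]
          exact mul_le_mul_of_nonneg_left h1 h3.le
        have h3 : logCutoff T x ^ 2 ≤ Real.exp R ^ 2 * expWeight 0 x ^ 2 := by
          rw [← mul_pow]
          have h4 : 1 ≤ Real.exp R * expWeight 0 x := by
            rw [expWeight, ← Real.exp_add]
            refine Real.one_le_exp ?_
            rw [sub_zero]; linarith
          have h5 := logCutoff.nonneg (T := T) x
          gcongr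
          exact (logCutoff.le_one hT x).trans h4
        have h4 : dyadicQuotient F e k x * dyadicQuotient u e k x -
            c x * dyadicQuotient u e k x ^ 2 ≤ ω * dyadicQuotient u e k x ^ 2 := by
          calc _ = (dyadicQuotient F e k x - c x * dyadicQuotient u e k x) *
                dyadicQuotient u e k x := by ring
            _ ≤ |dyadicQuotient F e k x - c x * dyadicQuotient u e k x| *
                |dyadicQuotient u e k x| := by rw [← abs_mul]; exact le_abs_self _
            _ ≤ ω * |dyadicQuotient u e k x| * |dyadicQuotient u e k x| := by gcongr
            _ = _ := by rw [mul_assoc, ← sq, sq_abs]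
        calc _ ≤ ω * dyadicQuotient u e k x ^ 2 * logCutoff T x ^ 2 := by gcongr
          _ ≤ ω * dyadicQuotient u e k x ^ 2 * (Real.exp R ^ 2 * expWeight 0 x ^ 2) := by gcongr
          _ = _ := by ring
    have hi := (expWeight.integrable_mul 0 (hDm k).measurable (hDb k)).const_mul
      (ω * Real.exp R ^ 2)
    have hs2 : HasCompactSupport (fun x => logCutoff T x ^ 2) :=
      (logCutoff.hasCompactSupport hT).comp_left (g := fun t => t ^ 2) (by simp)
    have hcont : Continuous (logCutoff T) := by
      obtain ⟨L₁, hL₁⟩ := logCutoff.lipschitz hT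
      exact hL₁.continuous
    have hDF := continuous_dyadicQuotient hF e k
    have hDu := hDm k
    have hi2 : Integrable (fun x => (dyadicQuotient F e k x * dyadicQuotient u e k x -
        c x * dyadicQuotient u e k x ^ 2) * logCutoff T x ^ 2) :=
      Continuous.integrable_of_hasCompactSupport (by fun_prop) hs2.mul_left
    refine (integral_mono hi2 hi hpt).trans ?_
    rw [integral_const_mul]
    have := hC 0 k
    calc _ ≤ ω * Real.exp R ^ 2 * C := by gcongr
      _ = ε * ((Real.exp R ^ 2 * C) / (Real.exp R ^ 2 * C + 1)) := by rw [hω]; field_simp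
      _ ≤ ε * 1 := by
          gcongr
          rw [div_le_one (by positivity)]; linarith
      _ = ε := mul_one ε
  -- At fixed T the step of the quotients tends to zero first; T → ∞ comes last.
  have hcutoff : ∀ T : ℝ, 1 ≤ T → interaction ν (fun x => logCutoff T x * v x) ψ ≤
      ENNReal.ofReal (1 / T + A * C / T + secondVariation ν c ψ) := fun T hT => by
    have hT0 : 0 < T := by linarith
    have hcont : Continuous (logCutoff T) := by
      obtain ⟨L₁, hL₁⟩ := logCutoff.lipschitz hT0
      exact hL₁.continuous
    refine interaction_le_of_tendsto hν
      (a := fun n x => logCutoff T x * dyadicQuotient u e (ks n) x)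
      (fun n => by have := hDm (ks n); fun_prop) hψm
      (hv.mono fun x hx => hx.const_mul _) ?_ tendsto_const_nhds
    filter_upwards [hks.eventually (herr T hT0 (1 / T) (by positivity))] with n hn
    refine (h.interaction_dyadicQuotient_le hν hu hM hF hM' hs hc hT0 hψ hψs e (ks n)).trans ?_
    refine ENNReal.ofReal_le_ofReal ?_
    have h1 := hcut _ _ C (hDm (ks n)).measurable (hDb (ks n)) (fun x₀ => hC x₀ (ks n)) T hT
    have h2 : 0 ≤ A * C / T := by positivity
    linarith
  have hlim : Tendsto (fun n : ℕ => 1 / ((n : ℝ) + 1) + A * C / ((n : ℝ) + 1) +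
      secondVariation ν c ψ) atTop (𝓝 (0 + 0 + secondVariation ν c ψ)) := by
    refine (Tendsto.add tendsto_one_div_add_atTop_nhds_zero_nat ?_).add_const _
    exact tendsto_const_nhds.div_atTop
      (tendsto_atTop_add_const_right _ _ tendsto_natCast_atTop_atTop)
  rw [zero_add, zero_add] at hlim
  refine interaction_le_of_tendsto hν (a := fun (n : ℕ) x => logCutoff ((n : ℝ) + 1) x * v x)
    (fun n => ?_) hψm ?_ (Eventually.of_forall fun n => hcutoff _ (by
      linarith [(Nat.cast_nonneg n : (0 : ℝ) ≤ n)])) hlim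
  · obtain ⟨L₁, hL₁⟩ := logCutoff.lipschitz (show (0 : ℝ) < (n : ℝ) + 1 by positivity)
    have := hL₁.continuous
    fun_prop
  · refine Eventually.of_forall fun x => ?_
    simpa using (logCutoff.tendsto_one x).mul_const (v x)

theorem secondVariation_smul (ν : Measure Plane) (c ψ : Plane → ℝ) (s : ℝ) :
    secondVariation ν c (fun x => s * ψ x) = s ^ 2 * secondVariation ν c ψ := by
  have e1 : ∫ p : Plane × Plane, (s * ψ (p.2 + p.1) - s * ψ p.2) ^ 2 ∂(ν.prod volume) =
      s ^ 2 * ∫ p : Plane × Plane, (ψ (p.2 + p.1) - ψ p.2) ^ 2 ∂(ν.prod volume) := by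
    rw [← integral_const_mul]; congr 1; ext p; ring
  have e2 : ∫ x, c x * (s * ψ x) ^ 2 = s ^ 2 * ∫ x, c x * ψ x ^ 2 := by
    rw [← integral_const_mul]; congr 1; ext p; ring
  rw [secondVariation, e1, e2, secondVariation]; ring

/-! ### The derivative has one sign. -/

section Sign

variable {ν : Measure Plane} {v c : Plane → ℝ}

/-- Where v ≤ 0 the competitor sψ exceeds `v` by at least sψ, so the interaction is at least of
order s, whereas the second variation of sψ is of order s². Dividing by s and letting s → 0 leaves
zero. -/
theorem interaction_nonpos_eq_zero (hv : Measurable v)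
    (h : ∀ (ψ : Plane → ℝ) (L : NNReal), LipschitzWith L ψ → HasCompactSupport ψ →
      interaction ν v ψ ≤ ENNReal.ofReal (secondVariation ν c ψ))
    {ψ : Plane → ℝ} {L : NNReal} (hψ : LipschitzWith L ψ) (hψs : HasCompactSupport ψ)
    (hψ0 : ∀ x, 0 ≤ ψ x) :
    ∫⁻ p : Plane × Plane, ENNReal.ofReal ({x | v x ≤ 0}.indicator ψ p.2 *
      max (v (p.2 + p.1)) 0) ∂(ν.prod volume) = 0 := by
  set A := {x | v x ≤ 0} with hA
  have hAm : MeasurableSet A := measurableSet_le hv measurable_const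
  have hψm := hψ.continuous.measurable
  have hAψ : Measurable (A.indicator ψ) := hψm.indicator hAm
  have hAψ0 : ∀ x, 0 ≤ A.indicator ψ x := fun x => Set.indicator_nonneg (fun x _ => hψ0 x) x
  set s : ℕ → ℝ := fun n => 1 / ((n : ℝ) + 1) with hs
  have hs0 : ∀ n, 0 < s n := fun n => by positivity
  have hslim : Tendsto s atTop (𝓝 0) := tendsto_one_div_add_atTop_nhds_zero_nat
  set Q := secondVariation ν c ψ
  set I : ℕ → ENNReal := fun n => ∫⁻ p : Plane × Plane, ENNReal.ofReal (A.indicator ψ p.2 *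
      max (v (p.2 + p.1) - s n * ψ (p.2 + p.1)) 0) ∂(ν.prod volume) with hI
  have hle : ∀ n, I n ≤ ENNReal.ofReal (s n * Q) := fun n => by
    have hL : LipschitzWith (Real.toNNReal (s n) * L) (fun x => s n * ψ x) := by
      refine LipschitzWith.of_dist_le_mul fun x y => ?_
      have := hψ.dist_le_mul x y
      rw [Real.dist_eq] at this ⊢
      rw [← mul_sub, abs_mul, abs_of_pos (hs0 n), NNReal.coe_mul,
        Real.coe_toNNReal _ (hs0 n).le, mul_assoc]
      exact mul_le_mul_of_nonneg_left this (hs0 n).le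
    have h1 := h _ _ hL hψs.mul_left
    rw [secondVariation_smul] at h1
    have h2 : ENNReal.ofReal (s n) * I n ≤ interaction ν v (fun x => s n * ψ x) := by
      rw [hI]; dsimp only
      rw [← lintegral_const_mul _ (by fun_prop), interaction]
      refine lintegral_mono fun p => ?_
      rw [← ENNReal.ofReal_mul (hs0 n).le]
      refine ENNReal.ofReal_le_ofReal ?_
      rw [← mul_assoc]
      refine mul_le_mul_of_nonneg_right ?_ (le_max_right _ _)
      by_cases hp : p.2 ∈ A
      · rw [Set.indicator_of_mem hp]
        have : v p.2 ≤ 0 := hp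
        exact le_max_of_le_left (by linarith)
      · rw [Set.indicator_of_notMem hp, mul_zero]
        exact le_max_right _ _
    have h3 := h2.trans h1
    rw [show s n ^ 2 * Q = s n * (s n * Q) by ring, ENNReal.ofReal_mul (hs0 n).le] at h3
    exact (ENNReal.mul_le_mul_iff_right (by simpa using hs0 n) ENNReal.ofReal_ne_top).1 h3
  refine le_antisymm ?_ bot_le
  calc _ = ∫⁻ p : Plane × Plane, liminf (fun n => ENNReal.ofReal (A.indicator ψ p.2 *
            max (v (p.2 + p.1) - s n * ψ (p.2 + p.1)) 0)) atTop ∂(ν.prod volume) := by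
        refine lintegral_congr fun p => ?_
        refine (Tendsto.liminf_eq ?_).symm
        refine (ENNReal.continuous_ofReal.tendsto _).comp (Tendsto.const_mul _ ?_)
        have := (tendsto_const_nhds (x := v (p.2 + p.1))).sub (hslim.mul_const (ψ (p.2 + p.1)))
        rw [zero_mul, sub_zero] at this
        exact this.max tendsto_const_nhds
    _ ≤ liminf I atTop := lintegral_liminf_le fun n => by fun_prop
    _ ≤ liminf (fun n => ENNReal.ofReal (s n * Q)) atTop :=
        liminf_le_liminf (Eventually.of_forall hle)
    _ = 0 := by
        have := (ENNReal.continuous_ofReal.tendsto _).comp (hslim.mul_const Q)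
        rw [zero_mul, ENNReal.ofReal_zero] at this
        exact this.liminf_eq

/-- The test functions are logarithmic cutoffs, each point lying in the positivity set of one of
them. -/
theorem ae_nonpos_shift [SFinite ν] (hv : Measurable v)
    (h : ∀ (ψ : Plane → ℝ) (L : NNReal), LipschitzWith L ψ → HasCompactSupport ψ →
      interaction ν v ψ ≤ ENNReal.ofReal (secondVariation ν c ψ)) :
    ∀ᵐ x : Plane, ∀ᵐ z ∂ν, v x ≤ 0 → v (x + z) ≤ 0 := by
  have h1 : ∀ n : ℕ, ∀ᵐ p : Plane × Plane ∂(ν.prod volume),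
      v p.2 ≤ 0 → 0 < logCutoff ((n : ℝ) + 1) p.2 → v (p.2 + p.1) ≤ 0 := fun n => by
    have hT : (0 : ℝ) < (n : ℝ) + 1 := by positivity
    obtain ⟨L, hL⟩ := logCutoff.lipschitz hT
    have h2 := interaction_nonpos_eq_zero hv h hL (logCutoff.hasCompactSupport hT)
      logCutoff.nonneg
    have hAm : MeasurableSet {x | v x ≤ 0} := measurableSet_le hv measurable_const
    have hAψ := hL.continuous.measurable.indicator hAm
    rw [lintegral_eq_zero_iff (by fun_prop)] at h2
    filter_upwards [h2] with p hp hp1 hp2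
    rw [Pi.zero_apply, ENNReal.ofReal_eq_zero, Set.indicator_of_mem (by exact hp1)] at hp
    by_contra hcon
    rw [not_le] at hcon
    have : 0 < max (v (p.2 + p.1)) 0 := lt_max_of_lt_left hcon
    nlinarith [mul_pos hp2 this]
  have h3 : ∀ᵐ p : Plane × Plane ∂(ν.prod volume), v p.2 ≤ 0 → v (p.2 + p.1) ≤ 0 := by
    filter_upwards [ae_all_iff.2 h1] with p hp hp1
    obtain ⟨n, hn⟩ := ((logCutoff.tendsto_one p.2).eventually (lt_mem_nhds zero_lt_one)).exists
    exact hp n hp1 hn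
  have h4 := (Measure.measurePreserving_swap (μ := (volume : Measure Plane))
    (ν := ν)).quasiMeasurePreserving.ae h3
  exact Measure.ae_ae_of_ae_prod h4

theorem DominatesBalls.ae_ball {κ β δ₁ : ℝ} (hd : DominatesBalls ν κ β δ₁) (hκ : 0 < κ)
    (hδ₁ : 0 < δ₁) {P : Plane → Prop} (h : ∀ᵐ z ∂ν, P z) :
    ∀ᵐ z : Plane, ‖z‖ < δ₁ → P z := by
  have h1 : ∀ᵐ z ∂(ENNReal.ofReal (κ * δ₁ ^ (-(2 + β))) • volume.restrict (Metric.ball 0 δ₁)), P z :=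
    h.filter_mono (ae_mono (hd δ₁ hδ₁ le_rfl))
  have h0 : ENNReal.ofReal (κ * δ₁ ^ (-(2 + β))) ≠ 0 := by simpa using by positivity
  rw [ae_iff, Measure.smul_apply, smul_eq_mul, mul_eq_zero, or_iff_right h0, ← ae_iff,
    ae_restrict_iff' measurableSet_ball] at h1
  simpa using h1

/-- A function whose nonpositivity set spreads at unit speed is of one sign. -/
theorem ae_pos_or_ae_nonpos {κ β δ₁ : ℝ} (hd : DominatesBalls ν κ β δ₁) (hκ : 0 < κ)
    (hδ₁ : 0 < δ₁) (h : ∀ᵐ x : Plane, ∀ᵐ z ∂ν, v x ≤ 0 → v (x + z) ≤ 0) :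
    (∀ᵐ x : Plane, 0 < v x) ∨ ∀ᵐ x : Plane, v x ≤ 0 := by
  have hgood : ∀ᵐ x : Plane, v x ≤ 0 → ∀ᵐ y : Plane, dist y x < δ₁ → v y ≤ 0 := by
    filter_upwards [h] with x hx hx0
    have h1 := hd.ae_ball hκ hδ₁ (hx.mono fun z hz => hz hx0)
    have h2 := (measurePreserving_sub_right (volume : Measure Plane) x).quasiMeasurePreserving.ae h1
    filter_upwards [h2] with y hy hyx
    rw [dist_eq_norm] at hyx
    simpa using hy hyx
  by_cases hpos : ∀ᵐ x : Plane, 0 < v x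
  · exact Or.inl hpos
  refine Or.inr ?_
  -- A version of the nonpositivity set insensitive to null sets; it is stable under moves of length
  -- less than δ₁/4, hence open and closed.
  set S := {y : Plane | ∀ᵐ w : Plane, dist w y < δ₁ / 2 → v w ≤ 0} with hS
  have hne : S.Nonempty := by
    have : ∃ᶠ x in ae (volume : Measure Plane), v x ≤ 0 := by
      rw [Filter.not_eventually] at hpos
      exact hpos.mono fun x hx => not_lt.1 hx
    obtain ⟨x, hx0, hx⟩ := (this.and_eventually hgood).exists
    exact ⟨x, (hx hx0).mono fun w hw hwx => hw (by linarith)⟩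
  have hstep : ∀ y ∈ S, ∀ y', dist y y' < δ₁ / 4 → y' ∈ S := fun y hy y' hyy' => by
    -- A generic nonpositive point x near y spreads nonpositivity to its δ₁-ball, which contains the
    -- δ₁/2-ball of y' since δ₁/2 + δ₁/4 + δ₁/4 = δ₁.
    have hfr : ∃ᶠ x in ae (volume : Measure Plane), dist x y < δ₁ / 4 := by
      intro hno
      refine (Metric.measure_ball_pos volume y (by positivity : 0 < δ₁ / 4)).ne' ?_
      refine measure_mono_null (fun x hx => ?_) (ae_iff.1 hno)
      exact not_not.2 (Metric.mem_ball.1 hx)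
    have hyw : ∀ᵐ w : Plane, dist w y < δ₁ / 2 → v w ≤ 0 := hy
    obtain ⟨x, hx1, hx2, hx3⟩ := (hfr.and_eventually (hyw.and hgood)).exists
    refine (hx3 (hx2 (by linarith))).mono fun w hw hwy => hw ?_
    calc dist w x ≤ dist w y' + dist y' x := dist_triangle _ _ _
      _ ≤ dist w y' + (dist y' y + dist y x) := by gcongr; apply dist_triangle
      _ < δ₁ := by rw [dist_comm y' y, dist_comm y x]; linarith
  have hopen : IsOpen S := Metric.isOpen_iff.2 fun y hy =>
    ⟨δ₁ / 4, by positivity, fun y' hy' => hstep y hy y' (by rwa [dist_comm])⟩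
  have hclosed : IsClosed S := ⟨Metric.isOpen_iff.2 fun y hy =>
    ⟨δ₁ / 4, by positivity, fun y' hy' hmem => hy (hstep y' hmem y hy')⟩⟩
  have huniv : S = Set.univ := IsClopen.eq_univ ⟨hclosed, hopen⟩ hne
  rw [ae_iff]
  refine measure_null_of_locally_null _ fun y _ => ?_
  have hy : y ∈ S := huniv ▸ Set.mem_univ y
  refine ⟨Metric.ball y (δ₁ / 2) ∩ {x | ¬ v x ≤ 0}, ?_, ?_⟩
  · rw [Set.inter_comm]
    exact inter_mem_nhdsWithin _ (Metric.ball_mem_nhds y (by positivity))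
  · have := ae_iff.1 hy
    refine measure_mono_null (fun w hw => ?_) this
    simp only [Set.mem_ofPred_eq, Classical.not_imp]
    exact ⟨hw.1, hw.2⟩

end Sign

/-! ### From the sign of the limit to monotonicity of `u`. -/

/-- Telescoping over 2ᵏ equal steps: the full increment is an average of translated quotients. -/
theorem sum_dyadicQuotient (u : Plane → ℝ) (e : Plane) (k : ℕ) (x : Plane) :
    u (x + e) - u x = (2⁻¹ : ℝ) ^ k * ∑ j ∈ Finset.range (2 ^ k),
      dyadicQuotient u e k (x + (j : ℝ) • ((2⁻¹ : ℝ) ^ k • e)) := by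
  have h1 : ∀ j : ℕ, dyadicQuotient u e k (x + (j : ℝ) • ((2⁻¹ : ℝ) ^ k • e)) =
      2 ^ k * (u (x + ((j + 1 : ℕ) : ℝ) • ((2⁻¹ : ℝ) ^ k • e)) -
        u (x + (j : ℝ) • ((2⁻¹ : ℝ) ^ k • e))) := fun j => by
    rw [dyadicQuotient, add_assoc]
    congr 4
    push_cast
    rw [add_smul, one_smul]
  simp only [h1]
  rw [← Finset.mul_sum, Finset.sum_range_sub fun j : ℕ => u (x + (j : ℝ) • ((2⁻¹ : ℝ) ^ k • e))]
  rw [← mul_assoc, ← mul_pow]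
  have h2 : (((2 ^ k : ℕ) : ℝ)) • ((2⁻¹ : ℝ) ^ k • e) = e := by
    rw [smul_smul]; push_cast; rw [← mul_pow]; norm_num
  rw [h2]; norm_num

/-- If the dyadic difference quotients converge to a nonnegative function then `u` increases. -/
theorem le_shift_of_dyadicQuotient_tendsto {u : Plane → ℝ} (hu : Continuous u)
    {e : Plane} {v : Plane → ℝ} {ks : ℕ → ℕ}
    (hint : ∀ n, Integrable (fun x => expWeight 0 x ^ 2 * |dyadicQuotient u e (ks n) x - v x|))
    (hlim : Tendsto (fun n => ∫ x, expWeight 0 x ^ 2 * |dyadicQuotient u e (ks n) x - v x|)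
      atTop (𝓝 0)) (hv : ∀ᵐ x, 0 ≤ v x) (x₀ : Plane) : u x₀ ≤ u (x₀ + e) := by
  by_contra! hcon
  set κ := (u x₀ - u (x₀ + e)) / 2 with hκ
  have hκ0 : 0 < κ := by rw [hκ]; linarith
  have hev : ∀ᶠ x in 𝓝 x₀, κ < u x - u (x + e) := by
    have : Continuous fun x => u x - u (x + e) := by fun_prop
    exact this.continuousAt.eventually (lt_mem_nhds (by rw [hκ]; linarith))
  obtain ⟨ρ, hρ0, hρ⟩ := Metric.eventually_nhds_iff_ball.1 hev
  set R := ‖x₀‖ + ρ + ‖e‖ with hR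
  -- If `u` dropped by κ across `e` on a small ball, the averaged negative parts of the quotients
  -- would keep a fixed mass there. Since v ≥ 0 these are at most |D - v|, whose weighted integral
  -- tends to zero.
  have key : ∀ n, κ * volume.real (Metric.ball x₀ ρ) ≤
      Real.exp R ^ 2 * ∫ x, expWeight 0 x ^ 2 * |dyadicQuotient u e (ks n) x - v x| := fun n => by
    set k := ks n
    set w : Plane → ℝ := fun x => expWeight 0 x ^ 2 * |dyadicQuotient u e k x - v x| with hw
    have hw0 : ∀ x, 0 ≤ w x := fun x => by positivity
    set τ : ℕ → Plane := fun j => (j : ℝ) • ((2⁻¹ : ℝ) ^ k • e) with hτ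
    have hwi : ∀ j, Integrable fun x => w (x + τ j) := fun j => (hint n).comp_add_right _
    have hva : ∀ᵐ x, ∀ j : ℕ, 0 ≤ v (x + τ j) := ae_all_iff.2 fun j =>
      (measurePreserving_add_right (volume : Measure Plane) (τ j)).quasiMeasurePreserving.ae hv
    have hpt : ∀ᵐ x, x ∈ Metric.ball x₀ ρ → κ ≤
        (2⁻¹ : ℝ) ^ k * ∑ j ∈ Finset.range (2 ^ k), Real.exp R ^ 2 * w (x + τ j) := by
      filter_upwards [hva] with x hx hxB
      have h1 := hρ x hxB
      have h2 := sum_dyadicQuotient u e k x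
      have h3 : -((2⁻¹ : ℝ) ^ k * ∑ j ∈ Finset.range (2 ^ k), dyadicQuotient u e k (x + τ j)) ≤
          (2⁻¹ : ℝ) ^ k * ∑ j ∈ Finset.range (2 ^ k), Real.exp R ^ 2 * w (x + τ j) := by
        rw [← mul_neg, ← Finset.sum_neg_distrib]
        gcongr with j hj
        have h4 : ‖x + τ j‖ ≤ R := by
          have a1 : ‖x‖ ≤ ‖x₀‖ + ρ := by
            have : ‖x - x₀‖ < ρ := by simpa [dist_eq_norm] using hxB
            have := norm_le_norm_add_norm_sub' x x₀
            linarith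
          have a2 : ‖τ j‖ ≤ ‖e‖ := by
            rw [hτ]; dsimp only
            rw [smul_smul, norm_smul]
            refine mul_le_of_le_one_left (norm_nonneg e) ?_
            rw [Real.norm_eq_abs, abs_of_nonneg (by positivity), inv_pow, ← div_eq_mul_inv,
              div_le_one (by positivity)]
            exact_mod_cast (Finset.mem_range.1 hj).le
          calc _ ≤ ‖x‖ + ‖τ j‖ := norm_add_le _ _
            _ ≤ R := by rw [hR]; linarith
        have h5 : 1 ≤ Real.exp R ^ 2 * expWeight 0 (x + τ j) ^ 2 := by
          rw [← mul_pow, expWeight, ← Real.exp_add, sub_zero]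
          exact one_le_pow₀ (Real.one_le_exp (by linarith))
        have h6 : -dyadicQuotient u e k (x + τ j) ≤
            |dyadicQuotient u e k (x + τ j) - v (x + τ j)| := by
          have := neg_abs_le (dyadicQuotient u e k (x + τ j) - v (x + τ j))
          linarith [hx j]
        refine h6.trans ?_
        rw [hw]; dsimp only
        rw [← mul_assoc]
        exact le_mul_of_one_le_left (abs_nonneg _) h5
      change u (x + e) - u x = (2⁻¹ : ℝ) ^ k * ∑ j ∈ Finset.range (2 ^ k),
        dyadicQuotient u e k (x + τ j) at h2
      linarith
    have hsumi : Integrable fun x =>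
        (2⁻¹ : ℝ) ^ k * ∑ j ∈ Finset.range (2 ^ k), Real.exp R ^ 2 * w (x + τ j) :=
      (integrable_finsetSum _ fun j _ => (hwi j).const_mul _).const_mul _
    calc _ = ∫ x in Metric.ball x₀ ρ, κ := by rw [setIntegral_const, smul_eq_mul, mul_comm]
      _ ≤ ∫ x in Metric.ball x₀ ρ,
          (2⁻¹ : ℝ) ^ k * ∑ j ∈ Finset.range (2 ^ k), Real.exp R ^ 2 * w (x + τ j) := by
          refine integral_mono_ae (integrableOn_const measure_ball_lt_top.ne) hsumi.integrableOn ?_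
          exact (ae_restrict_iff' measurableSet_ball).2 hpt
      _ ≤ ∫ x, (2⁻¹ : ℝ) ^ k * ∑ j ∈ Finset.range (2 ^ k), Real.exp R ^ 2 * w (x + τ j) :=
          setIntegral_le_integral hsumi (Eventually.of_forall fun x => by
            have := fun j => hw0 (x + τ j)
            positivity)
      -- All translates have the same integral, so averaging 2ᵏ of them costs nothing.
      _ = (2⁻¹ : ℝ) ^ k * ∑ j ∈ Finset.range (2 ^ k), Real.exp R ^ 2 * ∫ x, w x := by
          rw [integral_const_mul, integral_finsetSum _ fun j _ => (hwi j).const_mul _]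
          congr 1
          refine Finset.sum_congr rfl fun j _ => ?_
          rw [integral_const_mul, integral_add_right_eq_self w]
      _ = _ := by
          rw [Finset.sum_const, Finset.card_range, nsmul_eq_mul, ← mul_assoc]
          push_cast
          rw [← mul_pow]; norm_num
  have h2 := ge_of_tendsto' (hlim.const_mul (Real.exp R ^ 2)) key
  rw [mul_zero] at h2
  have h3 : 0 < volume.real (Metric.ball x₀ ρ) :=
    ENNReal.toReal_pos (Metric.measure_ball_pos volume x₀ hρ0).ne' measure_ball_lt_top.ne
  nlinarith [mul_pos hκ0 h3]

theorem expWeight.integrable_mul_abs (x₀ : Plane) {w : Plane → ℝ} (hw : Measurable w) {C : ℝ}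
    (hC : ∀ x, |w x| ≤ C) : Integrable (fun x => expWeight x₀ x ^ 2 * |w x|) :=
  (expWeight.integrable x₀).mul_bdd (c := C) (Measurable.aestronglyMeasurable (by fun_prop))
    (Eventually.of_forall fun x => by rw [Real.norm_eq_abs, abs_abs]; exact hC x)

/-- A sequence whose consecutive differences decay geometrically in a weighted `L¹` norm converges
almost everywhere and in that norm. -/
theorem expWeight.exists_limit {D : ℕ → Plane → ℝ} (hm : ∀ k, Measurable (D k)) {B : ℕ → ℝ}
    (hB : ∀ k x, |D k x| ≤ B k) {A p : ℝ} (hp : 0 ≤ p) (hp1 : p < 1)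
    (h : ∀ k, ∫ x, expWeight 0 x ^ 2 * |D (k + 1) x - D k x| ≤ A * p ^ k) :
    ∃ v : Plane → ℝ, Measurable v ∧ (∀ᵐ x, Tendsto (fun k => D k x) atTop (𝓝 (v x))) ∧
      (∀ k, Integrable fun x => expWeight 0 x ^ 2 * |D k x - v x|) ∧
      Tendsto (fun k => ∫ x, expWeight 0 x ^ 2 * |D k x - v x|) atTop (𝓝 0) := by
  have hw := (expWeight.continuous 0).measurable
  have hint : ∀ i j, Integrable fun x => expWeight 0 x ^ 2 * |D i x - D j x| := fun i j => by
    have h1 := hm i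
    have h2 := hm j
    exact expWeight.integrable_mul_abs 0 (C := B i + B j) (by fun_prop) fun x =>
      (abs_sub _ _).trans (add_le_add (hB i x) (hB j x))
  have hA : 0 ≤ A := by
    have := (integral_nonneg fun x => by positivity).trans (h 0)
    simpa using this
  have hgs := (summable_geometric_of_lt_one hp hp1).mul_left A
  have hlint : ∀ i j, ∫⁻ x, ENNReal.ofReal (expWeight 0 x ^ 2 * |D i x - D j x|) =
      ENNReal.ofReal (∫ x, expWeight 0 x ^ 2 * |D i x - D j x|) := fun i j =>
    (ofReal_integral_eq_lintegral_ofReal (hint i j)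
      (Eventually.of_forall fun x => by positivity)).symm
  have hconv : ∀ᵐ x, ∃ l, Tendsto (fun k => D k x) atTop (𝓝 l) := by
    -- The integrated total variation of the sequence is finite, so almost everywhere the sequence
    -- is Cauchy.
    have hfin : ∫⁻ x, ∑' k, ENNReal.ofReal (expWeight 0 x ^ 2 * |D (k + 1) x - D k x|) ≠ ⊤ := by
      rw [lintegral_tsum fun k => by
        have h1 := hm k
        have h2 := hm (k + 1)
        exact Measurable.aemeasurable (by fun_prop)]
      refine ne_top_of_le_ne_top ?_ (ENNReal.tsum_le_tsum fun k =>
        (hlint _ _).trans_le (ENNReal.ofReal_le_ofReal (h k)))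
      rw [← ENNReal.ofReal_tsum_of_nonneg (fun k => by positivity) hgs]
      exact ENNReal.ofReal_ne_top
    have hmeas : Measurable fun x =>
        ∑' k, ENNReal.ofReal (expWeight 0 x ^ 2 * |D (k + 1) x - D k x|) := by fun_prop
    filter_upwards [ae_lt_top hmeas hfin] with x hx
    have h1 := ENNReal.summable_toReal hx.ne
    have h2 : Summable fun k => dist (D k x) (D k.succ x) := by
      have h3 := h1.mul_left (expWeight 0 x ^ 2)⁻¹
      refine h3.congr fun k => ?_
      have h4 := expWeight.pos 0 x
      rw [ENNReal.toReal_ofReal (by positivity), inv_mul_cancel_left₀ (by positivity),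
        dist_comm, Real.dist_eq]
    exact cauchySeq_tendsto_of_complete (cauchySeq_of_summable_dist h2)
  obtain ⟨v, hvm, hv⟩ := measurable_limit_of_tendsto_metrizable_ae (L := atTop)
    (fun k => (hm k).aemeasurable) hconv
  have htel : ∀ k n, ∫ x, expWeight 0 x ^ 2 * |D k x - D (n + k) x| ≤ A * p ^ k * (1 - p)⁻¹ :=
      fun k n => by
    calc _ ≤ ∫ x, ∑ j ∈ Finset.range n,
          expWeight 0 x ^ 2 * |D (j + k + 1) x - D (j + k) x| := by
          refine integral_mono (hint _ _) (integrable_finsetSum _ fun j _ => hint _ _) fun x => ?_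
          dsimp only
          rw [← Finset.mul_sum, abs_sub_comm]
          gcongr
          have h1 := Finset.sum_range_sub (fun j => D (j + k) x) n
          rw [zero_add] at h1
          rw [← h1]
          simp only [add_right_comm _ 1 k]
          exact Finset.abs_sum_le_sum_abs _ _
      _ = ∑ j ∈ Finset.range n, ∫ x, expWeight 0 x ^ 2 * |D (j + k + 1) x - D (j + k) x| :=
          integral_finsetSum _ fun j _ => hint _ _
      _ ≤ ∑ j ∈ Finset.range n, A * p ^ k * p ^ j :=
          Finset.sum_le_sum fun j _ => (h _).trans_eq (by rw [pow_add]; ring)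
      _ ≤ A * p ^ k * (1 - p)⁻¹ := by
          rw [← Finset.mul_sum, ← tsum_geometric_of_lt_one hp hp1]
          gcongr
          exact (summable_geometric_of_lt_one hp hp1).sum_le_tsum _ fun i _ => by positivity
  -- Fatou in the second index of the telescoped bound gives the rate of convergence to `v`.
  have hbound : ∀ k, ∫⁻ x, ENNReal.ofReal (expWeight 0 x ^ 2 * |D k x - v x|) ≤
      ENNReal.ofReal (A * p ^ k * (1 - p)⁻¹) := fun k => by
    calc _ = ∫⁻ x, liminf (fun n =>
          ENNReal.ofReal (expWeight 0 x ^ 2 * |D k x - D (n + k) x|)) atTop := by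
          refine lintegral_congr_ae ?_
          filter_upwards [hv] with x hx
          refine (Tendsto.liminf_eq ?_).symm
          refine (ENNReal.continuous_ofReal.tendsto _).comp (Tendsto.const_mul _ ?_)
          exact (((tendsto_add_atTop_iff_nat k).2 hx).const_sub _).abs
      _ ≤ liminf (fun n => ∫⁻ x,
          ENNReal.ofReal (expWeight 0 x ^ 2 * |D k x - D (n + k) x|)) atTop :=
          lintegral_liminf_le fun n => by
            have h1 := hm k
            have h2 := hm (n + k)
            fun_prop
      _ ≤ liminf (fun _ : ℕ => ENNReal.ofReal (A * p ^ k * (1 - p)⁻¹)) atTop :=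
          liminf_le_liminf (Eventually.of_forall fun n =>
            (hlint _ _).trans_le (ENNReal.ofReal_le_ofReal (htel k n)))
      _ = _ := liminf_const _
  have hinv : ∀ k, Integrable fun x => expWeight 0 x ^ 2 * |D k x - v x| := fun k => by
    have h1 := hm k
    refine ⟨Measurable.aestronglyMeasurable (by fun_prop), ?_⟩
    rw [hasFiniteIntegral_iff_ofReal (Eventually.of_forall fun x => by positivity)]
    exact (hbound k).trans_lt ENNReal.ofReal_lt_top
  refine ⟨v, hvm, hv, hinv, ?_⟩
  have hp1' : 0 < 1 - p := by linarith
  refine squeeze_zero (g := fun k => A * p ^ k * (1 - p)⁻¹)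
    (fun k => integral_nonneg fun x => by positivity) (fun k => ?_) ?_
  · rw [← ENNReal.ofReal_le_ofReal_iff (by positivity), ofReal_integral_eq_lintegral_ofReal
      (hinv k) (Eventually.of_forall fun x => by positivity)]
    exact hbound k
  · have := ((tendsto_pow_atTop_nhds_zero_of_lt_one hp hp1).const_mul A).mul_const (1 - p)⁻¹
    simpa using this

theorem dyadicQuotient_neg (u : Plane → ℝ) (e : Plane) (k : ℕ) (x : Plane) :
    dyadicQuotient (fun x => -u x) e k x = -dyadicQuotient u e k x := by
  simp only [dyadicQuotient]; ring

/-- A bounded stable solution is monotone along every short increment. -/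
theorem PVSolution.exists_le_shift_or {ν : Measure Plane} [SFinite ν] {δ₀ δ₁ κ β : ℝ}
    (hν : FiniteRange ν δ₀) (hδ : 0 ≤ δ₀) (hd : DominatesBalls ν κ β δ₁) (hκ : 0 < κ)
    (hδ₁ : 0 < δ₁) (hβ0 : 0 < β) (hβ : β ≤ 2) {u F c : Plane → ℝ} {M M' K : ℝ}
    (hu : Continuous u) (hM : ∀ x, |u x| ≤ M) (hF : Continuous F) (hM' : ∀ x, |F x| ≤ M')
    (hK : ∀ x y, |F y - F x| ≤ K * |u y - u x|) (h : PVSolution ν u F)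
    (hs : StableFor ν c) (hc : Continuous c)
    (hlin : ∀ R ω : ℝ, 0 < ω → ∃ δ > 0, ∀ x h : Plane, ‖x‖ ≤ R → ‖h‖ < δ →
      |F (x + h) - F x - c x * (u (x + h) - u x)| ≤ ω * |u (x + h) - u x|) :
    ∃ r : ℝ, 0 < r ∧ ∀ e : Plane, ‖e‖ ≤ r →
      (∀ x, u x ≤ u (x + e)) ∨ ∀ x, u (x + e) ≤ u x := by
  obtain ⟨r, C, p, hr, hC, hp, hp1, H⟩ :=
    h.exists_dyadicQuotient_le hν hδ hd hκ hδ₁ hβ0 hβ hu hM hF hM' hK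
  refine ⟨r, hr, fun e her => ?_⟩
  by_cases he : e = 0
  · simp [he]
  have hDm : ∀ k, Measurable (dyadicQuotient u e k) :=
    fun k => (continuous_dyadicQuotient hu e k).measurable
  have hDb := abs_dyadicQuotient_le hM e
  set W := ∫ x, expWeight 0 x ^ 2 with hW
  have hstep : ∀ k, ∫ x, expWeight 0 x ^ 2 *
      |dyadicQuotient u e (k + 1) x - dyadicQuotient u e k x| ≤ (C + W) * p ^ k := fun k => by
    have hpk : 0 < p ^ k := by positivity
    have h1 := hDm k
    have h2 := hDm (k + 1)
    have hb : ∀ x, |dyadicQuotient u e (k + 1) x - dyadicQuotient u e k x| ≤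
        2 ^ (k + 1) * (M + M) + 2 ^ k * (M + M) := fun x =>
      (abs_sub _ _).trans (add_le_add (hDb _ x) (hDb _ x))
    have i1 : Integrable fun x => expWeight 0 x ^ 2 *
        (dyadicQuotient u e (k + 1) x - dyadicQuotient u e k x) ^ 2 :=
      expWeight.integrable_mul 0 (by fun_prop) hb
    have i2 : Integrable fun x => expWeight 0 x ^ 2 *
        |dyadicQuotient u e (k + 1) x - dyadicQuotient u e k x| :=
      expWeight.integrable_mul_abs 0 (by fun_prop) hb
    calc _ ≤ ∫ x, ((p ^ k)⁻¹ * (expWeight 0 x ^ 2 *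
          (dyadicQuotient u e (k + 1) x - dyadicQuotient u e k x) ^ 2) +
          p ^ k * expWeight 0 x ^ 2) := by
          refine integral_mono i2 ((i1.const_mul _).add ((expWeight.integrable 0).const_mul _))
            fun x => ?_
          set a := dyadicQuotient u e (k + 1) x - dyadicQuotient u e k x
          -- Young's inequality with parameter p^k turns the mean square rate (p^k)² into the L¹
          -- rate p^k, the weight having finite total mass.
          have key : |a| ≤ (p ^ k)⁻¹ * a ^ 2 + p ^ k := by
            rw [← sq_abs a, inv_mul_eq_div, ← sub_le_iff_le_add, le_div_iff₀ hpk]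
            nlinarith [sq_nonneg (|a| - p ^ k), abs_nonneg a]
          calc _ ≤ expWeight 0 x ^ 2 * ((p ^ k)⁻¹ * a ^ 2 + p ^ k) := by gcongr
            _ = _ := by ring
      _ = (p ^ k)⁻¹ * (∫ x, expWeight 0 x ^ 2 *
          (dyadicQuotient u e (k + 1) x - dyadicQuotient u e k x) ^ 2) + p ^ k * W := by
          rw [integral_add (i1.const_mul _) ((expWeight.integrable 0).const_mul _),
            integral_const_mul, integral_const_mul]
      _ ≤ (p ^ k)⁻¹ * (C * (p ^ k) ^ 2) + p ^ k * W := by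
          gcongr
          exact (H e 0 he her k).2
      _ = (C + W) * p ^ k := by field_simp
  obtain ⟨v, hvm, hv, hvi, hvl⟩ := expWeight.exists_limit hDm hDb hp.le hp1 hstep
  have hint := fun (ψ : Plane → ℝ) (L : NNReal) (hψ : LipschitzWith L ψ)
      (hψs : HasCompactSupport ψ) =>
    h.interaction_limit_le hν hδ hu hM hF hM' hs hc hlin (fun x₀ k => (H e x₀ he her k).1)
      tendsto_id hv hvm hψ hψs
  rcases ae_pos_or_ae_nonpos hd hκ hδ₁ (ae_nonpos_shift hvm hint) with hsgn | hsgn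
  · exact Or.inl fun x => le_shift_of_dyadicQuotient_tendsto hu (ks := id) hvi hvl
      (hsgn.mono fun x hx => hx.le) x
  · refine Or.inr fun x => ?_
    have e1 : ∀ k x, |dyadicQuotient (fun x => -u x) e k x - -v x| =
        |dyadicQuotient u e k x - v x| := fun k x => by
      rw [dyadicQuotient_neg, neg_sub_neg, abs_sub_comm]
    have := le_shift_of_dyadicQuotient_tendsto (u := fun x => -u x) hu.neg (e := e)
      (v := fun x => -v x) (ks := id) (by simpa only [e1, id] using hvi)
      (by simpa only [e1, id] using hvl)
      (hsgn.mono fun x hx => neg_nonneg.2 hx) x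
    exact neg_le_neg_iff.1 this

/-! ### Monotonicity in every direction forces one-dimensionality. -/

section Monotone

variable {u : Plane → ℝ}

/-- Iterating steps 2⁻ᵏ reaches ⌊t 2ᵏ⌋ 2⁻ᵏ, which tends to t; infinitely many k suffice because `u`
is continuous. -/
theorem le_add_smul_of_frequently (hu : Continuous u) {e : Plane}
    (h : ∃ᶠ k : ℕ in atTop, ∀ x, u x ≤ u (x + (2⁻¹ : ℝ) ^ k • e)) (x : Plane) {t : ℝ}
    (ht : 0 ≤ t) : u x ≤ u (x + t • e) := by
  have hiter : ∀ k : ℕ, (∀ x, u x ≤ u (x + (2⁻¹ : ℝ) ^ k • e)) →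
      ∀ m : ℕ, u x ≤ u (x + (m * (2⁻¹ : ℝ) ^ k) • e) := fun k hk m => by
    induction m with
    | zero => simp
    | succ m ih =>
      refine ih.trans ((hk _).trans_eq ?_)
      rw [add_assoc, ← add_smul]
      push_cast
      ring_nf
  have h1 : Tendsto (fun k : ℕ => ((⌊t * 2 ^ k⌋₊ : ℕ) : ℝ) * (2⁻¹ : ℝ) ^ k) atTop (𝓝 t) := by
    have := (tendsto_nat_floor_mul_div_atTop ht).comp
      (tendsto_pow_atTop_atTop_of_one_lt (one_lt_two (α := ℝ)))
    refine this.congr fun k => ?_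
    simp [div_eq_mul_inv]
  have h2 : Tendsto (fun k : ℕ => x + (((⌊t * 2 ^ k⌋₊ : ℕ) : ℝ) * (2⁻¹ : ℝ) ^ k) • e) atTop
      (𝓝 (x + t • e)) := (h1.smul_const e).const_add x
  have hcl : IsClosed {y | u x ≤ u y} := isClosed_le continuous_const hu
  exact hcl.mem_of_frequently_of_tendsto (h.mono fun k hk => hiter k hk _) h2

/-- The sign may depend on the scale, but one of the two occurs at infinitely many dyadic scales. -/
theorem monotone_or_monotone_neg (hu : Continuous u) {r : ℝ} (hr : 0 < r)
    (h : ∀ e : Plane, ‖e‖ ≤ r → (∀ x, u x ≤ u (x + e)) ∨ ∀ x, u (x + e) ≤ u x) (e : Plane) :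
    (∀ x (t : ℝ), 0 ≤ t → u x ≤ u (x + t • e)) ∨ ∀ x (t : ℝ), 0 ≤ t → u x ≤ u (x + t • -e) := by
  have h0 : Tendsto (fun k : ℕ => ‖(2⁻¹ : ℝ) ^ k • e‖) atTop (𝓝 0) := by
    have h1 : Tendsto (fun k : ℕ => (2⁻¹ : ℝ) ^ k) atTop (𝓝 0) :=
      tendsto_pow_atTop_nhds_zero_of_lt_one (by norm_num) (by norm_num)
    simpa using (h1.smul_const e).norm
  have h1 : ∃ᶠ k : ℕ in atTop, (∀ x, u x ≤ u (x + (2⁻¹ : ℝ) ^ k • e)) ∨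
      ∀ x, u x ≤ u (x + (2⁻¹ : ℝ) ^ k • -e) := by
    refine ((h0.eventually (ge_mem_nhds hr)).mono fun k hk => ?_).frequently
    refine (h _ hk).imp_right fun H x => ?_
    have := H (x + (2⁻¹ : ℝ) ^ k • -e)
    simpa using this
  rcases frequently_or_distrib.1 h1 with h2 | h2
  · exact Or.inl fun x t ht => le_add_smul_of_frequently hu h2 x ht
  · exact Or.inr fun x t ht => le_add_smul_of_frequently hu h2 x ht

/-- A continuous function of the plane that is monotone along every short increment is
one-dimensional. -/
theorem isOneDimensional_of_le_shift_or (hu : Continuous u) {r : ℝ} (hr : 0 < r)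
    (h : ∀ e : Plane, ‖e‖ ≤ r → (∀ x, u x ≤ u (x + e)) ∨ ∀ x, u (x + e) ≤ u x) :
    IsOneDimensional u := by
  set S := {e : Plane | ∀ x (t : ℝ), 0 ≤ t → u x ≤ u (x + t • e)} with hS
  have hSc : IsClosed S := by
    have : S = ⋂ (x : Plane) (t : ℝ) (_ : 0 ≤ t), {e | u x ≤ u (x + t • e)} := by
      ext e; simp [hS]
    rw [this]
    exact isClosed_iInter fun x => isClosed_iInter fun t => isClosed_iInter fun _ =>
      isClosed_le continuous_const (by fun_prop)
  have hSn : IsClosed {e : Plane | -e ∈ S} := hSc.preimage continuous_neg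
  have hor : ∀ e, e ∈ S ∨ -e ∈ S := monotone_or_monotone_neg hu hr h
  have hne : ∃ e : Plane, ‖e‖ = 1 ∧ e ∈ S := by
    have h1 : ‖(EuclideanSpace.single 0 1 : Plane)‖ = 1 := by simp
    rcases hor (EuclideanSpace.single 0 1) with h2 | h2
    · exact ⟨_, h1, h2⟩
    · exact ⟨_, by rwa [norm_neg], h2⟩
  obtain ⟨e', he', heS'⟩ := hne
  have hrank : 1 < Module.rank ℝ Plane := by
    rw [← Module.finrank_eq_rank]
    simp
  -- Two closed nonempty sets covering the connected unit circle meet.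
  obtain ⟨e, he, heS, heS2⟩ := isPreconnected_closed_iff.1
    (isPreconnected_sphere hrank (0 : Plane) 1) S {e | -e ∈ S} hSc hSn (fun e _ => hor e)
    ⟨e', by simpa using he', heS'⟩ ⟨-e', by simpa using he', by simpa using heS'⟩
  have he1 : ‖e‖ = 1 := by simpa using he
  have hpos : ∀ x (t : ℝ), 0 ≤ t → u (x + t • e) = u x := fun x t ht =>
    le_antisymm (by simpa using heS2 (x + t • e) t ht) (heS x t ht)
  have hconst : ∀ x (t : ℝ), u (x + t • e) = u x := fun x t => by
    rcases le_total 0 t with ht | ht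
    · exact hpos x t ht
    · have := hpos (x + t • e) (-t) (by linarith)
      simpa using this.symm
  have hsq : e 0 ^ 2 + e 1 ^ 2 = 1 := by
    have := EuclideanSpace.norm_sq_eq e
    rw [he1] at this
    simpa [Fin.sum_univ_two] using this.symm
  -- The unit normal to the direction of constancy.
  set p : Plane := !₂[-e 1, e 0] with hp
  refine ⟨p, fun s => u (s • p), ?_, fun x => ?_⟩
  · have : ‖p‖ ^ 2 = 1 := by
      rw [EuclideanSpace.norm_sq_eq, Fin.sum_univ_two]
      simp [hp]
      linarith
    nlinarith [norm_nonneg p]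
  · have hx : x = inner ℝ p x • p + inner ℝ e x • e := by
      ext i
      fin_cases i
      · simp [hp, PiLp.inner_apply, Fin.sum_univ_two]
        linear_combination -(x 0) * hsq
      · simp [hp, PiLp.inner_apply, Fin.sum_univ_two]
        linear_combination -(x 1) * hsq
    dsimp only
    conv_lhs => rw [hx]
    exact hconst _ _

end Monotone

/-! ### Linearisation of the nonlinearity along `u`. -/

section Nonlinearity

/-- Mean value inequality for t ↦ f(t) - f'(a)t, with f' uniformly continuous on [-M, M]. -/
theorem abs_sub_sub_deriv_mul_le {f : ℝ → ℝ} (hf : ContDiff ℝ 1 f) {M ω : ℝ} (hω : 0 < ω) :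
    ∃ δ > 0, ∀ a b : ℝ, |a| ≤ M → |b| ≤ M → |b - a| < δ →
      |f b - f a - deriv f a * (b - a)| ≤ ω * |b - a| := by
  have hc : Continuous (deriv f) := hf.continuous_deriv le_rfl
  have hd : Differentiable ℝ f := hf.differentiable one_ne_zero
  have huc := (isCompact_Icc (a := -M) (b := M)).uniformContinuousOn_of_continuous hc.continuousOn
  obtain ⟨δ, hδ0, hδ⟩ := Metric.uniformContinuousOn_iff.1 huc ω hω
  refine ⟨δ, hδ0, fun a b ha hb hab => ?_⟩
  have key := (convex_uIcc a b).norm_image_sub_le_of_norm_deriv_le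
    (f := fun t => f t - deriv f a * t) (C := ω) (fun t _ => by fun_prop) (fun t ht => ?_)
    Set.left_mem_uIcc Set.right_mem_uIcc
  · rw [Real.norm_eq_abs, Real.norm_eq_abs] at key
    convert key using 2
    ring
  · have h1 : deriv (fun t => f t - deriv f a * t) t = deriv f t - deriv f a := by
      rw [deriv_fun_sub (hd t) (by fun_prop)]
      simp
    rw [h1, ← dist_eq_norm]
    have hsub : Set.uIcc a b ⊆ Set.Icc (-M) M :=
      Set.uIcc_subset_Icc (abs_le.1 ha) (abs_le.1 hb)
    refine (hδ t (hsub ht) a (hsub Set.left_mem_uIcc) ?_).le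
    rw [Real.dist_eq]
    exact (Set.abs_sub_left_of_mem_uIcc ht).trans_lt hab

theorem exists_linearization_le {f : ℝ → ℝ} (hf : ContDiff ℝ 1 f) {u : Plane → ℝ}
    (hu : Continuous u) {M : ℝ} (hM : ∀ x, |u x| ≤ M) (R ω : ℝ) (hω : 0 < ω) :
    ∃ δ > 0, ∀ x h : Plane, ‖x‖ ≤ R → ‖h‖ < δ →
      |f (u (x + h)) - f (u x) - deriv f (u x) * (u (x + h) - u x)| ≤
        ω * |u (x + h) - u x| := by
  obtain ⟨δ, hδ0, hδ⟩ := abs_sub_sub_deriv_mul_le hf (M := M) hω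
  have huc := (isCompact_closedBall (0 : Plane) (R + 1)).uniformContinuousOn_of_continuous
    hu.continuousOn
  obtain ⟨r, hr0, hr⟩ := Metric.uniformContinuousOn_iff.1 huc δ hδ0
  refine ⟨min r 1, lt_min hr0 one_pos, fun x h hx hh => hδ _ _ (hM _) (hM _) ?_⟩
  rw [← Real.dist_eq]
  have h1 := norm_add_le x h
  refine hr _ ?_ _ ?_ ?_
  · rw [mem_closedBall_zero_iff]; linarith [min_le_right r 1]
  · rw [mem_closedBall_zero_iff]; linarith
  · simpa [dist_eq_norm] using hh.trans_le (min_le_left r 1)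

theorem ContDiff.exists_abs_sub_le {f : ℝ → ℝ} (hf : ContDiff ℝ 1 f) (M : ℝ) :
    ∃ K, ∀ a b : ℝ, |a| ≤ M → |b| ≤ M → |f b - f a| ≤ K * |b - a| := by
  obtain ⟨K, hK⟩ := (isCompact_Icc (a := -M) (b := M)).exists_bound_of_continuousOn
    (hf.continuous_deriv le_rfl).continuousOn
  exact ⟨K, fun a b ha hb => (convex_Icc (-M) M).norm_image_sub_le_of_norm_deriv_le
    (fun t _ => (hf.differentiable one_ne_zero) t) hK (abs_le.1 ha) (abs_le.1 hb)⟩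

end Nonlinearity

/-! ### From truncated kernels to jump measures, and the conclusion. -/

/-- The measure with density `J`. -/
noncomputable def kernelMeasure (J : Plane → ℝ) : Measure Plane :=
  volume.withDensity fun z => ENNReal.ofReal (J z)

instance (J : Plane → ℝ) : SFinite (kernelMeasure J) := by
  unfold kernelMeasure; infer_instance

namespace IsJumpKernel

variable {J : Plane → ℝ}

theorem add {J' : Plane → ℝ} (hJ : IsJumpKernel J) (hJ' : IsJumpKernel J') :
    IsJumpKernel fun z => J z + J' z where
  measurable := hJ.measurable.add hJ'.measurable
  nonneg z := add_nonneg (hJ.nonneg z) (hJ'.nonneg z)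
  even z := by rw [hJ.even, hJ'.even]

theorem integrable_iff (hJ : IsJumpKernel J) {g : Plane → ℝ} :
    Integrable g (kernelMeasure J) ↔ Integrable fun z => J z * g z := by
  rw [kernelMeasure, integrable_withDensity_iff_integrable_smul' hJ.measurable.ennreal_ofReal
    (by simp)]
  simp only [ENNReal.toReal_ofReal (hJ.nonneg _), smul_eq_mul]

theorem setIntegral_eq (hJ : IsJumpKernel J) (g : Plane → ℝ) {s : Set Plane}
    (hs : MeasurableSet s) : ∫ z in s, g z ∂(kernelMeasure J) = ∫ z in s, J z * g z := by
  rw [kernelMeasure, setIntegral_withDensity_eq_setIntegral_toReal_smul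
    hJ.measurable.ennreal_ofReal (by simp) _ hs]
  simp only [ENNReal.toReal_ofReal (hJ.nonneg _), smul_eq_mul]

/-- Integrals against the kernel centred at `x` in terms of the kernel measure. -/
theorem setIntegral_shift (hJ : IsJumpKernel J) (g : Plane → ℝ) (x : Plane) {s : Set Plane}
    (hs : MeasurableSet s) (hneg : ∀ z, -z ∈ s ↔ z ∈ s) :
    ∫ y in {y | x - y ∈ s}, g y * J (x - y) = ∫ z in s, g (x + z) ∂(kernelMeasure J) := by
  have hs' : MeasurableSet {y | x - y ∈ s} := hs.preimage (by fun_prop : Measurable (x - ·))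
  rw [hJ.setIntegral_eq _ hs, ← integral_indicator hs', ← integral_indicator hs,
    ← integral_add_left_eq_self _ x]
  congr 1
  ext z
  have h1 : x - (x + z) = -z := by abel
  have h2 : x + z ∈ {y | x - y ∈ s} ↔ z ∈ s := by
    rw [Set.mem_ofPred_eq, h1, hneg]
  by_cases hz : z ∈ s
  · rw [Set.indicator_of_mem hz, Set.indicator_of_mem (h2.2 hz), h1, hJ.even, mul_comm]
  · rw [Set.indicator_of_notMem hz, Set.indicator_of_notMem fun h => hz (h2.1 h)]

theorem measurePreserving_neg (hJ : IsJumpKernel J) :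
    MeasurePreserving (fun z : Plane => -z) (kernelMeasure J) (kernelMeasure J) := by
  refine ⟨measurable_neg, ?_⟩
  ext s hs
  rw [Measure.map_apply measurable_neg hs, kernelMeasure, withDensity_apply _ hs,
    withDensity_apply _ (hs.preimage measurable_neg)]
  have := (Measure.measurePreserving_neg (volume : Measure Plane)).setLIntegral_comp_preimage hs
    hJ.measurable.ennreal_ofReal
  simp only [Neg.neg] at this ⊢
  rw [← this]
  exact lintegral_congr fun z => by
    have := hJ.even z
    simp only [Neg.neg] at this
    rw [this]

end IsJumpKernel

namespace TruncatedBounds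

variable {lam Lam δ₁ δ₀ β α : ℝ} {J : Plane → ℝ}

theorem eq_zero (hb : TruncatedBounds lam Lam δ₁ δ₀ β α J) (hJ : IsJumpKernel J) {z : Plane}
    (hz0 : z ≠ 0) (hz : δ₀ < ‖z‖) : J z = 0 := by
  have h := (hb z hz0).2
  rw [Set.indicator_of_notMem (by simpa using hz)] at h
  exact le_antisymm h (hJ.nonneg z)

theorem mul_norm_sq_le (hb : TruncatedBounds lam Lam δ₁ δ₀ β α J)
    {z : Plane} (hz0 : z ≠ 0) (hz : ‖z‖ ≤ δ₀) : J z * ‖z‖ ^ 2 ≤ Lam * ‖z‖ ^ (-α) := by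
  have h := (hb z hz0).2
  have hn : 0 < ‖z‖ := norm_pos_iff.2 hz0
  rw [Set.indicator_of_mem (by simpa using hz), Nat.cast_ofNat, Real.rpow_add hn,
    Real.rpow_two] at h
  calc _ ≤ Lam / (‖z‖ ^ 2 * ‖z‖ ^ α) * ‖z‖ ^ 2 := by gcongr
    _ = _ := by rw [Real.rpow_neg hn.le]; field_simp

/-- In polar coordinates the bound is r^(1-α), integrable at the origin because α < 2. -/
theorem integrable_mul_norm_sq (hb : TruncatedBounds lam Lam δ₁ δ₀ β α J) (hJ : IsJumpKernel J)
    (hLam : 0 ≤ Lam) (hα : α < 2) : Integrable fun z => J z * ‖z‖ ^ 2 := by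
  have h1 : IntegrableOn (fun z : Plane => Lam * ‖z‖ ^ (-α)) (Metric.ball 0 (δ₀ + 1)) := by
    refine Integrable.const_mul ?_ _
    rw [← IntegrableOn, integrableOn_fun_norm_addHaar (μ := (volume : Measure Plane))
      (f := fun t : ℝ => t ^ (-α))]
    rcases le_or_gt (δ₀ + 1) 0 with h0 | h0
    · rw [Set.Ioo_eq_empty (by linarith)]; exact integrableOn_empty
    refine ((intervalIntegral.integrableOn_Ioo_rpow_iff (s := 1 - α) h0).2 (by linarith)).congr_fun
      (fun y hy => ?_) measurableSet_Ioo
    simp only [finrank_euclideanSpace, Fintype.card_fin, smul_eq_mul]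
    rw [sub_eq_add_neg, Real.rpow_add hy.1, Real.rpow_one]
    simp
  have hm := hJ.measurable
  refine (h1.integrable_indicator measurableSet_ball).mono'
    (Measurable.aestronglyMeasurable (by fun_prop)) ?_
  filter_upwards [Measure.ae_ne volume (0 : Plane)] with z hz
  have h2 := hJ.nonneg z
  rw [Real.norm_eq_abs, abs_of_nonneg (by positivity)]
  by_cases hzδ : ‖z‖ ≤ δ₀
  · rw [Set.indicator_of_mem (by rw [mem_ball_zero_iff]; linarith)]
    exact hb.mul_norm_sq_le hz hzδ
  · rw [hb.eq_zero hJ hz (not_le.1 hzδ), zero_mul]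
    exact Set.indicator_nonneg (fun w _ => by positivity) z

theorem finiteRange_kernelMeasure {β' α' : ℝ} {J' : Plane → ℝ}
    (hb : TruncatedBounds lam Lam δ₁ δ₀ β α J) (hb' : TruncatedBounds lam Lam δ₁ δ₀ β' α' J')
    (hJ : IsJumpKernel J) (hJ' : IsJumpKernel J') (hLam : 0 ≤ Lam)
    (hα : α < 2) (hα' : α' < 2) :
    FiniteRange (kernelMeasure fun z => J z + J' z) δ₀ where
  neg := (hJ.add hJ').measurePreserving_neg
  range := by
    rw [kernelMeasure, ae_withDensity_iff (hJ.add hJ').measurable.ennreal_ofReal]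
    filter_upwards [Measure.ae_ne volume (0 : Plane)] with z hz hne
    by_contra hcon
    rw [not_le] at hcon
    exact hne (by rw [hb.eq_zero hJ hz hcon, hb'.eq_zero hJ' hz hcon]; simp)
  sq := by
    rw [(hJ.add hJ').integrable_iff]
    simp only [add_mul]
    exact (hb.integrable_mul_norm_sq hJ hLam hα).add (hb'.integrable_mul_norm_sq hJ' hLam hα')

/-- On the ball of radius r ≤ δ₁ the lower bound `lam / |z|^(2+β)` is at least its value at radius
r. -/
theorem dominatesBalls_kernelMeasure (hb : TruncatedBounds lam Lam δ₁ δ₀ β α J)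
    (hlam : 0 < lam) (hβ : 0 < β) {K : Plane → ℝ} (hJK : ∀ z, J z ≤ K z) :
    DominatesBalls (kernelMeasure K) lam β δ₁ := fun r hr hr' => by
  refine le_trans ?_ (Measure.restrict_le_self (s := Metric.ball 0 r))
  rw [kernelMeasure, restrict_withDensity measurableSet_ball, ← withDensity_const]
  refine withDensity_mono ?_
  rw [EventuallyLE, ae_restrict_iff' measurableSet_ball]
  filter_upwards [Measure.ae_ne volume (0 : Plane)] with z hz hzr
  rw [mem_ball_zero_iff] at hzr
  have h := (hb z hz).1
  rw [Set.indicator_of_mem (by rw [mem_closedBall_zero_iff]; linarith), Nat.cast_ofNat] at h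
  refine ENNReal.ofReal_le_ofReal (le_trans ?_ (h.trans (hJK z)))
  have hn : 0 < ‖z‖ := norm_pos_iff.2 hz
  rw [Real.rpow_neg hr.le, ← div_eq_mul_inv]
  gcongr

end TruncatedBounds

theorem IsNonlocalSolution.pvSolution {K : Plane → ℝ} (hK : IsJumpKernel K) {f : ℝ → ℝ}
    {u : Plane → ℝ} (h : IsNonlocalSolution K f u) :
    PVSolution (kernelMeasure K) u fun x => f (u x) := fun x => by
  have h1 := (h.2 x).sub_const (f (u x))
  simp only [add_sub_cancel_right, zero_sub] at h1
  refine h1.congr fun ε => ?_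
  exact hK.setIntegral_shift (fun y => u y - u x) x (s := {z | ε < ‖z‖})
    (measurableSet_lt measurable_const measurable_norm) (by simp)

theorem IsNonlocalStable.stableFor {K : Plane → ℝ} (hK : IsJumpKernel K) {δ₀ : ℝ}
    (hν : FiniteRange (kernelMeasure K) δ₀) {f : ℝ → ℝ} {u : Plane → ℝ}
    (h : IsNonlocalStable K f u) :
    StableFor (kernelMeasure K) fun x => deriv f (u x) := fun ζ hζ hs => by
  obtain ⟨L, hL⟩ := hζ.lipschitzWith_of_hasCompactSupport hs one_ne_zero
  obtain ⟨B, hB⟩ := hs.exists_abs_le hL.continuous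
  have hw := hL.isWeight hs.isCompact (fun x hx => image_eq_zero_of_notMem_tsupport hx) hB δ₀
  have hi := hν.integrable_weight_sq (v := fun _ => 1) measurable_const (C := 1) (by simp) hw
  simp only [one_pow, one_mul] at hi
  refine (h ζ hζ hs).trans_eq ?_
  rw [integral_prod_symm _ hi]
  congr 2
  ext x
  have := hK.setIntegral_shift (fun y => (ζ x - ζ y) ^ 2) x MeasurableSet.univ (by simp)
  simp only [Set.mem_univ, Set.ofPred_true, Measure.restrict_univ] at this
  rw [this]
  congr 1
  ext z
  ring

theorem theorem5
    (lam Lam δ₁ δ₀ α₁ α₂ β₁ β₂ : ℝ)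
    (hlam : 0 < lam) (hLam : lam ≤ Lam)
    (hδ₁ : 0 < δ₁) (hδ₀ : δ₁ ≤ δ₀)
    (hβ₁ : 0 < β₁) (hβα₁ : β₁ ≤ α₁) (hα₁ : α₁ < 2)
    (hβ₂ : 0 < β₂) (hβα₂ : β₂ ≤ α₂) (hα₂ : α₂ < 2)
    (J₁ J₂ : EuclideanSpace ℝ (Fin 2) → ℝ)
    (hJ₁ : IsJumpKernel J₁) (hJ₂ : IsJumpKernel J₂)
    (hb₁ : TruncatedBounds lam Lam δ₁ δ₀ β₁ α₁ J₁)
    (hb₂ : TruncatedBounds lam Lam δ₁ δ₀ β₂ α₂ J₂)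
    (f : ℝ → ℝ) (hf : ContDiff ℝ 1 f)
    (u : EuclideanSpace ℝ (Fin 2) → ℝ)
    (hbdd : ∃ M : ℝ, ∀ x, |u x| ≤ M)
    (hsol : IsNonlocalSolution (fun z => J₁ z + J₂ z) f u)
    (hstab : IsNonlocalStable (fun z => J₁ z + J₂ z) f u) :
    IsOneDimensional u := by
  obtain ⟨M, hM⟩ := hbdd
  have hJ := hJ₁.add hJ₂
  have hν := hb₁.finiteRange_kernelMeasure hb₂ hJ₁ hJ₂ (hlam.le.trans hLam) hα₁ hα₂
  -- The lower bound of the first kernel alone gives the regularity gain and the spreading of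
  -- nonpositivity.
  have hd := hb₁.dominatesBalls_kernelMeasure hlam hβ₁ (K := fun z => J₁ z + J₂ z)
    fun z => le_add_of_nonneg_right (hJ₂.nonneg z)
  have hu := hsol.1
  obtain ⟨M', hM'⟩ := (isCompact_Icc (a := -M) (b := M)).exists_bound_of_continuousOn
    hf.continuous.continuousOn
  obtain ⟨K, hK⟩ := hf.exists_abs_sub_le M
  obtain ⟨r, hr, H⟩ := (hsol.pvSolution hJ).exists_le_shift_or hν (hδ₁.le.trans hδ₀) hd hlam hδ₁ hβ₁
    (hβα₁.trans hα₁.le) hu hM (hf.continuous.comp hu) (fun x => hM' _ (abs_le.1 (hM x)))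
    (fun x y => hK _ _ (hM x) (hM y)) (hstab.stableFor hJ hν)
    ((hf.continuous_deriv le_rfl).comp hu) (exists_linearization_le hf hu hM)
  exact isOneDimensional_of_le_shift_or hu hr H
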